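/- Computation takes place on a random access machine whose memory consists of arrays of natural numbers (operations: addition, subtraction, comparison) and one- or two-dimensional arrays of elements of a prime field $\mathbb F_p$ (operations $+,-,\times,\div$, equality test). A program is a fixed finite text, independent of $p$, $h$, $d$, $E$, $N$. Every executed operation, memory access, test and assignment costs one unit, so the cost bounds in particular the number of operations in $\mathbb F_p$. There is a program, the composition of seven fixed programs run one after the other, and there are absolute constants $C,m$ such that the following holds for every prime $p$, all integers $h\ge 1$, $d\ge 2$, $N\ge 0$, and every $E\in\mathbb F_p[x,y]$ with $\deg_x E\le h$, $\deg_y E\le d$, $E(0,0)=0$ and $E_y(0,0)\ne 0$. There is exactly one $f=\sum_n f_nx^n\in\mathbb F_p[[x]]$ with $f(0)=0$ and $E(x,f(x))=0$. On input $p,h,d,N$ and the coefficients of $E$, the seven programs successively compute: 1. a Mahler equation $c_0(x)f(x)+c_1(x)f(x^p)+\dots+c_K(x)f(x^{p^K})=0$, $c_k\in\mathbb F_p[x]$, $c_K\neq 0$, of minimal order $K$ among the nontrivial Mahler equations satisfied by $f$, together with the lowest degree $v_0$ and the degree $d_0$ of $c_0$, where $c_0\ne 0$; 2. the polynomials $c'_0=1$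 and $c'_k=c_kc_0^{p^k-2}$ $(1\le k\le K)$, which give a Mahler equation $\sum_{k=0}^K c'_k(x)g(x^{p^k})=0$ with trailing coefficient $1$ for the Laurent series $g=f/c_0=\sum_n g_nx^n$; 3. $f \bmod x^{v_0}$ and the negative part $g_-=\sum_{n<0}g_nx^n$ of $g$; 4. the polynomial $b$ which is the nonnegative part of $-\sum_k c'_k(x)g_-(x^{p^k})$, so that the nonnegative part $\eta=\sum_{n\ge0}g_nx^n$ of $g$ satisfies $\sum_{k=0}^K c'_k(x)\,\eta(x^{p^k})=b(x)$; 5. a $p$-linear representation $(L,(A_r)_{0\le r<p},C)$ of $\eta$, that is, $\eta_n=L A_{n_\ell}\cdots A_{n_1}A_{n_0}C$ for all $n=(n_\ell\cdots n_1n_0)_p$. Here, for a bound $D$ on the degrees of $b$ and of $a_k=-c'_k$ $(1\le k\le K)$, $A_r$ is the matrix, with respect to the family $x^i$ $(0\le i\le D)$, $x^j\eta(x^{p^k})$ $(0\le j\le D,\ 0\le k\le K)$, of the section operator $S_r\sum_n u_nx^n=\sum_n u_{pn+r}x^n$; $L$ is the row of the constant terms of the family and $C$ the column of the coordinates of $\eta$.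 (The representation is stored in structured form, through $D$, $b$, the $a_k$ and $\eta_0$, of which all the entries are read off.); 6. the coefficients $\eta_{N-i}=L A_{n_\ell}\cdots A_{n_0}C$, where $N-i=(n_\ell\cdots n_0)_p$, for all $v_0\le i\le d_0$ with $i\le N$; 7. the coefficient $f_N=\sum_{i=v_0}^{d_0}c_{0,i}\,g_{N-i}$, where $c_{0,i}$ is the coefficient of $x^i$ in $c_0$ (so $g_{N-i}=\eta_{N-i}$ for $i\le N$). The total cost is $\tilde O(d^3h^2p^{3d}\log N)$; precisely, it is at most $C\,B\,(\log(B+2))^m$ with $B=d^3h^2p^{3d}\log(N+2)$. -/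

import Mathlib

/-! ## A uniform random access machine over prime fields

Programs are finite texts which do not depend on the prime, on the polynomial or on the index.
The memory consists of arrays of natural numbers and of (two-dimensional) arrays of elements of
the prime field. Natural numbers can only be added, subtracted (truncated at zero) and compared;
field elements can be added, subtracted, multiplied, divided and tested for equality. There is no
other passage from field elements to natural numbers than the equality test.
Every operation, memory access, test and assignment costs one unit. -/

namespace FieldRAM

/-- Memory: `nat a i` is the entry `i` of the array of natural numbers called `a`, and
`fld a i j` is the entry `(i, j)` of the array of field elements called `a`. -/
structure State (p : ℕ) where
  nat : ℕ → ℕ → ℕ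
  fld : ℕ → ℕ → ℕ → ZMod p

/-- Expressions with values in the natural numbers. The name of an array is part of the text of
the program, the index is computed. -/
inductive NatExpr : Type
  | const (n : ℕ) : NatExpr
  | load (a : ℕ) (i : NatExpr) : NatExpr
  | add (x y : NatExpr) : NatExpr
  | sub (x y : NatExpr) : NatExpr

/-- Expressions with values in the field. -/
inductive FldExpr : Type
  | zero : FldExpr
  | one : FldExpr
  | load (a : ℕ) (i j : NatExpr) : FldExpr
  | add (x y : FldExpr) : FldExpr
  | sub (x y : FldExpr) : FldExpr
  | mul (x y : FldExpr) : FldExpr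
  | div (x y : FldExpr) : FldExpr

/-- Tests. -/
inductive Test : Type
  | natLt (x y : NatExpr) : Test
  | natEq (x y : NatExpr) : Test
  | fldEq (x y : FldExpr) : Test
  | neg (b : Test) : Test

/-- Programs. -/
inductive Prog : Type
  | skip : Prog
  | setNat (a : ℕ) (i x : NatExpr) : Prog
  | setFld (a : ℕ) (i j : NatExpr) (x : FldExpr) : Prog
  | seq (P Q : Prog) : Prog
  | cond (b : Test) (P Q : Prog) : Prog
  | loop (b : Test) (P : Prog) : Prog

variable {p : ℕ}

def NatExpr.eval (s : State p) : NatExpr → ℕ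
  | .const n => n
  | .load a i => s.nat a (i.eval s)
  | .add x y => x.eval s + y.eval s
  | .sub x y => x.eval s - y.eval s

def NatExpr.cost : NatExpr → ℕ
  | .const _ => 1
  | .load _ i => i.cost + 1
  | .add x y => x.cost + y.cost + 1
  | .sub x y => x.cost + y.cost + 1

def FldExpr.eval [Fact p.Prime] (s : State p) : FldExpr → ZMod p
  | .zero => 0
  | .one => 1
  | .load a i j => s.fld a (i.eval s) (j.eval s)
  | .add x y => x.eval s + y.eval s
  | .sub x y => x.eval s - y.eval s
  | .mul x y => x.eval s * y.eval s
  | .div x y => x.eval s / y.eval s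

def FldExpr.cost : FldExpr → ℕ
  | .zero => 1
  | .one => 1
  | .load _ i j => i.cost + j.cost + 1
  | .add x y => x.cost + y.cost + 1
  | .sub x y => x.cost + y.cost + 1
  | .mul x y => x.cost + y.cost + 1
  | .div x y => x.cost + y.cost + 1

def Test.Holds [Fact p.Prime] (s : State p) : Test → Prop
  | .natLt x y => x.eval s < y.eval s
  | .natEq x y => x.eval s = y.eval s
  | .fldEq x y => x.eval s = y.eval s
  | .neg b => ¬ b.Holds s

def Test.cost : Test → ℕ
  | .natLt x y => x.cost + y.cost + 1
  | .natEq x y => x.cost + y.cost + 1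
  | .fldEq x y => x.cost + y.cost + 1
  | .neg b => b.cost + 1

/-- The memory after `nat a i := x`. -/
def State.setNat (s : State p) (a i x : ℕ) : State p :=
  { s with nat := fun a' i' => if a' = a ∧ i' = i then x else s.nat a' i' }

/-- The memory after `fld a i j := x`. -/
def State.setFld (s : State p) (a i j : ℕ) (x : ZMod p) : State p :=
  { s with fld := fun a' i' j' => if a' = a ∧ i' = i ∧ j' = j then x else s.fld a' i' j' }

/-- `Exec P s t s'`: started in the memory `s`, the program `P` stops in the memory `s'` after
exactly `t` units of time (in particular after at most `t` operations in the field). -/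
inductive Exec [Fact p.Prime] : Prog → State p → ℕ → State p → Prop
  | skip (s : State p) : Exec .skip s 1 s
  | setNat (a : ℕ) (i x : NatExpr) (s : State p) :
      Exec (.setNat a i x) s (i.cost + x.cost + 1) (s.setNat a (i.eval s) (x.eval s))
  | setFld (a : ℕ) (i j : NatExpr) (x : FldExpr) (s : State p) :
      Exec (.setFld a i j x) s (i.cost + j.cost + x.cost + 1)
        (s.setFld a (i.eval s) (j.eval s) (x.eval s))
  | seq {P Q : Prog} {s s' s'' : State p} {t t' : ℕ} :
      Exec P s t s' → Exec Q s' t' s'' → Exec (.seq P Q) s (t + t') s''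
  | cond_true {b : Test} {P Q : Prog} {s s' : State p} {t : ℕ} :
      b.Holds s → Exec P s t s' → Exec (.cond b P Q) s (b.cost + t) s'
  | cond_false {b : Test} {P Q : Prog} {s s' : State p} {t : ℕ} :
      ¬ b.Holds s → Exec Q s t s' → Exec (.cond b P Q) s (b.cost + t) s'
  | loop_true {b : Test} {P : Prog} {s s' s'' : State p} {t t' : ℕ} :
      b.Holds s → Exec P s t s' → Exec (.loop b P) s' t' s'' →
      Exec (.loop b P) s (b.cost + t + t') s''
  | loop_false {b : Test} {P : Prog} {s : State p} :
      ¬ b.Holds s → Exec (.loop b P) s b.cost s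

/-- The polynomial of degree less than `len` whose coefficients are stored in row `i` of `a`. -/
noncomputable def State.poly (s : State p) (a i len : ℕ) : Polynomial (ZMod p) :=
  ∑ j ∈ Finset.range len, Polynomial.monomial j (s.fld a i j)

end FieldRAM

/-! ## Mahler operators, sections, linear representations -/

namespace MahlerMethod

open FieldRAM

variable {p : ℕ}

/-- A polynomial, seen as a Laurent series. -/
noncomputable def polyToLaurent (q : Polynomial (ZMod p)) : LaurentSeries (ZMod p) :=
  HahnSeries.ofPowerSeries ℤ (ZMod p) (q : PowerSeries (ZMod p))

/-- `f` is a power series without constant term and `E(x, f(x)) = 0`, where the inner variable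
of `E` is `x` and the outer one is `y`. -/
def IsRoot (E : Polynomial (Polynomial (ZMod p))) (f : PowerSeries (ZMod p)) : Prop :=
  PowerSeries.constantCoeff f = 0 ∧
    Polynomial.eval₂ Polynomial.coeToPowerSeries.ringHom f E = 0

/-- The Mahler operator `M`, `(M u)(x) = u(x ^ p)`, on Laurent series. -/
noncomputable def mahlerM [Fact p.Prime] (u : LaurentSeries (ZMod p)) : LaurentSeries (ZMod p) :=
  HahnSeries.embDomain
    (OrderEmbedding.ofStrictMono (fun n : ℤ => (p : ℤ) * n) (fun _ _ h =>
      mul_lt_mul_of_pos_left h (Int.natCast_pos.mpr (Fact.out : p.Prime).pos))) u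

/-- `∑_{k ≤ K} c_k(x) M ^ k`, applied to a Laurent series. -/
noncomputable def mahlerOp [Fact p.Prime] (K : ℕ) (c : ℕ → Polynomial (ZMod p))
    (u : LaurentSeries (ZMod p)) : LaurentSeries (ZMod p) :=
  ∑ k ∈ Finset.range (K + 1), polyToLaurent (c k) * mahlerM^[k] u

/-- `c_0(x) f(x) + c_1(x) f(x ^ p) + ⋯ + c_K(x) f(x ^ (p ^ K)) = 0` is a Mahler equation of
order `K`, and `f` satisfies no nontrivial Mahler equation of smaller order. -/
def IsMinimalMahlerEquation [Fact p.Prime] (f : PowerSeries (ZMod p)) (K : ℕ)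
    (c : ℕ → Polynomial (ZMod p)) : Prop :=
  c K ≠ 0 ∧ mahlerOp K c (HahnSeries.ofPowerSeries ℤ (ZMod p) f) = 0 ∧
    ∀ K' < K, ∀ c' : ℕ → Polynomial (ZMod p),
      mahlerOp K' c' (HahnSeries.ofPowerSeries ℤ (ZMod p) f) = 0 → ∀ k ≤ K', c' k = 0

/-- The nonnegative part `∑_{n ≥ 0} u_n x ^ n` of a Laurent series. -/
noncomputable def nonnegPart (u : LaurentSeries (ZMod p)) : PowerSeries (ZMod p) :=
  PowerSeries.mk fun n => u.coeff (n : ℤ)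

/-- The negative part `∑_{n < 0} u_n x ^ n` of a Laurent series. -/
noncomputable def negPart (u : LaurentSeries (ZMod p)) : LaurentSeries (ZMod p) :=
  u - HahnSeries.ofPowerSeries ℤ (ZMod p) (nonnegPart u)

/-- The section operator `S_r`, `S_r (∑ f_n x ^ n) = ∑ f_{p k + r} x ^ k`. -/
noncomputable def sectionOp (p r : ℕ) (f : PowerSeries (ZMod p)) : PowerSeries (ZMod p) :=
  PowerSeries.mk fun k => PowerSeries.coeff (p * k + r) f

/-- Row vector `L`, square matrices `A_r` (`r < p`) and column vector `C` form a linear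
representation of `h`: `h_n = L A_{n_ℓ} ⋯ A_{n_1} A_{n_0} C`, where `n = (n_ℓ ⋯ n_1 n_0)_p`. -/
def IsLinearRepresentation {ι : Type} [Fintype ι] [DecidableEq ι] (h : PowerSeries (ZMod p))
    (L : ι → ZMod p) (A : ℕ → Matrix ι ι (ZMod p)) (C : ι → ZMod p) : Prop :=
  ∀ n : ℕ, PowerSeries.coeff n h =
    L ⬝ᵥ (((p.digits n).map A).reverse.prod.mulVec C)

/-- The indices of the family `x ^ i` (`i ≤ D`), `x ^ j h(x ^ (p ^ k))` (`k ≤ K`, `j ≤ D`). -/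
abbrev FamilyIndex (K D : ℕ) : Type := Fin (D + 1) ⊕ (Fin (K + 1) × Fin (D + 1))

/-- The family `x ^ i` (`i ≤ D`), `x ^ j h(x ^ (p ^ k))` (`k ≤ K`, `j ≤ D`). -/
noncomputable def family [Fact p.Prime] (K D : ℕ) (h : PowerSeries (ZMod p)) :
    FamilyIndex K D → PowerSeries (ZMod p)
  | .inl i => PowerSeries.X ^ (i : ℕ)
  | .inr (k, j) => PowerSeries.X ^ (j : ℕ) *
      PowerSeries.expand (p ^ (k : ℕ)) (pow_ne_zero _ (Fact.out : p.Prime).ne_zero) h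

/-- The row of the constant terms of the family, in terms of the constant term `h₀` of `h`. -/
def repRow (K D : ℕ) (h₀ : ZMod p) : FamilyIndex K D → ZMod p
  | .inl i => if (i : ℕ) = 0 then 1 else 0
  | .inr (_, j) => if (j : ℕ) = 0 then h₀ else 0

/-- The column of the coordinates of `h` in the family. -/
def repCol (K D : ℕ) : FamilyIndex K D → ZMod p
  | .inl _ => 0
  | .inr (k, j) => if (k : ℕ) = 0 ∧ (j : ℕ) = 0 then 1 else 0

/-- The matrix of `S_r` with respect to the family when
`h(x) = a_0(x) + a_1(x) h(x ^ p) + ⋯ + a_K(x) h(x ^ (p ^ K))`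
(the inhomogeneous term is called `a_0`): the columns are
`S_r x ^ i`, then `S_r (x ^ j h) = S_r (x ^ j a_0) + ∑_{k < K} S_r (x ^ j a_{k+1}) h(x ^ (p ^ k))`,
then `S_r (x ^ j h(x ^ (p ^ (k + 1)))) = S_r (x ^ j) h(x ^ (p ^ k))`. All the entries are
zeros, ones, or coefficients of the `a_k`. -/
noncomputable def repMatrix (K D : ℕ) (a : ℕ → Polynomial (ZMod p)) (r : ℕ) :
    Matrix (FamilyIndex K D) (FamilyIndex K D) (ZMod p)
  | .inl m, .inl i => (Polynomial.X ^ (i : ℕ) : Polynomial (ZMod p)).coeff (p * m + r)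
  | .inr _, .inl _ => 0
  | .inl m, .inr (k', j) =>
      if (k' : ℕ) = 0 then (Polynomial.X ^ (j : ℕ) * a 0).coeff (p * m + r) else 0
  | .inr (k, m), .inr (k', j) =>
      if (k' : ℕ) = 0 then
        if (k : ℕ) + 1 ≤ K then (Polynomial.X ^ (j : ℕ) * a (k + 1)).coeff (p * m + r) else 0
      else if (k' : ℕ) = k + 1 then
        (Polynomial.X ^ (j : ℕ) : Polynomial (ZMod p)).coeff (p * m + r)
      else 0

/-! ## Where the data are stored -/

/-- The initial memory: `p`, `h`, `d`, `N`, and the coefficients of `E`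
(entry `(i, j)` is the coefficient of `x ^ i y ^ j`); everything else is zero. -/
noncomputable def inputState (p h d N : ℕ) (E : Polynomial (Polynomial (ZMod p))) : State p where
  nat a i :=
    if i = 0 then
      if a = 0 then p else if a = 1 then h else if a = 2 then d else if a = 3 then N else 0
    else 0
  fld a i j := if a = 0 then (E.coeff j).coeff i else 0

/-- The order of the stored Mahler equation. -/
def ordK (s : State p) : ℕ := s.nat 4 0

/-- The coefficients `c_0, …, c_K` of the stored Mahler equation. -/
noncomputable def coeffC (s : State p) (k : ℕ) : Polynomial (ZMod p) := s.poly 1 k (s.nat 5 0)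

/-- The stored lowest degree of `c_0`. -/
def lowDeg (s : State p) : ℕ := s.nat 6 0

/-- The stored degree of `c_0`. -/
def topDeg (s : State p) : ℕ := s.nat 7 0

/-- The coefficients `c'_0, …, c'_K` of the stored monic Mahler equation. -/
noncomputable def coeffC' (s : State p) (k : ℕ) : Polynomial (ZMod p) := s.poly 2 k (s.nat 8 0)

/-- The stored initial segment of the root, with as many terms as the lowest degree of `c_0`. -/
noncomputable def storedTrunc (s : State p) : Polynomial (ZMod p) := s.poly 3 0 (lowDeg s)

/-- The stored negative part `∑_{j < v} u_j x ^ (-(j + 1))`, `v` the lowest degree of `c_0`. -/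
noncomputable def storedNeg (s : State p) : LaurentSeries (ZMod p) :=
  ∑ j ∈ Finset.range (lowDeg s), HahnSeries.single (-((j : ℤ) + 1)) (s.fld 3 1 j)

/-- The stored right-hand side of the inhomogeneous equation. -/
noncomputable def storedRhs (s : State p) : Polynomial (ZMod p) := s.poly 4 0 (s.nat 9 0)

/-- The degree bound `D` of the stored linear representation. -/
def repD (s : State p) : ℕ := s.nat 10 0

/-- The polynomials `a_0, …, a_K`, of degree at most `D`, that hold the entries of the
matrices of the stored linear representation. -/
noncomputable def repA (s : State p) (k : ℕ) : Polynomial (ZMod p) := s.poly 5 k (repD s + 1)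

/-- The field element that determines the row of the stored linear representation. -/
def repH0 (s : State p) : ZMod p := s.fld 6 0 0

/-- The stored value of the coefficient of index `N - i` of `h`. -/
def storedTerm (s : State p) (i : ℕ) : ZMod p := s.fld 7 0 i

/-- The returned field element. -/
def output (s : State p) : ZMod p := s.fld 8 0 0

/-- The successive memories `s 0, …, s 7` are those of a run of the method via Mahler equations
for the coefficient of index `N` of the root `f` of `E`. Here `c` is the minimal-order
Mahler equation that has been found, `g = f / c_0`, and `h` is the nonnegative part of `g`. -/
structure IsMahlerRun [Fact p.Prime] (degX degY N : ℕ) (E : Polynomial (Polynomial (ZMod p)))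
    (f : PowerSeries (ZMod p)) (s : Fin 8 → State p)
    (K : ℕ) (c : ℕ → Polynomial (ZMod p))
    (g : LaurentSeries (ZMod p)) (h : PowerSeries (ZMod p)) : Prop where
  start : s 0 = inputState p degX degY N E
  /-- First a Mahler equation of minimal order is found; its trailing coefficient is not zero. -/
  order_eq : ordK (s 1) = K
  coeff_eq : ∀ k ≤ K, coeffC (s 1) k = c k
  minimal : IsMinimalMahlerEquation f K c
  trailing_ne_zero : c 0 ≠ 0
  lowDeg_eq : lowDeg (s 1) = (c 0).natTrailingDegree
  topDeg_eq : topDeg (s 1) = (c 0).natDegree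
  quotient_eq : g = HahnSeries.ofPowerSeries ℤ (ZMod p) f / polyToLaurent (c 0)
  nonneg_eq : h = nonnegPart g
  /-- Then the equation is changed into an equation for `g` with trailing coefficient `1`. -/
  monic_zero : coeffC' (s 2) 0 = 1
  monic_succ : ∀ k, 1 ≤ k → k ≤ K → coeffC' (s 2) k = c k * c 0 ^ (p ^ k - 2)
  monic_eq : mahlerOp K (coeffC' (s 2)) g = 0
  /-- Then `f` modulo `x ^ v`, with `v` the lowest degree of `c_0`, and the negative part of
  `g` are computed. -/
  lowDeg_eq' : lowDeg (s 3) = (c 0).natTrailingDegree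
  trunc_eq : storedTrunc (s 3) = PowerSeries.trunc (c 0).natTrailingDegree f
  neg_eq : storedNeg (s 3) = negPart g
  /-- Then the right-hand side of the inhomogeneous equation for `h` is computed. -/
  rhs_eq : (storedRhs (s 4) : PowerSeries (ZMod p)) =
    nonnegPart (-(mahlerOp K (coeffC' (s 2)) (negPart g)))
  inhomogeneous_eq : mahlerOp K (coeffC' (s 2)) (HahnSeries.ofPowerSeries ℤ (ZMod p) h) =
    polyToLaurent (storedRhs (s 4))
  /-- Then a linear representation of `h` by matrices of the section operators is obtained. -/
  repA_zero : repA (s 5) 0 = storedRhs (s 4)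
  repA_succ : ∀ k, 1 ≤ k → k ≤ K → repA (s 5) k = -coeffC' (s 2) k
  repH0_eq : repH0 (s 5) = PowerSeries.constantCoeff h
  section_eq : ∀ r < p, ∀ j : FamilyIndex K (repD (s 5)),
    sectionOp p r (family K (repD (s 5)) h j) =
      ∑ i, repMatrix K (repD (s 5)) (repA (s 5)) r i j • family K (repD (s 5)) h i
  linearRepresentation : IsLinearRepresentation h
    (repRow K (repD (s 5)) (repH0 (s 5)))
    (repMatrix K (repD (s 5)) (repA (s 5)))
    (repCol K (repD (s 5)))
  /-- Then the coefficients of `h` of the indices `N - i ≥ 0`, for `i` between the lowest degree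
  and the degree of `c_0`, are computed as values of the linear representation. -/
  term_eq : ∀ i, (c 0).natTrailingDegree ≤ i → i ≤ (c 0).natDegree → i ≤ N →
    storedTerm (s 6) i = repRow K (repD (s 5)) (repH0 (s 5)) ⬝ᵥ
      (((p.digits (N - i)).map (repMatrix K (repD (s 5)) (repA (s 5)))).reverse.prod.mulVec
        (repCol K (repD (s 5))))
  /-- Finally these are combined, together with coefficients of the negative part of `g` for
  the negative indices, into the coefficient of index `N` of `f`. -/
  output_eq : output (s 7) =
    ∑ i ∈ Finset.Icc (c 0).natTrailingDegree (c 0).natDegree, (c 0).coeff i *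
      (if i ≤ N then storedTerm (s 6) i else (negPart g).coeff ((N : ℤ) - i))
  correct : output (s 7) = PowerSeries.coeff N f

end MahlerMethod

/-- `C B (log B) ^ m`: a function is `Õ(B)` if it is bounded by such an expression with constants
`C` and `m` (the shift by `2` keeps the logarithm away from zero). -/
noncomputable def softBound (C : ℝ) (m : ℕ) (B : ℝ) : ℝ := C * B * Real.log (B + 2) ^ m

/-! Over `F_p` substitution is a power: `f(x^p) = f^p`. A Mahler equation is therefore a linear
relation over `F_p[x]` between `f, f^p, f^(p^2), …`. As `f` is algebraic of degree at most `d`, the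
`d + 1` powers with exponents `p^k`, `k ≤ d`, are dependent, so the minimal order `K` is at most
`d`. The root itself exists and is unique by Newton's method (`exists_eval₂_eq_zero`,
`eval₂_unique`).

Finding the equation rests on two bounds. Put `Q = p^d`, `H = d h Q` and `σ = (d + 2) H + 1`, and
reduce powers of `f` modulo an irreducible factor of `E` that vanishes at `f`. Siegel's lemma shows
that if there is a nontrivial relation of order `K ≤ d`, there is one with coefficients of degree at
most `H` (`exists_small_relation`). A norm argument shows that a combination with coefficients of
degree at most `H` which vanishes modulo `x^σ` is zero (`eq_zero_of_X_pow_dvd`). So order `K` occurs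
exactly when there is a nonzero Hermite–Padé approximant of order `σ` and degree at most `H`, and a
reduced basis of the approximation module decides this (`IsReducedBasis.succ`,
`IsReducedBasis.exists_small`). Trying `K = 0, 1, …` gives the minimal order, and section operators
show that `c_0 ≠ 0` for a minimal equation (`trailing_ne_zero_of_minimal`).

Substituting `f = c_0 g` and dividing by `c_0^2` makes the trailing coefficient `1`. Splitting off
the negative part of `g` leaves an inhomogeneous equation that expresses `η` through the
`η(x^(p^k))` with `k ≥ 1`. Hence the span of the family `x^i`, `x^j η(x^(p^k))` is stable under
sections, and a linear representation follows (`section_family`,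
`isLinearRepresentation_of_section`).

The values of the representation are not computed by matrix products. By the functional equation,
the window of the `η_(n-t)`, `t ≤ 2H`, at `n = ⌊N/p^l⌋` follows from the windows at `⌊N/p^(l+k)⌋`,
`1 ≤ k ≤ K` (`windowCoeff_mul_pow`), so about `log_p N` levels suffice. The linear representation
identifies the resulting coefficients with the matrix products.

Up to constants, the search costs `d^3 σ^2 ~ d^7 h^2 p^(2d)`, the monic equation `d H^2 Q = d^3 h^2
p^(3d)`, and the windows `d H^2 log N`. All of this is at most `d^4 B`, and `d^4` is absorbed by
`(log B)^4` since `B ≥ 2^(3d)`. -/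

namespace FieldRAM

variable {p : ℕ}

/-! ## Reasoning about programs -/

/-- The scalar register `a`. -/
def NatExpr.var (a : ℕ) : NatExpr := .load a (.const 0)

instance : Add NatExpr := ⟨.add⟩
instance : Sub NatExpr := ⟨.sub⟩
instance (n : ℕ) : OfNat NatExpr n := ⟨.const n⟩
instance : Zero FldExpr := ⟨.zero⟩
instance : One FldExpr := ⟨.one⟩
instance : Add FldExpr := ⟨.add⟩
instance : Sub FldExpr := ⟨.sub⟩
instance : Mul FldExpr := ⟨.mul⟩
instance : Div FldExpr := ⟨.div⟩

section Eval

variable (s : State p)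

@[simp] theorem NatExpr.eval_zero : (0 : NatExpr).eval s = 0 := rfl
@[simp] theorem NatExpr.eval_one : (1 : NatExpr).eval s = 1 := rfl
@[simp] theorem NatExpr.eval_two : (2 : NatExpr).eval s = 2 := rfl
@[simp] theorem NatExpr.eval_const (n : ℕ) : (NatExpr.const n).eval s = n := rfl
@[simp] theorem NatExpr.eval_var (a : ℕ) : (NatExpr.var a).eval s = s.nat a 0 := rfl
@[simp] theorem NatExpr.eval_load (a : ℕ) (i : NatExpr) :
    (NatExpr.load a i).eval s = s.nat a (i.eval s) := rfl
@[simp] theorem NatExpr.eval_add (x y : NatExpr) : (x + y).eval s = x.eval s + y.eval s := rfl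
@[simp] theorem NatExpr.eval_sub (x y : NatExpr) : (x - y).eval s = x.eval s - y.eval s := rfl

@[simp] theorem NatExpr.cost_zero : (0 : NatExpr).cost = 1 := rfl
@[simp] theorem NatExpr.cost_one : (1 : NatExpr).cost = 1 := rfl
@[simp] theorem NatExpr.cost_two : (2 : NatExpr).cost = 1 := rfl
@[simp] theorem NatExpr.cost_const (n : ℕ) : (NatExpr.const n).cost = 1 := rfl
@[simp] theorem NatExpr.cost_var (a : ℕ) : (NatExpr.var a).cost = 2 := rfl
@[simp] theorem NatExpr.cost_load (a : ℕ) (i : NatExpr) :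
    (NatExpr.load a i).cost = i.cost + 1 := rfl
@[simp] theorem NatExpr.cost_add (x y : NatExpr) : (x + y).cost = x.cost + y.cost + 1 := rfl
@[simp] theorem NatExpr.cost_sub (x y : NatExpr) : (x - y).cost = x.cost + y.cost + 1 := rfl

@[simp] theorem FldExpr.cost_zero : (0 : FldExpr).cost = 1 := rfl
@[simp] theorem FldExpr.cost_one : (1 : FldExpr).cost = 1 := rfl
@[simp] theorem FldExpr.cost_load (a : ℕ) (i j : NatExpr) :
    (FldExpr.load a i j).cost = i.cost + j.cost + 1 := rfl
@[simp] theorem FldExpr.cost_add (x y : FldExpr) : (x + y).cost = x.cost + y.cost + 1 := rfl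
@[simp] theorem FldExpr.cost_sub (x y : FldExpr) : (x - y).cost = x.cost + y.cost + 1 := rfl
@[simp] theorem FldExpr.cost_mul (x y : FldExpr) : (x * y).cost = x.cost + y.cost + 1 := rfl
@[simp] theorem FldExpr.cost_div (x y : FldExpr) : (x / y).cost = x.cost + y.cost + 1 := rfl

@[simp] theorem Test.cost_natLt (x y : NatExpr) :
    (Test.natLt x y).cost = x.cost + y.cost + 1 := rfl
@[simp] theorem Test.cost_natEq (x y : NatExpr) :
    (Test.natEq x y).cost = x.cost + y.cost + 1 := rfl
@[simp] theorem Test.cost_fldEq (x y : FldExpr) :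
    (Test.fldEq x y).cost = x.cost + y.cost + 1 := rfl
@[simp] theorem Test.cost_neg (b : Test) : (Test.neg b).cost = b.cost + 1 := rfl

@[simp] theorem State.setNat_nat (a i x a' i' : ℕ) :
    (s.setNat a i x).nat a' i' = if a' = a ∧ i' = i then x else s.nat a' i' := rfl
@[simp] theorem State.setNat_fld (a i x : ℕ) : (s.setNat a i x).fld = s.fld := rfl
@[simp] theorem State.setFld_nat (a i j : ℕ) (x : ZMod p) : (s.setFld a i j x).nat = s.nat := rfl
@[simp] theorem State.setFld_fld (a i j : ℕ) (x : ZMod p) (a' i' j' : ℕ) :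
    (s.setFld a i j x).fld a' i' j' =
      if a' = a ∧ i' = i ∧ j' = j then x else s.fld a' i' j' := rfl

variable [Fact p.Prime]

@[simp] theorem FldExpr.eval_zero : (0 : FldExpr).eval s = 0 := rfl
@[simp] theorem FldExpr.eval_one : (1 : FldExpr).eval s = 1 := rfl
@[simp] theorem FldExpr.eval_load (a : ℕ) (i j : NatExpr) :
    (FldExpr.load a i j).eval s = s.fld a (i.eval s) (j.eval s) := rfl
@[simp] theorem FldExpr.eval_add (x y : FldExpr) : (x + y).eval s = x.eval s + y.eval s := rfl
@[simp] theorem FldExpr.eval_sub (x y : FldExpr) : (x - y).eval s = x.eval s - y.eval s := rfl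
@[simp] theorem FldExpr.eval_mul (x y : FldExpr) : (x * y).eval s = x.eval s * y.eval s := rfl
@[simp] theorem FldExpr.eval_div (x y : FldExpr) : (x / y).eval s = x.eval s / y.eval s := rfl

@[simp] theorem Test.holds_natLt (x y : NatExpr) :
    (Test.natLt x y).Holds s ↔ x.eval s < y.eval s := Iff.rfl
@[simp] theorem Test.holds_natEq (x y : NatExpr) :
    (Test.natEq x y).Holds s ↔ x.eval s = y.eval s := Iff.rfl
@[simp] theorem Test.holds_fldEq (x y : FldExpr) :
    (Test.fldEq x y).Holds s ↔ x.eval s = y.eval s := Iff.rfl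
@[simp] theorem Test.holds_neg (b : Test) : (Test.neg b).Holds s ↔ ¬ b.Holds s := Iff.rfl

end Eval

/-- Whether the program text contains an assignment to the array `a` of natural numbers. -/
def Prog.writesNat : Prog → ℕ → Bool
  | .skip, _ => false
  | .setNat b _ _, a => a == b
  | .setFld _ _ _ _, _ => false
  | .seq P Q, a => P.writesNat a || Q.writesNat a
  | .cond _ P Q, a => P.writesNat a || Q.writesNat a
  | .loop _ P, a => P.writesNat a

/-- Whether the program text contains an assignment to the array `a` of field elements. -/
def Prog.writesFld : Prog → ℕ → Bool
  | .skip, _ => false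
  | .setNat _ _ _, _ => false
  | .setFld b _ _ _, a => a == b
  | .seq P Q, a => P.writesFld a || Q.writesFld a
  | .cond _ P Q, a => P.writesFld a || Q.writesFld a
  | .loop _ P, a => P.writesFld a

/-- The arrays to which `P` does not assign have the same contents in `s` and in `s'`. -/
structure Keeps (P : Prog) (s s' : State p) : Prop where
  nat : ∀ a, P.writesNat a = false → s'.nat a = s.nat a
  fld : ∀ a, P.writesFld a = false → s'.fld a = s.fld a

theorem Keeps.refl (P : Prog) (s : State p) : Keeps P s s := ⟨fun _ _ => rfl, fun _ _ => rfl⟩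

theorem Keeps.trans {P : Prog} {s s' s'' : State p} (h : Keeps P s s') (h' : Keeps P s' s'') :
    Keeps P s s'' :=
  ⟨fun a ha => (h'.nat a ha).trans (h.nat a ha), fun a ha => (h'.fld a ha).trans (h.fld a ha)⟩

theorem Keeps.mono {P Q : Prog} {s s' : State p} (h : Keeps P s s')
    (hn : ∀ a, Q.writesNat a = false → P.writesNat a = false)
    (hf : ∀ a, Q.writesFld a = false → P.writesFld a = false) : Keeps Q s s' :=
  ⟨fun a ha => h.nat a (hn a ha), fun a ha => h.fld a (hf a ha)⟩

theorem Keeps.seq_left {P Q : Prog} {s s' : State p} (h : Keeps P s s') :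
    Keeps (.seq P Q) s s' :=
  h.mono (fun a ha => by simp_all [Prog.writesNat]) (fun a ha => by simp_all [Prog.writesFld])

theorem Keeps.seq_right {P Q : Prog} {s s' : State p} (h : Keeps Q s s') :
    Keeps (.seq P Q) s s' :=
  h.mono (fun a ha => by simp_all [Prog.writesNat]) (fun a ha => by simp_all [Prog.writesFld])

/-- Whether an expression only reads arrays to which `P` does not assign. -/
def NatExpr.stable (P : Prog) : NatExpr → Bool
  | .const _ => true
  | .load a i => !P.writesNat a && i.stable P
  | .add x y => x.stable P && y.stable P
  | .sub x y => x.stable P && y.stable P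

theorem NatExpr.eval_eq_of_stable {P : Prog} {s s' : State p} (h : Keeps P s s') :
    ∀ x : NatExpr, x.stable P = true → x.eval s' = x.eval s
  | .const _, _ => rfl
  | .load a i, hx => by
    simp only [NatExpr.stable, Bool.and_eq_true, Bool.not_eq_true'] at hx
    simp only [NatExpr.eval, h.nat a hx.1, eval_eq_of_stable h i hx.2]
  | .add x y, hx => by
    simp only [NatExpr.stable, Bool.and_eq_true] at hx
    simp only [NatExpr.eval, eval_eq_of_stable h x hx.1, eval_eq_of_stable h y hx.2]
  | .sub x y, hx => by
    simp only [NatExpr.stable, Bool.and_eq_true] at hx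
    simp only [NatExpr.eval, eval_eq_of_stable h x hx.1, eval_eq_of_stable h y hx.2]

theorem NatExpr.stable_mono {P Q : Prog} (h : ∀ a, P.writesNat a = false → Q.writesNat a = false) :
    ∀ x : NatExpr, x.stable P = true → x.stable Q = true
  | .const _, _ => rfl
  | .load a i, hx => by
    simp only [NatExpr.stable, Bool.and_eq_true, Bool.not_eq_true'] at hx ⊢
    exact ⟨h a hx.1, stable_mono h i hx.2⟩
  | .add x y, hx => by
    simp only [NatExpr.stable, Bool.and_eq_true] at hx ⊢
    exact ⟨stable_mono h x hx.1, stable_mono h y hx.2⟩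
  | .sub x y, hx => by
    simp only [NatExpr.stable, Bool.and_eq_true] at hx ⊢
    exact ⟨stable_mono h x hx.1, stable_mono h y hx.2⟩

variable [Fact p.Prime]

/-- The frame rule. For a concrete program `writesNat` and `writesFld` evaluate, so later proofs
transport the contents of an untouched array by a term such as `k.nat 13 rfl`. -/
theorem Exec.keeps {P : Prog} {s s' : State p} {t : ℕ} (h : Exec P s t s') : Keeps P s s' := by
  induction h with
  | skip s => exact Keeps.refl _ _
  | setNat a i x s =>
    refine ⟨fun b hb => ?_, fun _ _ => rfl⟩
    have : b ≠ a := by simpa [Prog.writesNat] using hb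
    funext j
    simp [this]
  | setFld a i j x s =>
    refine ⟨fun _ _ => rfl, fun b hb => ?_⟩
    have : b ≠ a := by simpa [Prog.writesFld] using hb
    funext i j
    simp [this]
  | seq _ _ h1 h2 => exact h1.seq_left.trans h2.seq_right
  | cond_true _ _ h1 =>
    exact h1.mono (fun a ha => by simp_all [Prog.writesNat])
      (fun a ha => by simp_all [Prog.writesFld])
  | cond_false _ _ h1 =>
    exact h1.mono (fun a ha => by simp_all [Prog.writesNat])
      (fun a ha => by simp_all [Prog.writesFld])
  | loop_true _ _ _ h1 h2 =>
    exact (h1.mono (fun a ha => by simpa [Prog.writesNat] using ha)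
      (fun a ha => by simpa [Prog.writesFld] using ha)).trans h2
  | loop_false _ => exact Keeps.refl _ _

/-- Started in `s`, the program `P` stops after at most `T` units of time in a memory that
satisfies `R`. -/
def Runs (P : Prog) (s : State p) (T : ℕ) (R : State p → Prop) : Prop :=
  ∃ t s', Exec P s t s' ∧ t ≤ T ∧ R s'

/-- The new postcondition may use the frame condition `Keeps P s s'`, so the postcondition of a
program need only list what the program computes. -/
theorem Runs.mono {P : Prog} {s : State p} {T T' : ℕ} {R R' : State p → Prop} (h : Runs P s T R)
    (hR : ∀ s', Keeps P s s' → R s' → R' s') (hT : T ≤ T') : Runs P s T' R' := by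
  obtain ⟨t, s', he, ht, hr⟩ := h
  exact ⟨t, s', he, ht.trans hT, hR s' he.keeps hr⟩

theorem Runs.le {P : Prog} {s : State p} {T T' : ℕ} {R : State p → Prop} (h : Runs P s T R)
    (hT : T ≤ T') : Runs P s T' R :=
  h.mono (fun _ _ h => h) hT

theorem Runs.skip {s : State p} {T : ℕ} {R : State p → Prop} (h : R s) (hT : 1 ≤ T) :
    Runs .skip s T R :=
  ⟨1, s, .skip s, hT, h⟩

theorem Runs.setNat {a : ℕ} {i x : NatExpr} {s : State p} {T : ℕ} {R : State p → Prop}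
    (h : R (s.setNat a (i.eval s) (x.eval s))) (hT : i.cost + x.cost + 1 ≤ T) :
    Runs (.setNat a i x) s T R :=
  ⟨_, _, .setNat a i x s, hT, h⟩

theorem Runs.setFld {a : ℕ} {i j : NatExpr} {x : FldExpr} {s : State p} {T : ℕ}
    {R : State p → Prop} (h : R (s.setFld a (i.eval s) (j.eval s) (x.eval s)))
    (hT : i.cost + j.cost + x.cost + 1 ≤ T) : Runs (.setFld a i j x) s T R :=
  ⟨_, _, .setFld a i j x s, hT, h⟩

theorem Runs.seq {P Q : Prog} {s : State p} {T₁ T₂ : ℕ} {R₁ R : State p → Prop}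
    (h₁ : Runs P s T₁ R₁) (h₂ : ∀ s', Keeps P s s' → R₁ s' → Runs Q s' T₂ R) :
    Runs (.seq P Q) s (T₁ + T₂) R := by
  obtain ⟨t, s', he, ht, hr⟩ := h₁
  obtain ⟨t', s'', he', ht', hr'⟩ := h₂ s' he.keeps hr
  exact ⟨t + t', s'', he.seq he', by omega, hr'⟩

theorem Runs.cond {b : Test} {P Q : Prog} {s : State p} {T : ℕ} {R : State p → Prop}
    (h₁ : b.Holds s → Runs P s T R) (h₂ : ¬ b.Holds s → Runs Q s T R) :
    Runs (.cond b P Q) s (b.cost + T) R := by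
  by_cases hb : b.Holds s
  · obtain ⟨t, s', he, ht, hr⟩ := h₁ hb
    exact ⟨b.cost + t, s', .cond_true hb he, by omega, hr⟩
  · obtain ⟨t, s', he, ht, hr⟩ := h₂ hb
    exact ⟨b.cost + t, s', .cond_false hb he, by omega, hr⟩

/-- A loop whose number of rounds is given by a variant `n`. -/
theorem Runs.loop {b : Test} {P : Prog} {T : ℕ} (I : ℕ → State p → Prop)
    (hb : ∀ i s, I i s → (b.Holds s ↔ 0 < i))
    (hP : ∀ i s, I (i + 1) s → Runs P s T (I i)) (n : ℕ) (s : State p) (h : I n s) :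
    Runs (.loop b P) s (n * (T + b.cost) + b.cost) (I 0) := by
  induction n generalizing s with
  | zero =>
    exact ⟨b.cost, s, .loop_false (by simp [hb 0 s h]), by simp, h⟩
  | succ n ih =>
    obtain ⟨t, s', he, ht, hr⟩ := hP n s h
    obtain ⟨t', s'', he', ht', hr'⟩ := ih s' hr
    exact ⟨b.cost + t + t', s'', .loop_true ((hb _ _ h).2 (by simp)) he he', by
      rw [Nat.succ_mul]; omega, hr'⟩

/-- The loop `for v = 0, …, n - 1 do P`. -/
def forUp (v : ℕ) (n : NatExpr) (P : Prog) : Prog :=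
  .seq (.setNat v 0 0) (.loop (.natLt (.var v) n) (.seq P (.setNat v 0 (.var v + 1))))

/-- The invariant `I i` describes the memory at the start of round `i`. The body must establish `I
(i + 1)` for the memory in which the counter has already been raised. Stability of `n` keeps the
bound constant, and the variant passed to `Runs.loop` is the number of rounds left. -/
theorem Runs.forUp {v : ℕ} {n : NatExpr} {P : Prog} {s : State p} {N T : ℕ}
    (I : ℕ → State p → Prop) (hN : n.eval s = N) (hn : n.stable (forUp v n P) = true)
    (hv : P.writesNat v = false) (h0 : I 0 (s.setNat v 0 0))
    (hP : ∀ i < N, ∀ s', Keeps (FieldRAM.forUp v n P) s s' → s'.nat v 0 = i → I i s' →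
      Runs P s' T fun s'' => I (i + 1) (s''.setNat v 0 (i + 1))) :
    Runs (FieldRAM.forUp v n P) s (N * (T + n.cost + 9) + n.cost + 6)
      fun s' => I N s' := by
  have key := Runs.loop (p := p) (b := .natLt (.var v) n) (P := .seq P (.setNat v 0 (.var v + 1)))
    (T := T + 6)
    (fun k s' => k ≤ N ∧ Keeps (FieldRAM.forUp v n P) s s' ∧ s'.nat v 0 = N - k ∧ I (N - k) s')
    (fun k s' ⟨hk, hs, hv', _⟩ => by
      have := NatExpr.eval_eq_of_stable hs n hn
      simp only [Test.holds_natLt, NatExpr.eval_var, this, hN, hv']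
      omega)
    (fun k s' ⟨hk, hs, hv', hi⟩ => by
      refine Runs.seq (hP (N - (k + 1)) (by omega) s' hs hv' hi) fun s'' hk2 h2 => ?_
      have e : N - (k + 1) + 1 = N - k := by omega
      have hv2 : s''.nat v 0 = N - (k + 1) := by rw [hk2.nat v hv, hv']
      refine Runs.setNat ⟨by omega, ?_, ?_, ?_⟩ (by simp)
      · refine hs.trans ?_
        refine ⟨fun a ha => ?_, fun a ha => ?_⟩
        · simp only [FieldRAM.forUp, Prog.writesNat, Bool.or_eq_false_iff, beq_eq_false_iff_ne] at ha
          funext j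
          simp [ha.1, hk2.nat a ha.2.1]
        · simp only [FieldRAM.forUp, Prog.writesFld, Bool.or_eq_false_iff] at ha
          exact hk2.fld a ha.2.1
      · simp [hv2, e]
      · simpa [hv2, e] using h2)
    N (s.setNat v 0 0) ⟨le_rfl, ⟨fun a ha => by
        simp only [FieldRAM.forUp, Prog.writesNat, Bool.or_eq_false_iff, beq_eq_false_iff_ne] at ha
        funext j
        simp [ha.1], fun _ _ => rfl⟩, by simp, by simpa using h0⟩
  refine (Runs.seq (R₁ := fun s' => s' = s.setNat v 0 0) (T₁ := 3)
    (Runs.setNat rfl (by simp)) fun s' _ hs' => hs' ▸ key).mono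
      (fun s' _ h => by simpa using h.2.2.2) ?_
  simp only [Test.cost_natLt, NatExpr.cost_var]
  rw [show T + 6 + (2 + n.cost + 1) = T + n.cost + 9 by ring]
  omega

/-- The assignment of the product of two natural numbers, by repeated addition. -/
def mulInto (a v : ℕ) (n x : NatExpr) : Prog :=
  .seq (.setNat a 0 0) (forUp v n (.setNat a 0 (.var a + x)))

/-- The machine has no multiplication of natural numbers. The time is linear in the first factor and
does not depend on the size of the second. -/
theorem Runs.mulInto {a v : ℕ} {n x : NatExpr} {s : State p} {N M : ℕ} (hN : n.eval s = N)
    (hM : x.eval s = M) (hav : v ≠ a) (hn : n.stable (FieldRAM.mulInto a v n x) = true)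
    (hx : x.stable (FieldRAM.mulInto a v n x) = true) :
    Runs (FieldRAM.mulInto a v n x) s (N * (x.cost + n.cost + 14) + n.cost + 9)
      fun s' => s'.nat a 0 = N * M := by
  have hk : Keeps (FieldRAM.mulInto a v n x) s (s.setNat a 0 0) :=
    ⟨fun b hb => by
        simp only [FieldRAM.mulInto, Prog.writesNat, Bool.or_eq_false_iff, beq_eq_false_iff_ne] at hb
        funext j
        simp [hb.1], fun _ _ => rfl⟩
  have key := Runs.forUp (p := p) (v := v) (n := n) (P := .setNat a 0 (.var a + x)) (T := x.cost + 5)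
    (s := s.setNat a 0 0) (N := N)
    (fun i s' => s'.nat a 0 = i * M) (by rw [← hN]; exact NatExpr.eval_eq_of_stable hk n hn)
    (NatExpr.stable_mono (fun b hb => by
      simp only [FieldRAM.mulInto, Prog.writesNat, Bool.or_eq_false_iff] at hb
      exact hb.2) n hn)
    (by simpa [Prog.writesNat] using hav) (by simp) (fun i hi s' hs hv hI => by
      have : x.eval s' = M := by
        rw [← hM]
        exact NatExpr.eval_eq_of_stable (hk.trans hs.seq_right) x hx
      refine Runs.setNat ?_ (by simp; omega)
      simp [hav.symm, this, hI]
      ring)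
  refine (Runs.seq (R₁ := fun s' => s' = s.setNat a 0 0) (T₁ := 3)
    (Runs.setNat rfl (by simp)) fun s' _ hs' => hs' ▸ key).mono (fun s' _ h => h) ?_
  rw [show x.cost + 5 + n.cost + 9 = x.cost + n.cost + 14 by ring]
  omega

/-- The assignment of `∑ e`, over all `v < n` with `g`, to the field element `a`. -/
def sumInto (a v : ℕ) (n : NatExpr) (g : Test) (e : FldExpr) : Prog :=
  .seq (.setFld a 0 0 0) (forUp v n (.cond g (.setFld a 0 0 (.load a 0 0 + e)) .skip))

-- The guard enters the value as a zero summand, which allows sums over ranges cut off by a test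
-- such as `i ≤ m`, where the subtraction `m - i` is meaningful.
open Classical in
theorem Runs.sumInto {a v : ℕ} {n : NatExpr} {g : Test} {e : FldExpr} {s : State p} {N : ℕ}
    (val : ℕ → ZMod p) (hN : n.eval s = N)
    (hn : n.stable (FieldRAM.sumInto a v n g e) = true)
    (hval : ∀ i < N, ∀ s', Keeps (FieldRAM.sumInto a v n g e) s s' → s'.nat v 0 = i →
      (if g.Holds s' then e.eval s' else 0) = val i) :
    Runs (FieldRAM.sumInto a v n g e) s (N * (e.cost + g.cost + n.cost + 18) + n.cost + 10)
      fun s' => s'.fld a 0 0 = ∑ i ∈ Finset.range N, val i := by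
  have hk : Keeps (FieldRAM.sumInto a v n g e) s (s.setFld a 0 0 0) :=
    ⟨fun _ _ => rfl, fun b hb => by
        simp only [FieldRAM.sumInto, Prog.writesFld, Bool.or_eq_false_iff, beq_eq_false_iff_ne] at hb
        funext i j
        simp [hb.1]⟩
  have key := Runs.forUp (p := p) (v := v) (n := n)
    (P := .cond g (.setFld a 0 0 (.load a 0 0 + e)) .skip) (T := g.cost + (e.cost + 7))
    (s := s.setFld a 0 0 0) (N := N)
    (fun i s' => s'.fld a 0 0 = ∑ j ∈ Finset.range i, val j)
    (by rw [← hN]; exact NatExpr.eval_eq_of_stable hk n hn)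
    (NatExpr.stable_mono (fun b hb => by
      simpa [FieldRAM.sumInto, Prog.writesNat] using hb) n hn)
    (by simp [Prog.writesNat]) (by simp) (fun i hi s' hs hv hI => by
      have := hval i hi s' (hk.trans hs.seq_right) hv
      refine Runs.cond (fun hg => Runs.setFld ?_ (by simp; omega)) (fun hg => Runs.skip ?_ (by omega))
      · rw [if_pos hg] at this
        simp [this, hI, Finset.sum_range_succ]
      · rw [if_neg hg] at this
        simp [hI, Finset.sum_range_succ, ← this])
  refine (Runs.seq (R₁ := fun s' => s' = s.setFld a 0 0 0) (T₁ := 4)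
    (Runs.setFld rfl (by simp)) fun s' _ hs' => hs' ▸ key).mono (fun s' _ h => h) ?_
  rw [show g.cost + (e.cost + 7) + n.cost + 9 = e.cost + g.cost + n.cost + 16 by ring]
  have : N * (e.cost + g.cost + n.cost + 16) ≤ N * (e.cost + g.cost + n.cost + 18) :=
    Nat.mul_le_mul_left _ (by omega)
  omega

end FieldRAM

namespace MahlerMethod

open FieldRAM

variable {p : ℕ} [Fact p.Prime]

/-! ## Mahler operators, sections and linear representations -/

/-- Frobenius fixes the coefficients in `ZMod p`, so a `p`-th power only spreads the exponents. This
is what turns Mahler equations into polynomial relations. -/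
theorem expand_pow_eq_pow (k : ℕ) (u : PowerSeries (ZMod p)) (h : p ^ k ≠ 0) :
    PowerSeries.expand (p ^ k) h u = u ^ p ^ k := by
  induction k with
  | zero => simp
  | succ k ih =>
    have hp : p ≠ 0 := (Fact.out : p.Prime).ne_zero
    have key : ∀ v : PowerSeries (ZMod p), PowerSeries.expand p hp v = v ^ p := fun v => by
      have := MvPowerSeries.map_frobenius_expand p hp (f := v)
      rw [ZMod.frobenius_zmod] at this
      rw [← this]
      simp [PowerSeries.expand]
    have e : p ^ (k + 1) = p * p ^ k := pow_succ' p k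
    simp only [e]
    rw [PowerSeries.expand_mul p hp (p ^ k) (pow_ne_zero _ hp), ih, key, ← pow_mul, mul_comm]

theorem coeff_X_pow_mul_pow_prime {r : ℕ} (hr : r < p) (v : PowerSeries (ZMod p)) (n : ℕ) :
    PowerSeries.coeff n (PowerSeries.X ^ r * v ^ p) =
      if r = n % p then PowerSeries.coeff (n / p) v else 0 := by
  have hp := (Fact.out : p.Prime)
  have h1 := expand_pow_eq_pow 1 v (pow_ne_zero _ hp.ne_zero)
  simp only [pow_one] at h1
  rw [PowerSeries.coeff_X_pow_mul', ← h1, PowerSeries.coeff_expand]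
  have hn := Nat.div_add_mod n p
  by_cases h : r = n % p
  · subst h
    have e : n - n % p = p * (n / p) := by omega
    rw [if_pos (Nat.mod_le _ _), e, if_pos (dvd_mul_right _ _), Nat.mul_div_cancel_left _ hp.pos,
      if_pos rfl]
  · rw [if_neg h]
    split_ifs with h2 h3
    · exfalso
      obtain ⟨q, hq⟩ := h3
      apply h
      have : n = r + p * q := by omega
      rw [this, Nat.add_mul_mod_self_left, Nat.mod_eq_of_lt hr]
    · rfl
    · rfl

/-- Sorting the exponents by their residue modulo `p`: class `r` contributes `x^r (S_r c)(x^p)`. -/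
theorem sum_X_pow_mul_section_pow (c : PowerSeries (ZMod p)) :
    c = ∑ r ∈ Finset.range p, PowerSeries.X ^ r * sectionOp p r c ^ p := by
  ext n
  have hp := (Fact.out : p.Prime)
  rw [map_sum, Finset.sum_congr rfl fun r hr =>
    coeff_X_pow_mul_pow_prime (Finset.mem_range.1 hr) _ n]
  rw [Finset.sum_ite_eq' , if_pos (Finset.mem_range.2 (Nat.mod_lt _ hp.pos)), sectionOp,
    PowerSeries.coeff_mk, Nat.div_add_mod]

theorem sectionOp_sum_X_pow_mul_pow (v : ℕ → PowerSeries (ZMod p)) {r : ℕ} (hr : r < p) :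
    sectionOp p r (∑ i ∈ Finset.range p, PowerSeries.X ^ i * v i ^ p) = v r := by
  ext n
  have hp := (Fact.out : p.Prime)
  rw [sectionOp, PowerSeries.coeff_mk, map_sum, Finset.sum_congr rfl fun i hi =>
    coeff_X_pow_mul_pow_prime (Finset.mem_range.1 hi) _ _]
  rw [Nat.mul_add_mod, Nat.mod_eq_of_lt hr, Finset.sum_ite_eq', if_pos (Finset.mem_range.2 hr),
    Nat.mul_add_div hp.pos, Nat.div_eq_of_lt hr, add_zero]

/-- Multiplying the decomposition of `c` by residue classes by `u ^ p` gives the decomposition of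
the product, and the components of such a decomposition are the sections. -/
theorem sectionOp_mul_pow (c u : PowerSeries (ZMod p)) {r : ℕ} (hr : r < p) :
    sectionOp p r (c * u ^ p) = sectionOp p r c * u := by
  conv_lhs => rw [sum_X_pow_mul_section_pow c]
  simp only [Finset.sum_mul, mul_assoc, ← mul_pow]
  exact sectionOp_sum_X_pow_mul_pow (fun i => sectionOp p i c * u) hr

theorem sectionOp_add (r : ℕ) (u v : PowerSeries (ZMod p)) :
    sectionOp p r (u + v) = sectionOp p r u + sectionOp p r v := by
  ext n
  simp [sectionOp]

theorem sectionOp_sum {ι : Type*} (r : ℕ) (s : Finset ι) (u : ι → PowerSeries (ZMod p)) :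
    sectionOp p r (∑ i ∈ s, u i) = ∑ i ∈ s, sectionOp p r (u i) := by
  ext n
  simp [sectionOp]

theorem sectionOp_coe {q : Polynomial (ZMod p)} {D r : ℕ} (hq : q.natDegree < p * (D + 1)) :
    sectionOp p r (q : PowerSeries (ZMod p)) =
      ∑ m : Fin (D + 1), q.coeff (p * m + r) • (PowerSeries.X : PowerSeries (ZMod p)) ^ (m : ℕ) := by
  ext n
  rw [Fin.sum_univ_eq_sum_range (fun m : ℕ => q.coeff (p * m + r) •
    (PowerSeries.X : PowerSeries (ZMod p)) ^ m) (D + 1)]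
  simp only [sectionOp, PowerSeries.coeff_mk, Polynomial.coeff_coe, map_sum, PowerSeries.coeff_smul,
    PowerSeries.coeff_X_pow, smul_eq_mul, mul_ite, mul_one, mul_zero]
  rw [Finset.sum_ite_eq]
  split_ifs with h
  · rfl
  · apply Polynomial.coeff_eq_zero_of_natDegree_lt
    have : p * (D + 1) ≤ p * n := Nat.mul_le_mul_left _ (by simpa using h)
    omega

theorem sectionOp_polynomial_mul_pow {q : Polynomial (ZMod p)} {D r : ℕ} (hr : r < p)
    (hq : q.natDegree < p * (D + 1)) (u : PowerSeries (ZMod p)) :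
    sectionOp p r (q * u ^ p) =
      ∑ m : Fin (D + 1), q.coeff (p * m + r) • (PowerSeries.X ^ (m : ℕ) * u) := by
  rw [sectionOp_mul_pow _ _ hr, sectionOp_coe hq, Finset.sum_mul]
  exact Finset.sum_congr rfl fun m _ => by rw [smul_mul_assoc]

/-- Sections lower `h^(p^(k+1))` to `h^(p^k)`. The element `x^j h` is first rewritten by the
functional equation so that only such powers remain. The polynomial factors have degree at most `2 D
< p (D + 1)`, because `p ≥ 2`, so their sections have degree at most `D` again. -/
theorem section_family {K D : ℕ} {h : PowerSeries (ZMod p)} {a : ℕ → Polynomial (ZMod p)}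
    (ha : ∀ k ≤ K, (a k).natDegree ≤ D)
    (heq : h = a 0 + ∑ k ∈ Finset.range K, (a (k + 1) : PowerSeries (ZMod p)) * h ^ p ^ (k + 1))
    {r : ℕ} (hr : r < p) (j : FamilyIndex K D) :
    sectionOp p r (family K D h j) = ∑ i, repMatrix K D a r i j • family K D h i := by
  have hp := (Fact.out : p.Prime).two_le
  have hD : 2 * (D + 1) ≤ p * (D + 1) := Nat.mul_le_mul_right _ hp
  rw [Fintype.sum_sum_type, Fintype.sum_prod_type]
  rcases j with i | ⟨k', j⟩
  · have hi := i.2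
    have : (PowerSeries.X ^ (i : ℕ) : PowerSeries (ZMod p)) =
        ((Polynomial.X ^ (i : ℕ) : Polynomial (ZMod p)) : PowerSeries (ZMod p)) := by simp
    simp only [family, repMatrix]
    conv_lhs => rw [this]
    rw [sectionOp_coe (D := D) (by rw [Polynomial.natDegree_X_pow]; omega)]
    simp
  · have hj := j.2
    rcases k' with ⟨_ | k', hk'⟩
    · simp only [family, repMatrix, expand_pow_eq_pow, if_true]
      simp only [pow_zero, pow_one]
      have e : (PowerSeries.X : PowerSeries (ZMod p)) ^ (j : ℕ) * h =
          ((Polynomial.X ^ (j : ℕ) * a 0 : Polynomial (ZMod p)) : PowerSeries (ZMod p)) +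
          ∑ k ∈ Finset.range K, ((Polynomial.X ^ (j : ℕ) * a (k + 1) : Polynomial (ZMod p)) :
            PowerSeries (ZMod p)) * (h ^ p ^ k) ^ p := by
        conv_lhs => rw [heq]
        rw [mul_add, Finset.mul_sum]
        simp only [Polynomial.coe_mul, Polynomial.coe_pow, Polynomial.coe_X]
        congr 1
        refine Finset.sum_congr rfl fun k _ => ?_
        rw [← pow_mul, ← pow_succ, mul_assoc]
      have hdeg : ∀ k ≤ K, (Polynomial.X ^ (j : ℕ) * a k).natDegree < p * (D + 1) := fun k hk => by
        refine lt_of_le_of_lt Polynomial.natDegree_mul_le ?_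
        rw [Polynomial.natDegree_X_pow]
        have := ha k hk
        omega
      rw [e, sectionOp_add, sectionOp_sum, sectionOp_coe (hdeg 0 (by omega))]
      congr 1
      rw [Fin.sum_univ_castSucc]
      -- The highest power in the functional equation is `h^(p^K)`, which the section lowers to
      -- `h^(p^(K-1))`; the block with `k = K` is zero.
      have hlast : ∑ x : Fin (D + 1), (if (Fin.last K : ℕ) + 1 ≤ K then
          (Polynomial.X ^ (j : ℕ) * a ((Fin.last K : ℕ) + 1)).coeff (p * x + r) else 0) •
            (PowerSeries.X ^ (x : ℕ) * h ^ p ^ (Fin.last K : ℕ)) = 0 :=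
        Finset.sum_eq_zero fun x _ => by simp
      rw [hlast, add_zero, Finset.sum_range]
      refine Finset.sum_congr rfl fun k _ => ?_
      have hk := k.2
      rw [sectionOp_polynomial_mul_pow hr (hdeg _ (by omega))]
      refine Finset.sum_congr rfl fun m _ => ?_
      rw [if_pos (by simp)]
      simp
    · simp only [family, repMatrix, expand_pow_eq_pow, Nat.add_eq_zero_iff, one_ne_zero, and_false,
        if_false, zero_smul, Finset.sum_const_zero, zero_add, Nat.add_right_cancel_iff]
      have e : (PowerSeries.X : PowerSeries (ZMod p)) ^ (j : ℕ) * h ^ p ^ (k' + 1) =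
          ((Polynomial.X ^ (j : ℕ) : Polynomial (ZMod p)) : PowerSeries (ZMod p)) *
            (h ^ p ^ k') ^ p := by
        rw [← pow_mul, ← pow_succ]
        simp
      rw [e, sectionOp_polynomial_mul_pow (D := D) hr (by rw [Polynomial.natDegree_X_pow]; omega),
        Finset.sum_eq_single (⟨k', by omega⟩ : Fin (K + 1))]
      · simp
      · intro b _ hb
        refine Finset.sum_eq_zero fun x _ => ?_
        rw [if_neg (fun h => hb (Fin.ext h.symm)), zero_smul]
      · simp

/-- The coefficient of index `p m + r` of a series is the coefficient of index `m` of its section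
`S_r`, and `S_r` acts on coordinates by `A_r`. Peeling off the lowest digit each time leaves a
constant term, which `L` reads. -/
theorem isLinearRepresentation_of_section {K D : ℕ} {h : PowerSeries (ZMod p)}
    {A : ℕ → Matrix (FamilyIndex K D) (FamilyIndex K D) (ZMod p)}
    (hs : ∀ r < p, ∀ j, sectionOp p r (family K D h j) = ∑ i, A r i j • family K D h i) :
    IsLinearRepresentation h (repRow K D (PowerSeries.constantCoeff h)) A (repCol K D) := by
  have hp := (Fact.out : p.Prime)
  have hL : ∀ j, repRow K D (PowerSeries.constantCoeff h) j =
      PowerSeries.constantCoeff (family K D h j) := by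
    rintro (i | ⟨k, j⟩)
    · simp [repRow, family, zero_pow_eq]
    · simp [repRow, family, zero_pow_eq]
  -- The coordinate vector must be arbitrary in the induction, since each digit replaces it by its
  -- image under `A_r`. For `n = 0` the list of digits is empty.
  have key : ∀ n (C : FamilyIndex K D → ZMod p),
      PowerSeries.coeff n (∑ j, C j • family K D h j) =
        repRow K D (PowerSeries.constantCoeff h) ⬝ᵥ
          (((p.digits n).map A).reverse.prod.mulVec C) := by
    intro n
    induction n using Nat.strong_induction_on with
    | _ n ih =>
      intro C
      rcases Nat.eq_zero_or_pos n with rfl | hn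
      · simp [dotProduct, hL, mul_comm]
      · have hlt := Nat.mod_lt n hp.pos
        have hsec : ∑ i, (A (n % p)).mulVec C i • family K D h i =
            sectionOp p (n % p) (∑ j, C j • family K D h j) := by
          have e2 : ∀ j, sectionOp p (n % p) (C j • family K D h j) =
              C j • sectionOp p (n % p) (family K D h j) := fun j => by
            ext m
            simp [sectionOp]
          rw [sectionOp_sum]
          simp only [e2, hs _ hlt, Matrix.mulVec, dotProduct, Finset.sum_smul, Finset.smul_sum,
            smul_smul]
          rw [Finset.sum_comm]
          simp only [mul_comm]
        rw [Nat.digits_def' hp.one_lt hn, List.map_cons, List.reverse_cons, List.prod_append,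
          List.prod_singleton, ← Matrix.mulVec_mulVec, ← ih _ (Nat.div_lt_self hn hp.one_lt), hsec,
          sectionOp, PowerSeries.coeff_mk, Nat.div_add_mod]
  intro n
  rw [← key]
  congr 1
  rw [Fintype.sum_sum_type, Fintype.sum_prod_type,
    Finset.sum_eq_single (0 : Fin (K + 1)), Finset.sum_eq_single (0 : Fin (D + 1))]
  · simp [repCol, family]
  · intro b _ hb
    simp [repCol]
  · simp
  · intro b _ hb
    have : (b : ℕ) ≠ 0 := fun h => hb (Fin.ext h)
    simp [repCol, this]
  · simp

/-- Both sides are ring homomorphisms in `u`: the first spreads exponents along multiplication by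
`p`, the second is Frobenius. They agree on power series, and Laurent series are a localization of
these. -/
theorem mahlerM_eq_pow (u : LaurentSeries (ZMod p)) : mahlerM u = u ^ p := by
  have hp := (Fact.out : p.Prime)
  let φ : LaurentSeries (ZMod p) →+* LaurentSeries (ZMod p) :=
    HahnSeries.embDomainRingHom (AddMonoidHom.mulLeft (p : ℤ))
      (fun a b h => by
        have : (p : ℤ) ≠ 0 := by exact_mod_cast hp.ne_zero
        exact mul_left_cancel₀ this h)
      (fun a b => by
        have : (0 : ℤ) < p := by exact_mod_cast hp.pos
        exact mul_le_mul_iff_right₀ this)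
  have : CharP (LaurentSeries (ZMod p)) p :=
    charP_of_injective_ringHom (HahnSeries.C_injective (Γ := ℤ) (R := ZMod p)) p
  have hφ : φ = frobenius (LaurentSeries (ZMod p)) p := by
    refine IsLocalization.ringHom_ext (nonZeroDivisors (PowerSeries (ZMod p))) ?_
    ext1 v
    have h1 := expand_pow_eq_pow 1 v (pow_ne_zero _ hp.ne_zero)
    simp only [pow_one] at h1
    simp only [RingHom.comp_apply, frobenius_def]
    rw [LaurentSeries.coe_algebraMap, ← map_pow, ← h1]
    ext n
    by_cases hn : ∃ m : ℤ, n = p * m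
    · obtain ⟨m, rfl⟩ := hn
      have : (φ (HahnSeries.ofPowerSeries ℤ (ZMod p) v)).coeff (p * m) =
          (HahnSeries.ofPowerSeries ℤ (ZMod p) v).coeff m :=
        HahnSeries.embDomain_coeff
          (f := OrderEmbedding.ofStrictMono (fun n : ℤ => (p : ℤ) * n) (fun _ _ h =>
          mul_lt_mul_of_pos_left h (Int.natCast_pos.mpr (Fact.out : p.Prime).pos)))
      rw [this]
      rcases lt_or_ge m 0 with hm | hm
      · have h2 : (p : ℤ) * m < 0 := mul_neg_of_pos_of_neg (by exact_mod_cast hp.pos) hm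
        simp [PowerSeries.coeff_coe, hm, h2]
      · lift m to ℕ using hm
        rw [← Nat.cast_mul, HahnSeries.ofPowerSeries_apply_coeff,
          HahnSeries.ofPowerSeries_apply_coeff, PowerSeries.coeff_expand_mul]
    · have : (φ (HahnSeries.ofPowerSeries ℤ (ZMod p) v)).coeff n = 0 :=
        HahnSeries.embDomain_of_notMem_range
          (f := OrderEmbedding.ofStrictMono (fun n : ℤ => (p : ℤ) * n) (fun _ _ h =>
          mul_lt_mul_of_pos_left h (Int.natCast_pos.mpr (Fact.out : p.Prime).pos)))
          (fun ⟨m, hm⟩ => hn ⟨m, hm.symm⟩)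
      rw [this]
      rcases lt_or_ge n 0 with hm | hm
      · simp [PowerSeries.coeff_coe, hm]
      · lift n to ℕ using hm
        rw [HahnSeries.ofPowerSeries_apply_coeff, PowerSeries.coeff_expand, if_neg]
        rintro ⟨q, rfl⟩
        exact hn ⟨q, by simp⟩
  exact congrArg (fun ψ : LaurentSeries (ZMod p) →+* LaurentSeries (ZMod p) => ψ u) hφ

theorem mahlerM_iterate (k : ℕ) (u : LaurentSeries (ZMod p)) : mahlerM^[k] u = u ^ p ^ k := by
  induction k with
  | zero => simp
  | succ k ih => rw [Function.iterate_succ_apply', ih, mahlerM_eq_pow, ← pow_mul, ← pow_succ]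

theorem mahlerOp_eq (K : ℕ) (c : ℕ → Polynomial (ZMod p)) (u : LaurentSeries (ZMod p)) :
    mahlerOp K c u = ∑ k ∈ Finset.range (K + 1), polyToLaurent (c k) * u ^ p ^ k := by
  simp [mahlerOp, mahlerM_iterate]

theorem mahlerOp_ofPowerSeries (K : ℕ) (c : ℕ → Polynomial (ZMod p)) (f : PowerSeries (ZMod p)) :
    mahlerOp K c (HahnSeries.ofPowerSeries ℤ (ZMod p) f) = HahnSeries.ofPowerSeries ℤ (ZMod p)
      (∑ k ∈ Finset.range (K + 1), (c k : PowerSeries (ZMod p)) * f ^ p ^ k) := by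
  simp [mahlerOp_eq, polyToLaurent]

theorem mahlerOp_ofPowerSeries_eq_zero_iff (K : ℕ) (c : ℕ → Polynomial (ZMod p))
    (f : PowerSeries (ZMod p)) : mahlerOp K c (HahnSeries.ofPowerSeries ℤ (ZMod p) f) = 0 ↔
      ∑ k ∈ Finset.range (K + 1), (c k : PowerSeries (ZMod p)) * f ^ p ^ k = 0 := by
  rw [mahlerOp_ofPowerSeries, map_eq_zero_iff _ HahnSeries.ofPowerSeries_injective]

/-- The trailing coefficient of a Mahler equation of minimal order is not zero. -/
theorem trailing_ne_zero_of_minimal {f : PowerSeries (ZMod p)} {K : ℕ}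
    {c : ℕ → Polynomial (ZMod p)} (h : IsMinimalMahlerEquation f K c) : c 0 ≠ 0 := by
  intro h0
  obtain ⟨hK, heq, hmin⟩ := h
  rcases K with _ | K
  · exact hK h0
  rw [mahlerOp_ofPowerSeries_eq_zero_iff, Finset.sum_range_succ', h0] at heq
  simp only [Polynomial.coe_zero, zero_mul, add_zero] at heq
  have hp := (Fact.out : p.Prime)
  apply hK
  -- If `c_0 = 0`, all terms are `p`-th powers times polynomials, and each section of the equation
  -- is an equation of order one less with coefficients `S_r c_(k+1)`. Minimality makes its top
  -- coefficient vanish for every `r`, and a polynomial all of whose sections vanish is zero.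
  have hs : ∀ r < p, sectionOp p r (c (K + 1) : PowerSeries (ZMod p)) = 0 := by
    intro r hr
    have h1 : ∑ k ∈ Finset.range (K + 1),
        sectionOp p r (c (k + 1) : PowerSeries (ZMod p)) * f ^ p ^ k = 0 := by
      have : sectionOp p r (∑ k ∈ Finset.range (K + 1),
          (c (k + 1) : PowerSeries (ZMod p)) * f ^ p ^ (k + 1)) = 0 := by
        rw [heq]
        ext
        simp [sectionOp]
      rw [sectionOp_sum] at this
      rw [← this]
      refine Finset.sum_congr rfl fun k _ => ?_
      rw [pow_succ p k, pow_mul, sectionOp_mul_pow _ _ hr]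
    let c' : ℕ → Polynomial (ZMod p) := fun k =>
      PowerSeries.trunc ((c (k + 1)).natDegree + 1) (sectionOp p r (c (k + 1)))
    have hc' : ∀ k, (c' k : PowerSeries (ZMod p)) = sectionOp p r (c (k + 1)) := fun k => by
      ext n
      rw [Polynomial.coeff_coe, PowerSeries.coeff_trunc]
      split_ifs with hn
      · rfl
      · rw [sectionOp, PowerSeries.coeff_mk, Polynomial.coeff_coe,
          Polynomial.coeff_eq_zero_of_natDegree_lt]
        have := Nat.le_mul_of_pos_left n hp.pos
        omega
    have h2 := hmin K (by omega) c' (by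
      rw [mahlerOp_ofPowerSeries_eq_zero_iff]
      simpa only [hc'] using h1) K le_rfl
    rw [← hc', h2, Polynomial.coe_zero]
  rw [← Polynomial.coe_eq_zero_iff, sum_X_pow_mul_section_pow (c (K + 1) : PowerSeries (ZMod p))]
  exact Finset.sum_eq_zero fun r hr => by
    rw [hs r (Finset.mem_range.1 hr), zero_pow hp.ne_zero, mul_zero]

end MahlerMethod

namespace MahlerMethod

open Polynomial

section

variable {F : Type*} [Field F]

/-! ## Roots of bivariate polynomials in power series -/

local notation "ι" => (Polynomial.coeToPowerSeries.ringHom : F[X] →+* PowerSeries F)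

theorem coeff_coeff_swap (E : F[X][X]) (i j : ℕ) :
    ((Bivariate.swap E).coeff i).coeff j = (E.coeff j).coeff i := by
  induction E using Polynomial.induction_on' with
  | add p q hp hq => simp only [map_add, coeff_add, hp, hq]
  | monomial n a =>
    induction a using Polynomial.induction_on' with
    | add p q hp hq => simp only [map_add, coeff_add, hp, hq]
    | monomial m a =>
      rw [Bivariate.swap_monomial_monomial]
      simp only [coeff_monomial]
      split_ifs <;> simp_all [coeff_monomial]

theorem natDegree_coeff_le_iff (E : F[X][X]) (h : ℕ) :
    (∀ j, (E.coeff j).natDegree ≤ h) ↔ (Bivariate.swap E).natDegree ≤ h := by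
  simp only [natDegree_le_iff_coeff_eq_zero]
  refine ⟨fun H i hi => ?_, fun H j i hi => ?_⟩
  · ext j
    rw [coeff_coeff_swap, H j i hi, coeff_zero]
  · rw [← coeff_coeff_swap, H i hi, coeff_zero]

theorem coe_injective' : Function.Injective ι := Polynomial.coe_injective F

/-- The Bézout identity over the fraction field is evaluated at `x`, after extending `g` to that
field. -/
theorem not_common_root_of_isCoprime {R L : Type*} [CommRing R] [IsDomain R] [Field L]
    {g : R →+* L} (hg : Function.Injective g) {m q : R[X]}
    (h : IsCoprime (m.map (algebraMap R (FractionRing R))) (q.map (algebraMap R (FractionRing R))))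
    {x : L} (hm : m.eval₂ g x = 0) (hq : q.eval₂ g x = 0) : False := by
  obtain ⟨u, v, huv⟩ := h
  have hG : (IsFractionRing.lift hg).comp (algebraMap R (FractionRing R)) = g :=
    RingHom.ext fun x => IsFractionRing.lift_algebraMap hg x
  have := congrArg (eval₂ (IsFractionRing.lift hg) x) huv
  rw [eval₂_add, eval₂_mul, eval₂_mul, eval₂_map, eval₂_map, hG, hm, hq] at this
  simp at this

/-- A prime factor `m` of `E` with `m(f) = 0` works. By Gauss's lemma it stays irreducible over the
fraction field, hence is coprime to every nonzero polynomial of smaller degree in `y`. The degree in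
`x` is handled by exchanging the variables, so that both bounds come from divisibility. -/
theorem exists_minimal_factor {E : F[X][X]} (hE : E ≠ 0) {f : PowerSeries F}
    (hf : E.eval₂ ι f = 0) {d h : ℕ} (hd : E.natDegree ≤ d) (hh : ∀ j, (E.coeff j).natDegree ≤ h) :
    ∃ m : F[X][X], m.eval₂ ι f = 0 ∧ 0 < m.natDegree ∧ m.natDegree ≤ d ∧
      (∀ j, (m.coeff j).natDegree ≤ h) ∧
      ∀ q : F[X][X], q.natDegree < m.natDegree → q.eval₂ ι f = 0 → q = 0 := by
  obtain ⟨s, hs, hsE⟩ := UniqueFactorizationMonoid.exists_prime_factors E hE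
  obtain ⟨m, hms, hm⟩ : ∃ m ∈ s, m.eval₂ ι f = 0 := by
    have h1 : (eval₂RingHom ι f) s.prod = 0 := by
      obtain ⟨w, hw⟩ := hsE.symm
      rw [← hw, map_mul, coe_eval₂RingHom, hf, zero_mul]
    rw [map_multiset_prod, Multiset.prod_eq_zero_iff] at h1
    simpa using h1
  have hprime := hs m hms
  have hmE : m ∣ E := (Multiset.dvd_prod hms).trans hsE.dvd
  have hpos : 0 < m.natDegree := by
    rw [Nat.pos_iff_ne_zero]
    intro h0
    rw [eq_C_of_natDegree_eq_zero h0, eval₂_C] at hm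
    apply hprime.ne_zero
    rw [eq_C_of_natDegree_eq_zero h0, (map_eq_zero_iff _ coe_injective').1 hm, C_0]
  refine ⟨m, hm, hpos, (natDegree_le_of_dvd hmE hE).trans hd, ?_, ?_⟩
  · rw [natDegree_coeff_le_iff] at hh ⊢
    refine (natDegree_le_of_dvd (map_dvd Bivariate.swap hmE) ?_).trans hh
    exact (map_ne_zero_iff _ Bivariate.swap.injective).2 hE
  · intro q hq hqf
    by_contra hq0
    have hirr := hprime.irreducible
    have hprim := hirr.isPrimitive hpos.ne'
    rw [hprim.irreducible_iff_irreducible_map_fraction_map (K := FractionRing F[X])] at hirr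
    have hinj := IsFractionRing.injective F[X] (FractionRing F[X])
    have hcop : IsCoprime (m.map (algebraMap F[X] (FractionRing F[X])))
      (q.map (algebraMap F[X] (FractionRing F[X]))) := by
      rw [hirr.coprime_iff_not_dvd]
      intro hdvd
      have := natDegree_le_of_dvd hdvd (by rwa [Polynomial.map_ne_zero_iff hinj])
      rw [natDegree_map_eq_of_injective hinj, natDegree_map_eq_of_injective hinj] at this
      omega
    refine not_common_root_of_isCoprime (g := (HahnSeries.ofPowerSeries ℤ F).comp ι)
      (HahnSeries.ofPowerSeries_injective.comp coe_injective') hcop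
      (x := HahnSeries.ofPowerSeries ℤ F f) ?_ ?_
    · rw [← hom_eval₂, hm, map_zero]
    · rw [← hom_eval₂, hqf, map_zero]

/-- Taylor expansion at `g` gives `(f - g) (E_y(g) + k (f - g)) = 0`, and the second factor has
constant term `E_y(0,0) ≠ 0`. -/
theorem eval₂_unique {E : F[X][X]} (h1 : (E.coeff 1).coeff 0 ≠ 0) {f g : PowerSeries F}
    (hf : PowerSeries.constantCoeff f = 0) (hg : PowerSeries.constantCoeff g = 0)
    (hEf : E.eval₂ ι f = 0) (hEg : E.eval₂ ι g = 0) : f = g := by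
  rw [← eval_map] at hEf hEg
  obtain ⟨k, hk⟩ := (E.map ι).binomExpansion g (f - g)
  rw [add_sub_cancel, hEf, hEg, zero_add] at hk
  have h2 : (f - g) * ((E.map ι).derivative.eval g + k * (f - g)) = 0 := by rw [hk]; ring
  rcases mul_eq_zero.1 h2 with h | h
  · exact sub_eq_zero.1 h
  · exfalso
    apply h1
    have := congrArg PowerSeries.constantCoeff h
    rw [map_add, map_mul, map_sub, hf, hg, sub_self, mul_zero, add_zero, map_zero,
      derivative_map, eval_map, hom_eval₂, hg, eval₂_at_zero, coeff_derivative] at this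
    simpa using this

/-- Newton's method with one new coefficient per step. Coefficient `n` no longer changes after step
`n`, so the limit is read off on the diagonal. -/
theorem exists_eval₂_eq_zero {E : F[X][X]} (h0 : (E.coeff 0).coeff 0 = 0)
    (h1 : (E.coeff 1).coeff 0 ≠ 0) :
    ∃ f : PowerSeries F, PowerSeries.constantCoeff f = 0 ∧ E.eval₂ ι f = 0 := by
  have step : ∀ (n : ℕ) (g : PowerSeries F), PowerSeries.constantCoeff g = 0 →
      PowerSeries.X ^ (n + 1) ∣ (E.map ι).eval g →
      ∃ g' : PowerSeries F, PowerSeries.constantCoeff g' = 0 ∧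
        PowerSeries.X ^ (n + 2) ∣ (E.map ι).eval g' ∧ PowerSeries.X ^ (n + 1) ∣ g' - g := by
    rintro n g hg ⟨u, hu⟩
    -- This `a` solves `u(0) + E_y(0,0) a = 0` and so removes the coefficient of `X ^ (n + 1)`. The
    -- quadratic term of the expansion carries an extra factor `X ^ (n + 1)` and does not interfere.
    set a := -(PowerSeries.constantCoeff u / (E.coeff 1).coeff 0) with ha
    obtain ⟨k, hk⟩ := (E.map ι).binomExpansion g (PowerSeries.X ^ (n + 1) * PowerSeries.C a)
    refine ⟨g + PowerSeries.X ^ (n + 1) * PowerSeries.C a, by simp [hg], ?_, by simp⟩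
    rw [hk, hu]
    have e : PowerSeries.X ^ (n + 1) * u + eval g (derivative (E.map ι)) *
        (PowerSeries.X ^ (n + 1) * PowerSeries.C a) +
        k * (PowerSeries.X ^ (n + 1) * PowerSeries.C a) ^ 2 = PowerSeries.X ^ (n + 1) *
        (u + eval g (derivative (E.map ι)) * PowerSeries.C a +
          k * PowerSeries.C a ^ 2 * PowerSeries.X ^ (n + 1)) := by ring
    rw [e, pow_succ _ (n + 1)]
    refine mul_dvd_mul_left _ (PowerSeries.X_dvd_iff.2 ?_)
    rw [map_add, map_add, map_mul, derivative_map, eval_map, hom_eval₂, hg, eval₂_at_zero,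
      coeff_derivative]
    simp only [map_mul, map_pow, PowerSeries.constantCoeff_X, PowerSeries.constantCoeff_C, ha]
    simp
    field_simp
    simp
  have base : PowerSeries.X ^ (0 + 1) ∣ (E.map ι).eval 0 := by
    rw [zero_add, pow_one, PowerSeries.X_dvd_iff, eval_map, hom_eval₂, map_zero, eval₂_at_zero]
    simpa using h0
  let S := {x : ℕ × PowerSeries F // PowerSeries.constantCoeff x.2 = 0 ∧
    PowerSeries.X ^ (x.1 + 1) ∣ (E.map ι).eval x.2}
  let next : S → S := fun x => ⟨(x.1.1 + 1, (step x.1.1 x.1.2 x.2.1 x.2.2).choose),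
    (step x.1.1 x.1.2 x.2.1 x.2.2).choose_spec.1, (step x.1.1 x.1.2 x.2.1 x.2.2).choose_spec.2.1⟩
  let seq : ℕ → S := fun n => next^[n] ⟨(0, 0), by simp, base⟩
  have hsucc : ∀ n, seq (n + 1) = next (seq n) := fun n => Function.iterate_succ_apply' _ _ _
  have hidx : ∀ n, (seq n).1.1 = n := fun n => by
    induction n with
    | zero => rfl
    | succ n ih => rw [hsucc]; simp [next, ih]
  have hnext : ∀ x : S, PowerSeries.X ^ (x.1.1 + 1) ∣ (next x).1.2 - x.1.2 := fun x =>
    (step x.1.1 x.1.2 x.2.1 x.2.2).choose_spec.2.2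
  have hdiff : ∀ n, PowerSeries.X ^ (n + 1) ∣ (seq (n + 1)).1.2 - (seq n).1.2 := fun n => by
    have := hnext (seq n)
    rw [hidx] at this
    rw [hsucc]
    exact this
  have hstab : ∀ m n k, k ≤ n →
      PowerSeries.coeff k (seq (n + m)).1.2 = PowerSeries.coeff k (seq n).1.2 := fun m n k hk => by
    induction m with
    | zero => rfl
    | succ m ih =>
      rw [← ih, ← sub_eq_zero, ← map_sub]
      exact PowerSeries.X_pow_dvd_iff.1 (hdiff (n + m)) k (by omega)
  refine ⟨PowerSeries.mk fun n => PowerSeries.coeff n (seq n).1.2, ?_, ?_⟩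
  · rw [← PowerSeries.coeff_zero_eq_constantCoeff_apply, PowerSeries.coeff_mk]
    simp [seq]
  · set f := PowerSeries.mk fun n => PowerSeries.coeff n (seq n).1.2 with hf
    have hfn : ∀ n, PowerSeries.X ^ (n + 1) ∣ f - (seq n).1.2 := fun n => by
      refine PowerSeries.X_pow_dvd_iff.2 fun k hk => ?_
      rw [map_sub, hf, PowerSeries.coeff_mk, sub_eq_zero]
      obtain ⟨m, rfl⟩ := Nat.exists_eq_add_of_le (Nat.lt_succ_iff.1 hk)
      exact (hstab m k k le_rfl).symm
    ext n
    rw [← eval_map, map_zero]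
    have h2 : PowerSeries.X ^ (n + 1) ∣ (E.map ι).eval f := by
      have h3 := (hfn n).trans (sub_dvd_eval_sub f (seq n).1.2 (E.map ι))
      have h4 := (seq n).2.2
      rw [hidx] at h4
      have := dvd_add h3 h4
      rwa [sub_add_cancel] at this
    exact PowerSeries.X_pow_dvd_iff.1 h2 n (by omega)

/-! ## Degree bounds for Mahler equations -/

/-- Pseudo-division: multiply the previous remainder by `y` and by the leading coefficient of `m`,
then cancel the top coefficient with a multiple of `m`. Each step raises the degree in `x` by at
most `h`. -/
theorem exists_reduction {m : F[X][X]} {f : PowerSeries F} (hm : m.eval₂ ι f = 0)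
    (hpos : 0 < m.natDegree) {h : ℕ} (hh : ∀ j, (m.coeff j).natDegree ≤ h) (n : ℕ) :
    ∃ r : F[X][X], r.natDegree < m.natDegree ∧ (∀ j, (r.coeff j).natDegree ≤ h * n) ∧
      ι (m.leadingCoeff ^ n) * f ^ n = r.eval₂ ι f := by
  induction n with
  | zero => exact ⟨1, by simpa using hpos, fun j => by simp [coeff_one]; split_ifs <;> simp, by simp⟩
  | succ n ih =>
    obtain ⟨r, hr, hrh, hrf⟩ := ih
    set δ := m.natDegree with hδ
    refine ⟨C m.leadingCoeff * X * r - C (r.coeff (δ - 1)) * m, ?_, ?_, ?_⟩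
    · have h1 : (C m.leadingCoeff * X * r - C (r.coeff (δ - 1)) * m).natDegree ≤ δ - 1 := by
        rw [natDegree_le_iff_coeff_eq_zero]
        intro j hj
        obtain ⟨j, rfl⟩ : ∃ i, j = i + 1 := ⟨j - 1, by omega⟩
        rw [coeff_sub, mul_assoc, coeff_C_mul, coeff_X_mul, coeff_C_mul]
        rcases Nat.lt_or_ge (j + 1) (δ + 1) with h2 | h2
        · have : j = δ - 1 := by omega
          subst this
          rw [Nat.sub_add_cancel hpos, hδ, coeff_natDegree]
          ring
        · rw [coeff_eq_zero_of_natDegree_lt (p := r) (by omega),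
            coeff_eq_zero_of_natDegree_lt (p := m) (by omega)]
          simp
      omega
    · intro j
      rw [coeff_sub, mul_assoc, coeff_C_mul, coeff_C_mul]
      refine (natDegree_sub_le _ _).trans (max_le ?_ ?_)
      · refine natDegree_mul_le.trans ?_
        have h1 : (m.leadingCoeff).natDegree ≤ h := hh _
        have h2 : ((X * r).coeff j).natDegree ≤ h * n := by
          rcases j with _ | j
          · simp
          · rw [coeff_X_mul]; exact hrh j
        rw [mul_add, mul_one]
        omega
      · refine natDegree_mul_le.trans ?_
        have h1 := hrh (δ - 1)
        have h2 := hh j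
        rw [mul_add, mul_one]
        omega
    · rw [eval₂_sub, eval₂_mul, eval₂_mul, eval₂_mul, eval₂_C, eval₂_X, hm, mul_zero, sub_zero, ← hrf,
        map_pow, map_pow]
      ring

/-- One common denominator for all exponents up to `M`. The bound on the degree in `y` stands
outside the implication so that, after `choose`, it is available for every exponent. -/
theorem exists_reduction_of_le {m : F[X][X]} {f : PowerSeries F} (hm : m.eval₂ ι f = 0)
    (hpos : 0 < m.natDegree) {h : ℕ} (hh : ∀ j, (m.coeff j).natDegree ≤ h) (M n : ℕ) :
    ∃ r : F[X][X], r.natDegree < m.natDegree ∧ (n ≤ M → (∀ j, (r.coeff j).natDegree ≤ h * M) ∧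
      ι (m.leadingCoeff ^ M) * f ^ n = r.eval₂ ι f) := by
  obtain ⟨r, hr, hrh, hrf⟩ := exists_reduction hm hpos hh n
  refine ⟨C (m.leadingCoeff ^ (M - n)) * r, (natDegree_C_mul_le _ _).trans_lt hr, fun hn => ⟨?_, ?_⟩⟩
  · intro j
    rw [coeff_C_mul]
    refine natDegree_mul_le.trans ?_
    have h1 : (m.leadingCoeff ^ (M - n)).natDegree ≤ (M - n) * h :=
      natDegree_pow_le.trans (Nat.mul_le_mul_left _ (hh _))
    have h2 := hrh j
    calc _ ≤ (M - n) * h + h * n := by omega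
      _ = h * (M - n + n) := by ring
      _ = h * M := by rw [Nat.sub_add_cancel hn]
  · rw [eval₂_mul, eval₂_C, ← hrf, ← mul_assoc, ← map_mul, ← pow_add, Nat.sub_add_cancel hn]

theorem natDegree_det_le {n : ℕ} (G : Matrix (Fin n) (Fin n) F[X]) {b : ℕ}
    (hG : ∀ i j, (G i j).natDegree ≤ b) : G.det.natDegree ≤ n * b := by
  rw [Matrix.det_apply]
  refine natDegree_sum_le_of_forall_le _ _ fun σ _ => ?_
  refine (natDegree_smul_le _ _).trans ((natDegree_prod_le _ _).trans ?_)
  exact (Finset.sum_le_sum fun i _ => hG _ _).trans (by simp)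

/-- A combination of powers of an algebraic power series with polynomial coefficients vanishes if
it vanishes to a sufficiently high order. -/
theorem eq_zero_of_X_pow_dvd {m : F[X][X]} {f : PowerSeries F} (hm : m.eval₂ ι f = 0)
    (hpos : 0 < m.natDegree) {h : ℕ} (hh : ∀ j, (m.coeff j).natDegree ≤ h)
    (hmin : ∀ q : F[X][X], q.natDegree < m.natDegree → q.eval₂ ι f = 0 → q = 0)
    {K H Q σ : ℕ} (e : ℕ → ℕ) (he : ∀ k ≤ K, e k ≤ Q) (c : ℕ → F[X])
    (hc : ∀ k ≤ K, (c k).natDegree ≤ H) (hσ : m.natDegree * (H + h * (Q + m.natDegree)) < σ)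
    (hdvd : PowerSeries.X ^ σ ∣ ∑ k ∈ Finset.range (K + 1), (c k : PowerSeries F) * f ^ e k) :
    ∑ k ∈ Finset.range (K + 1), (c k : PowerSeries F) * f ^ e k = 0 := by
  set δ := m.natDegree with hδ
  set u := ∑ k ∈ Finset.range (K + 1), (c k : PowerSeries F) * f ^ e k with hu
  by_contra hu0
  choose r hr hr' using exists_reduction_of_le hm hpos hh (Q + δ)
  have ha : ι m.leadingCoeff ≠ 0 := by
    rw [Ne, map_eq_zero_iff _ coe_injective', leadingCoeff_eq_zero]
    intro h0
    rw [hδ, h0, natDegree_zero] at hpos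
    exact lt_irrefl _ hpos
  -- `g i` expresses `a^(Q+δ) u f^i`, with `a` the leading coefficient of `m`, in the basis `1, f,
  -- …, f^(δ-1)`. The exponent `Q + δ` covers all exponents `e k + i` with `i < δ`. The matrix `G`
  -- below is multiplication by `a^(Q+δ) u`, and its determinant is a norm.
  let g : ℕ → F[X][X] := fun i => ∑ k ∈ Finset.range (K + 1), C (c k) * r (e k + i)
  have hgf : ∀ i < δ, (g i).eval₂ ι f = ι (m.leadingCoeff ^ (Q + δ)) * u * f ^ i := fun i hi => by
    rw [eval₂_finsetSum, hu, Finset.mul_sum, Finset.sum_mul]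
    refine Finset.sum_congr rfl fun k hk => ?_
    have hk' := he k (by simpa [Nat.lt_succ_iff] using hk)
    rw [eval₂_mul, eval₂_C, ← (hr' (e k + i) (by omega)).2, pow_add]
    simp only [coeToPowerSeries.ringHom_apply]
    ring
  have hgdeg : ∀ i, (g i).natDegree < δ := fun i => by
    have : (g i).natDegree ≤ δ - 1 := natDegree_sum_le_of_forall_le _ _ fun k _ => by
      have := (natDegree_C_mul_le (c k) (r (e k + i))).trans_lt (hr (e k + i))
      omega
    omega
  have hgh : ∀ i < δ, ∀ j, ((g i).coeff j).natDegree ≤ H + h * (Q + δ) := fun i hi j => by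
    rw [finsetSum_coeff]
    refine natDegree_sum_le_of_forall_le _ _ fun k hk => ?_
    have hk' := he k (by simpa [Nat.lt_succ_iff] using hk)
    rw [coeff_C_mul]
    exact natDegree_mul_le.trans (add_le_add (hc k (by simpa [Nat.lt_succ_iff] using hk))
      ((hr' (e k + i) (by omega)).1 j))
  let G : Matrix (Fin δ) (Fin δ) F[X] := fun i j => (g i).coeff j
  have hG : ∀ i : Fin δ, ∑ j, ι (G i j) * f ^ (j : ℕ) =
      ι (m.leadingCoeff ^ (Q + δ)) * u * f ^ (i : ℕ) := fun i => by
    rw [← hgf i i.2, eval₂_eq_sum_range' ι (hgdeg i), Finset.sum_range]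
  -- A vector in the left kernel would yield a nonzero polynomial in `f` of degree less than `δ`
  -- that is annihilated by `u ≠ 0`, against the minimality of `m`.
  have hdet : G.det ≠ 0 := by
    intro h0
    obtain ⟨v, hv0, hv⟩ := Matrix.exists_vecMul_eq_zero_iff.2 h0
    have h1 : ι (m.leadingCoeff ^ (Q + δ)) * u * ∑ i, ι (v i) * f ^ (i : ℕ) = 0 := by
      calc _ = ∑ i, ι (v i) * (ι (m.leadingCoeff ^ (Q + δ)) * u * f ^ (i : ℕ)) := by
            rw [Finset.mul_sum]
            exact Finset.sum_congr rfl fun i _ => by ring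
        _ = ∑ i, ∑ j, ι (v i * G i j) * f ^ (j : ℕ) := by
            refine Finset.sum_congr rfl fun i _ => ?_
            rw [← hG, Finset.mul_sum]
            exact Finset.sum_congr rfl fun j _ => by rw [map_mul]; ring
        _ = ∑ j, ι (Matrix.vecMul v G j) * f ^ (j : ℕ) := by
            rw [Finset.sum_comm]
            refine Finset.sum_congr rfl fun j _ => ?_
            rw [Matrix.vecMul, dotProduct, map_sum, Finset.sum_mul]
        _ = 0 := by simp [hv]
    have h2 : ∑ i, ι (v i) * f ^ (i : ℕ) = 0 := by
      rcases mul_eq_zero.1 h1 with h | h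
      · rcases mul_eq_zero.1 h with h | h
        · rw [map_pow] at h
          exact absurd (eq_zero_of_pow_eq_zero h) ha
        · exact absurd h hu0
      · exact h
    let q : F[X][X] := ∑ i : Fin δ, monomial (i : ℕ) (v i)
    have hq : q = 0 := by
      refine hmin q ?_ ?_
      · have : q.natDegree ≤ δ - 1 := natDegree_sum_le_of_forall_le _ _ fun i _ =>
          (natDegree_monomial_le _).trans (by omega)
        omega
      · rw [eval₂_finsetSum, ← h2]
        simp [eval₂_monomial]
    apply hv0
    funext i
    have := congrArg (fun w => coeff w (i : ℕ)) hq
    simp only [q, finsetSum_coeff, coeff_monomial, coeff_zero] at this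
    rw [Finset.sum_eq_single i] at this
    · simpa using this
    · intro b _ hb
      rw [if_neg (fun h => hb (Fin.ext h))]
    · simp
  -- The powers `f^j` form an eigenvector of `G` with eigenvalue `a^(Q+δ) u`. Applying the adjugate
  -- and reading the entry with `f^0 = 1` shows that `u`, hence `X ^ σ`, divides the determinant.
  -- Its degree is at most `δ (H + h (Q + δ)) < σ`, so it would be zero.
  have hdvd' : PowerSeries.X ^ σ ∣ ι G.det := by
    have h1 : (G.map ι).adjugate.mulVec ((G.map ι).mulVec fun j : Fin δ => f ^ (j : ℕ)) =
        (G.map ι).det • fun j : Fin δ => f ^ (j : ℕ) := by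
      rw [Matrix.mulVec_mulVec, Matrix.adjugate_mul, Matrix.smul_mulVec, Matrix.one_mulVec]
    have h2 : (G.map ι).mulVec (fun j : Fin δ => f ^ (j : ℕ)) =
        (ι (m.leadingCoeff ^ (Q + δ)) * u) • fun j : Fin δ => f ^ (j : ℕ) := by
      funext i
      exact hG i
    rw [h2, Matrix.mulVec_smul] at h1
    have h3 := congrFun h1 ⟨0, hpos⟩
    simp only [Pi.smul_apply, smul_eq_mul, pow_zero, mul_one] at h3
    rw [RingHom.map_det, RingHom.mapMatrix_apply, ← h3]
    exact (hdvd.mul_left _).mul_right _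
  have := natDegree_det_le G fun i j => hgh i i.2 j
  apply hdet
  ext n
  rw [coeff_zero]
  rcases Nat.lt_or_ge n σ with hn | hn
  · have := PowerSeries.X_pow_dvd_iff.1 hdvd' n hn
    simpa using this
  · exact coeff_eq_zero_of_natDegree_lt (by omega)

/-- Siegel's lemma for polynomials. -/
theorem exists_small_solution {J : Type*} [Fintype J] {K T : ℕ} (hJ : Fintype.card J ≤ K)
    (v : J → Fin (K + 1) → F[X]) (hv : ∀ j k, (v j k).natDegree ≤ T) :
    ∃ c : Fin (K + 1) → F[X], c ≠ 0 ∧ (∀ k, (c k).natDegree ≤ K * T) ∧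
      ∀ j, ∑ k, v j k * c k = 0 := by
  let Φ : (Fin (K + 1) → degreeLT F (K * T + 1)) →ₗ[F] (J → Fin (K * T + T + 1) → F) :=
    LinearMap.pi fun j => LinearMap.pi fun i =>
      (lcoeff F (i : ℕ)).comp (∑ k, (LinearMap.mulLeft F (v j k)).comp
        ((degreeLT F (K * T + 1)).subtype.comp (LinearMap.proj k)))
  have hΦ : ∀ c j i, Φ c j i = (∑ k, v j k * (c k : F[X])).coeff i := fun c j i => by
    simp [Φ]
  have hfin : Module.Finite F (degreeLT F (K * T + 1)) :=
    Module.Finite.equiv (degreeLTEquiv F (K * T + 1)).symm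
  -- Even with all `K` equations, the `(K + 1)(K T + 1)` unknown coefficients exceed the `K (K T + T
  -- + 1)` conditions by exactly one.
  have hrank : Module.finrank F (J → Fin (K * T + T + 1) → F) <
      Module.finrank F (Fin (K + 1) → degreeLT F (K * T + 1)) := by
    have e : Module.finrank F (degreeLT F (K * T + 1)) = K * T + 1 := by
      rw [(degreeLTEquiv F (K * T + 1)).finrank_eq, Module.finrank_fin_fun]
    have e1 : Module.finrank F (J → Fin (K * T + T + 1) → F) =
        Fintype.card J * (K * T + T + 1) := by
      rw [Module.finrank_pi_fintype, Module.finrank_fin_fun, Finset.sum_const, Finset.card_univ,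
        smul_eq_mul]
    have e2 : Module.finrank F (Fin (K + 1) → degreeLT F (K * T + 1)) = (K + 1) * (K * T + 1) := by
      rw [Module.finrank_pi_fintype, e, Finset.sum_const, Finset.card_univ, Fintype.card_fin,
        smul_eq_mul]
    rw [e1, e2]
    calc _ ≤ K * (K * T + T + 1) := Nat.mul_le_mul_right _ hJ
      _ < (K + 1) * (K * T + 1) := by ring_nf; omega
  have hker := Φ.ker_ne_bot_of_finrank_lt hrank
  obtain ⟨c, hc, hc0⟩ := (Submodule.ne_bot_iff _).1 hker
  have hdeg : ∀ k, (c k : F[X]).natDegree ≤ K * T := fun k => by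
    have := mem_degreeLT.1 (c k).2
    by_cases h0 : (c k : F[X]) = 0
    · simp [h0]
    · rw [degree_eq_natDegree h0] at this
      exact Nat.lt_succ_iff.1 (by exact_mod_cast this)
  refine ⟨fun k => c k, fun h => hc0 ?_, hdeg, fun j => ?_⟩
  · funext k
    exact Subtype.ext (congrFun h k)
  · ext i
    rw [coeff_zero]
    rcases Nat.lt_or_ge i (K * T + T + 1) with hi | hi
    · have := congrFun (congrFun (LinearMap.mem_ker.1 hc) j) ⟨i, hi⟩
      rwa [hΦ] at this
    · refine coeff_eq_zero_of_natDegree_lt (lt_of_le_of_lt ?_ hi)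
      refine natDegree_sum_le_of_forall_le _ _ fun k _ => natDegree_mul_le.trans ?_
      have h1 := hv j k
      have h2 : ((c k : F[X])).natDegree ≤ _ := hdeg k
      exact (add_le_add h1 h2).trans (by omega)

/-- A nonzero solution bounds the rank by `K`. At most `K` of the rows then span all the others over
the fraction field, and Siegel's lemma for these rows solves the whole system, whatever its number
of rows. -/
theorem exists_small_solution_of_solution {J : Type*} [Finite J] {K T : ℕ}
    (v : J → Fin (K + 1) → F[X]) (hv : ∀ j k, (v j k).natDegree ≤ T) {c₀ : Fin (K + 1) → F[X]}
    (hc₀ : c₀ ≠ 0) (h₀ : ∀ j, ∑ k, v j k * c₀ k = 0) :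
    ∃ c : Fin (K + 1) → F[X], c ≠ 0 ∧ (∀ k, (c k).natDegree ≤ K * T) ∧
      ∀ j, ∑ k, v j k * c k = 0 := by
  let L := FractionRing F[X]
  let φ := algebraMap F[X] L
  have hφ : Function.Injective φ := IsFractionRing.injective F[X] L
  let w : J → Fin (K + 1) → L := fun j k => φ (v j k)
  obtain ⟨b, hb, hspan, hli⟩ := exists_linearIndependent L (Set.range w)
  have hbfin : b.Finite := (Set.finite_range w).subset hb
  have := hbfin.fintype
  let ev : (Fin (K + 1) → F[X]) → (Fin (K + 1) → L) →ₗ[L] L := fun c =>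
    ∑ k, φ (c k) • LinearMap.proj k
  have hev : ∀ c j, ev c (w j) = φ (∑ k, v j k * c k) := fun c j => by
    simp [ev, w, map_sum, mul_comm]
  have hlt : Module.finrank L (Submodule.span L b) < K + 1 := by
    have h1 : Submodule.span L b ≤ LinearMap.ker (ev c₀) := by
      rw [hspan, Submodule.span_le]
      rintro _ ⟨j, rfl⟩
      simp [hev, h₀]
    have h2 : LinearMap.ker (ev c₀) ≠ ⊤ := by
      intro h
      rw [LinearMap.ker_eq_top] at h
      apply hc₀
      funext k
      have := congrArg (fun f => f (Pi.single k 1)) h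
      simp only [ev, LinearMap.sum_apply, LinearMap.smul_apply, LinearMap.proj_apply,
        LinearMap.zero_apply, smul_eq_mul] at this
      rw [Finset.sum_eq_single k] at this
      · simpa [map_eq_zero_iff φ hφ] using this
      · intro i _ hi
        simp [hi]
      · simp
    have h3 := Submodule.finrank_lt (lt_of_le_of_lt h1 (lt_top_iff_ne_top.2 h2)).ne
    simpa using h3
  have hcard : Fintype.card b ≤ K := by
    have : Module.finrank L (Submodule.span L b) = Fintype.card b := by
      have := finrank_span_eq_card hli
      rwa [Subtype.range_coe] at this
    omega
  choose i hi using fun x : b => hb x.2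
  obtain ⟨c, hc0, hcdeg, hc⟩ := exists_small_solution hcard (fun x : b => v (i x)) fun x => hv _
  refine ⟨c, hc0, hcdeg, fun j => ?_⟩
  have h1 : Submodule.span L b ≤ LinearMap.ker (ev c) := by
    rw [Submodule.span_le]
    intro x hx
    have := hi ⟨x, hx⟩
    simp only at this
    rw [SetLike.mem_coe, LinearMap.mem_ker, ← this, hev, hc ⟨x, hx⟩, map_zero]
  have h2 : w j ∈ Submodule.span L b := by
    rw [hspan]
    exact Submodule.subset_span ⟨j, rfl⟩
  have := h1 h2
  rw [LinearMap.mem_ker, hev, map_eq_zero_iff φ hφ] at this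
  exact this

/-- Relations between the `f^(e k)` are the solutions of a linear system whose columns are the
reductions of these powers modulo `m`, with entries of degree at most `h Q`. It has `natDegree m`
equations in `K + 1` unknowns; either this is few enough, or the given relation bounds the rank. -/
theorem exists_small_relation {m : F[X][X]} {f : PowerSeries F} (hm : m.eval₂ ι f = 0)
    (hpos : 0 < m.natDegree) {h : ℕ} (hh : ∀ j, (m.coeff j).natDegree ≤ h)
    (hmin : ∀ q : F[X][X], q.natDegree < m.natDegree → q.eval₂ ι f = 0 → q = 0)
    {K Q : ℕ} (e : ℕ → ℕ) (he : ∀ k ≤ K, e k ≤ Q)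
    (hK : m.natDegree ≤ K ∨ ∃ c : ℕ → F[X], (∃ k ≤ K, c k ≠ 0) ∧
      ∑ k ∈ Finset.range (K + 1), (c k : PowerSeries F) * f ^ e k = 0) :
    ∃ c : ℕ → F[X], (∃ k ≤ K, c k ≠ 0) ∧ (∀ k, (c k).natDegree ≤ K * (h * Q)) ∧
      ∑ k ∈ Finset.range (K + 1), (c k : PowerSeries F) * f ^ e k = 0 := by
  set δ := m.natDegree with hδ
  choose r hr hr' using exists_reduction_of_le hm hpos hh Q
  have ha : ι m.leadingCoeff ≠ 0 := by
    rw [Ne, map_eq_zero_iff _ coe_injective', leadingCoeff_eq_zero]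
    intro h0
    rw [hδ, h0, natDegree_zero] at hpos
    exact lt_irrefl _ hpos
  let v : Fin δ → Fin (K + 1) → F[X] := fun j k => (r (e k)).coeff j
  have hv : ∀ j k, (v j k).natDegree ≤ h * Q := fun j k =>
    (hr' (e k) (he k (by omega))).1 j
  have hsum : ∀ c : Fin (K + 1) → F[X], ι (m.leadingCoeff ^ Q) *
      ∑ k, (c k : PowerSeries F) * f ^ e k = (∑ k, C (c k) * r (e k)).eval₂ ι f := fun c => by
    rw [eval₂_finsetSum, Finset.mul_sum]
    refine Finset.sum_congr rfl fun k _ => ?_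
    rw [eval₂_mul, eval₂_C, ← (hr' (e k) (he k (by omega))).2]
    simp only [coeToPowerSeries.ringHom_apply]
    ring
  have hdeg : ∀ c : Fin (K + 1) → F[X], (∑ k, C (c k) * r (e k)).natDegree < δ := fun c => by
    have : (∑ k, C (c k) * r (e k)).natDegree ≤ δ - 1 :=
      natDegree_sum_le_of_forall_le _ _ fun k _ => by
        have := (natDegree_C_mul_le (c k) (r (e k))).trans_lt (hr (e k))
        omega
    omega
  have hiff : ∀ c : Fin (K + 1) → F[X], (∑ k, (c k : PowerSeries F) * f ^ e k = 0) ↔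
      ∀ j, ∑ k, v j k * c k = 0 := fun c => by
    have h1 : (∑ k, (c k : PowerSeries F) * f ^ e k = 0) ↔ ∑ k, C (c k) * r (e k) = 0 := by
      constructor
      · intro h0
        refine hmin _ (hdeg c) ?_
        rw [← hsum, h0, mul_zero]
      · intro h0
        have := hsum c
        rw [h0, eval₂_zero, map_pow] at this
        exact (mul_eq_zero.1 this).resolve_left (pow_ne_zero _ ha)
    rw [h1, Polynomial.ext_iff]
    constructor
    · intro h0 j
      have := h0 j
      simp only [finsetSum_coeff, coeff_C_mul, coeff_zero] at this
      simpa only [v, mul_comm] using this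
    · intro h0 j
      rw [coeff_zero]
      rcases Nat.lt_or_ge j δ with hj | hj
      · have := h0 ⟨j, hj⟩
        simp only [finsetSum_coeff, coeff_C_mul]
        simpa only [v, mul_comm] using this
      · exact coeff_eq_zero_of_natDegree_lt ((hdeg c).trans_le hj)
  obtain ⟨c, hc0, hcdeg, hc⟩ : ∃ c : Fin (K + 1) → F[X], c ≠ 0 ∧
      (∀ k, (c k).natDegree ≤ K * (h * Q)) ∧ ∀ j, ∑ k, v j k * c k = 0 := by
    rcases hK with hK | ⟨c, ⟨k, hk, hck⟩, hc⟩
    · exact exists_small_solution (by simpa using hK) v hv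
    · refine exists_small_solution_of_solution v hv (c₀ := fun k => c k) ?_ ?_
      · intro h0
        exact hck (congrFun h0 ⟨k, by omega⟩)
      · rw [← hiff]
        rwa [Finset.sum_range] at hc
  refine ⟨fun k => if hk : k < K + 1 then c ⟨k, hk⟩ else 0, ?_, fun k => ?_, ?_⟩
  · obtain ⟨k, hk⟩ := Function.ne_iff.1 hc0
    exact ⟨k, by omega, by simp only [dif_pos k.2]; exact hk⟩
  · by_cases hk : k < K + 1
    · simp only [dif_pos hk]
      exact hcdeg _
    · simp only [dif_neg hk, natDegree_zero]
      exact Nat.zero_le _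
  · rw [Finset.sum_range, ← (hiff c).2 hc]
    exact Finset.sum_congr rfl fun k _ => by simp only [dif_pos k.2]

end

end MahlerMethod

namespace MahlerMethod

open Polynomial

section

variable {F : Type*} [Field F]

/-! ## Hermite–Padé approximation

Vectors of `n` polynomials are interleaved into a single polynomial, on which the variable acts as
multiplication by `X ^ n`. -/

/-- The coefficient of index `n * (t + 1) - 1` of the product of `b` and the series `Ψ`. -/
noncomputable def residue (n : ℕ) (Ψ : ℕ → F) (t : ℕ) (b : F[X]) : F :=
  ∑ i ∈ Finset.range (n * (t + 1)), b.coeff i * Ψ (n * (t + 1) - 1 - i)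

variable {n : ℕ} {Ψ : ℕ → F}

theorem residue_add (t : ℕ) (b b' : F[X]) :
    residue n Ψ t (b + b') = residue n Ψ t b + residue n Ψ t b' := by
  simp [residue, add_mul, Finset.sum_add_distrib]

theorem residue_sub (t : ℕ) (b b' : F[X]) :
    residue n Ψ t (b - b') = residue n Ψ t b - residue n Ψ t b' := by
  simp [residue, sub_mul, Finset.sum_sub_distrib]

theorem residue_C_mul (t : ℕ) (a : F) (b : F[X]) :
    residue n Ψ t (C a * b) = a * residue n Ψ t b := by
  simp [residue, Finset.mul_sum, mul_assoc]

theorem residue_sum {ι : Type*} (t : ℕ) (s : Finset ι) (b : ι → F[X]) :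
    residue n Ψ t (∑ i ∈ s, b i) = ∑ i ∈ s, residue n Ψ t (b i) := by
  classical
  induction s using Finset.induction_on with
  | empty => simp [residue]
  | insert i s hi ih => rw [Finset.sum_insert hi, Finset.sum_insert hi, residue_add, ih]

theorem residue_X_pow_mul_zero (b : F[X]) : residue n Ψ 0 (X ^ n * b) = 0 :=
  Finset.sum_eq_zero fun i hi => by
    rw [coeff_X_pow_mul', if_neg (by simpa using hi), zero_mul]

theorem residue_X_pow_mul_succ (t : ℕ) (b : F[X]) :
    residue n Ψ (t + 1) (X ^ n * b) = residue n Ψ t b := by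
  rw [residue, show n * (t + 1 + 1) = n + n * (t + 1) by ring, Finset.sum_range_add,
    Finset.sum_eq_zero, zero_add, residue]
  · refine Finset.sum_congr rfl fun i _ => ?_
    rw [coeff_X_pow_mul', if_pos (by omega)]
    congr 2 <;> omega
  · intro i hi
    rw [coeff_X_pow_mul', if_neg (by simpa using hi), zero_mul]

theorem residue_X_pow_mul_mul (m t : ℕ) (b : F[X]) :
    residue n Ψ t (X ^ (n * m) * b) = if m ≤ t then residue n Ψ (t - m) b else 0 := by
  induction m generalizing t with
  | zero => simp
  | succ m ih =>
    rw [mul_add, mul_one, add_comm, pow_add, mul_assoc]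
    rcases t with _ | t
    · rw [residue_X_pow_mul_zero, if_neg (by omega)]
    · rw [residue_X_pow_mul_succ, ih, Nat.add_sub_add_right]
      simp

/-- `expand F n q` is `q(X^n)`, the scalar `q` acting on interleaved vectors. The residues of a
vector behave under it like the coefficients of a power series multiplied by `q`. -/
theorem residue_expand_mul (t : ℕ) (q b : F[X]) :
    residue n Ψ t (expand F n q * b) =
      ∑ m ∈ Finset.range (t + 1), q.coeff m * residue n Ψ (t - m) b := by
  induction q using Polynomial.induction_on' with
  | add q q' h h' => simp [add_mul, residue_add, h, h', Finset.sum_add_distrib]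
  | monomial k a =>
    rw [expand_monomial, ← C_mul_X_pow_eq_monomial, mul_comm k n, mul_assoc, residue_C_mul,
      residue_X_pow_mul_mul]
    simp only [coeff_monomial, ite_mul, zero_mul, Finset.sum_ite_eq, Finset.mem_range,
      Nat.lt_succ_iff, mul_ite, mul_zero]

/-- The polynomials `B i`, with degree bounds `δ i`, form a reduced basis of the module of all
polynomials whose residues of index less than `t` vanish. -/
structure IsReducedBasis (n : ℕ) (Ψ : ℕ → F) (t : ℕ) (B : ℕ → F[X]) (δ : ℕ → ℕ) : Prop where
  residue_eq_zero : ∀ i < n, ∀ τ < t, residue n Ψ τ (B i) = 0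
  natDegree_lt : ∀ i < n, (B i).natDegree < n * (δ i + 1)
  le_time : ∀ i < n, δ i ≤ t
  -- The predictable degree property: coordinates exist whose terms all respect the degree bound of
  -- `P`, so nothing is lost by cancellation and a short vector forces a short basis vector.
  exists_coordinates : ∀ (P : F[X]) (D : ℕ), P.natDegree < n * (D + 1) →
    (∀ τ < t, residue n Ψ τ P = 0) → ∃ q : ℕ → F[X],
      (∀ i < n, q i ≠ 0 → (q i).natDegree + δ i ≤ D) ∧
      P = ∑ i ∈ Finset.range n, expand F n (q i) * B i

theorem coeff_expand_mul_X_pow {k : ℕ} (hk : k < n) (q : F[X]) (j : ℕ) :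
    (expand F n q * X ^ k).coeff j = if k = j % n then q.coeff (j / n) else 0 := by
  have hn : 0 < n := by omega
  have hj := Nat.div_add_mod j n
  rw [coeff_mul_X_pow', coeff_expand hn]
  by_cases h : k = j % n
  · have e : j - k = n * (j / n) := by omega
    rw [if_pos (h ▸ Nat.mod_le _ _), e, if_pos (dvd_mul_right _ _), Nat.mul_div_cancel_left _ hn,
      if_pos h]
  · rw [if_neg h]
    split_ifs with h2 h3
    · exfalso
      obtain ⟨q, hq⟩ := h3
      apply h
      have : j = k + n * q := by omega
      rw [this, Nat.add_mul_mod_self_left, Nat.mod_eq_of_lt hk]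
    · rfl
    · rfl

theorem exists_eq_sum_expand_mul_X_pow (hn : 0 < n) (P : F[X]) {D : ℕ}
    (hP : P.natDegree < n * (D + 1)) : ∃ q : ℕ → F[X], (∀ i, (q i).natDegree ≤ D) ∧
      P = ∑ i ∈ Finset.range n, expand F n (q i) * X ^ i := by
  refine ⟨fun i => ∑ m ∈ Finset.range (D + 1), monomial m (P.coeff (n * m + i)), fun i => ?_, ?_⟩
  · refine natDegree_sum_le_of_forall_le _ _ fun m hm => (natDegree_monomial_le _).trans ?_
    simpa [Nat.lt_succ_iff] using hm
  · ext j
    rw [finsetSum_coeff, Finset.sum_congr rfl fun i hi =>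
      coeff_expand_mul_X_pow (Finset.mem_range.1 hi) _ j, Finset.sum_ite_eq',
      if_pos (Finset.mem_range.2 (Nat.mod_lt _ hn))]
    simp only [finsetSum_coeff, coeff_monomial, Finset.sum_ite_eq', Finset.mem_range]
    rw [Nat.div_add_mod]
    split_ifs with h
    · rfl
    · refine coeff_eq_zero_of_natDegree_lt (hP.trans_le ?_)
      calc n * (D + 1) ≤ n * (j / n) := Nat.mul_le_mul_left _ (by omega)
        _ ≤ j := Nat.mul_div_le j n

theorem IsReducedBasis.init (hn : 0 < n) : IsReducedBasis n Ψ 0 (fun i => X ^ i) fun _ => 0 where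
  residue_eq_zero := by simp
  natDegree_lt i hi := by simpa using hi
  le_time := by simp
  exists_coordinates P D hP _ := by
    obtain ⟨q, hq, h⟩ := exists_eq_sum_expand_mul_X_pow hn P hP
    exact ⟨q, fun i _ _ => by simpa using hq i, h⟩

theorem IsReducedBasis.succ_of_residue_eq_zero {t : ℕ} {B : ℕ → F[X]} {δ : ℕ → ℕ}
    (h : IsReducedBasis n Ψ t B δ) (h0 : ∀ i < n, residue n Ψ t (B i) = 0) :
    IsReducedBasis n Ψ (t + 1) B δ where
  residue_eq_zero i hi τ hτ := by
    rcases Nat.lt_succ_iff_lt_or_eq.1 hτ with hτ | rfl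
    · exact h.residue_eq_zero i hi τ hτ
    · exact h0 i hi
  natDegree_lt := h.natDegree_lt
  le_time i hi := (h.le_time i hi).trans (Nat.le_succ t)
  exists_coordinates P D hP hr := h.exists_coordinates P D hP fun τ hτ => hr τ (by omega)

/-- The pivot has least degree bound among the rows with nonzero residue, so eliminating with it
raises no degree bound. The pivot itself is multiplied by the variable `X ^ n`, which shifts its
residues by one. This costs one unit of degree and kills the residue of index `t`. -/
theorem IsReducedBasis.succ {t : ℕ} {B : ℕ → F[X]} {δ : ℕ → ℕ}
    (h : IsReducedBasis n Ψ t B δ) {k : ℕ} (hk : k < n) (hr : residue n Ψ t (B k) ≠ 0)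
    (hmin : ∀ i < n, residue n Ψ t (B i) ≠ 0 → δ k ≤ δ i) :
    IsReducedBasis n Ψ (t + 1)
      (fun i => if i = k then X ^ n * B k
        else B i - C (residue n Ψ t (B i) / residue n Ψ t (B k)) * B k)
      (fun i => if i = k then δ k + 1 else δ i) where
  residue_eq_zero i hi τ hτ := by
    split_ifs with hik
    · rcases τ with _ | τ
      · exact residue_X_pow_mul_zero _
      · rw [residue_X_pow_mul_succ]
        exact h.residue_eq_zero k hk τ (by omega)
    · rw [residue_sub, residue_C_mul]
      rcases Nat.lt_succ_iff_lt_or_eq.1 hτ with hτ | rfl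
      · rw [h.residue_eq_zero i hi τ hτ, h.residue_eq_zero k hk τ hτ]
        simp
      · field_simp
        simp
  natDegree_lt i hi := by
    split_ifs with hik
    · refine lt_of_le_of_lt natDegree_mul_le ?_
      have := h.natDegree_lt k hk
      rw [natDegree_X_pow, mul_add n (δ k + 1)]
      omega
    · by_cases hri : residue n Ψ t (B i) = 0
      · simpa [hri] using h.natDegree_lt i hi
      · refine lt_of_le_of_lt (natDegree_sub_le _ _) (max_lt (h.natDegree_lt i hi) ?_)
        refine lt_of_le_of_lt (natDegree_C_mul_le _ _) ((h.natDegree_lt k hk).trans_le ?_)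
        exact Nat.mul_le_mul_left _ (Nat.succ_le_succ (hmin i hi hri))
  le_time i hi := by
    split_ifs
    · exact Nat.succ_le_succ (h.le_time k hk)
    · exact (h.le_time i hi).trans (Nat.le_succ t)
  exists_coordinates P D hP hP0 := by
    have hn : 0 < n := by omega
    set r : ℕ → F := fun i => residue n Ψ t (B i) with hrdef
    obtain ⟨q, hq, hPq⟩ := h.exists_coordinates P D hP fun τ hτ => hP0 τ (by omega)
    have hzero : ∀ i < n, (q i).coeff 0 ≠ 0 → r i ≠ 0 → (q i).natDegree + δ k ≤ D := by
      intro i hi h1 h2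
      have := hq i hi (fun h0 => h1 (by simp [h0]))
      have := hmin i hi h2
      omega
    have hsum0 : ∑ i ∈ Finset.range n, (q i).coeff 0 * r i = 0 := by
      rw [← hP0 t (Nat.lt_succ_self t), hPq, residue_sum]
      refine Finset.sum_congr rfl fun i hi => ?_
      rw [residue_expand_mul, Finset.sum_eq_single 0]
      · rfl
      · intro m _ hm
        rw [Finset.mem_range] at hi
        rcases Nat.lt_or_ge t m with hmt | hmt
        · rename_i hmem
          simp at hmem
          omega
        · rw [h.residue_eq_zero i hi (t - m) (by omega), mul_zero]
      · simp
    -- `Q` is the pivot coordinate after elimination from the other rows. Vanishing of the residue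
    -- of `P` at `t` says that `Q(0) = 0`, so `Q` is divisible by the variable and the quotient is
    -- the coordinate at the shifted pivot.
    let Q : F[X] := ∑ i ∈ Finset.range n, C (r i / r k) * q i
    have hQ0 : Q.coeff 0 = 0 := by
      simp only [Q, finsetSum_coeff, coeff_C_mul]
      have : ∑ i ∈ Finset.range n, r i / r k * (q i).coeff 0 =
          (∑ i ∈ Finset.range n, (q i).coeff 0 * r i) / r k := by
        rw [Finset.sum_div]
        exact Finset.sum_congr rfl fun i _ => by ring
      rw [this, hsum0, zero_div]
    obtain ⟨Q', hQ'⟩ := X_dvd_iff.2 hQ0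
    have hQdeg : Q' ≠ 0 → Q'.natDegree + (δ k + 1) ≤ D := by
      intro hQ'0
      have h1 : Q.natDegree = Q'.natDegree + 1 := by rw [hQ', natDegree_X_mul hQ'0]
      -- The degree of `Q` is attained by some `q i` whose row has nonzero residue. As `δ k ≤ δ i`,
      -- the bound for `q i` passes to `Q`.
      have h2 : ∃ i < n, q i ≠ 0 ∧ r i ≠ 0 ∧ Q.natDegree ≤ (q i).natDegree := by
        by_contra hcon
        push Not at hcon
        have : Q.coeff Q.natDegree = 0 := by
          conv_lhs => rw [show Q = ∑ i ∈ Finset.range n, C (r i / r k) * q i from rfl]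
          rw [finsetSum_coeff]
          refine Finset.sum_eq_zero fun i hi => ?_
          rw [coeff_C_mul]
          by_cases hr0 : r i = 0
          · simp [hr0]
          by_cases hq0 : q i = 0
          · simp [hq0]
          rw [coeff_eq_zero_of_natDegree_lt (hcon i (Finset.mem_range.1 hi) hq0 hr0), mul_zero]
        rw [coeff_natDegree, leadingCoeff_eq_zero] at this
        rw [this] at hQ'
        exact hQ'0 (by simpa using hQ'.symm)
      obtain ⟨i, hi, hqi, hri, hle⟩ := h2
      have h3 := hq i hi hqi
      have h4 := hmin i hi hri
      omega
    refine ⟨fun i => if i = k then Q' else q i, fun i hi => ?_, ?_⟩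
    · by_cases hik : i = k
      · simpa [hik] using hQdeg
      · simpa [hik] using hq i hi
    · have hk' := Finset.mem_range.2 hk
      rw [← Finset.add_sum_erase _ _ hk']
      simp only [if_true]
      have e1 : ∑ i ∈ (Finset.range n).erase k, expand F n (if i = k then Q' else q i) *
          (if i = k then X ^ n * B k else B i - C (r i / r k) * B k) =
          ∑ i ∈ (Finset.range n).erase k, (expand F n (q i) * B i -
            expand F n (C (r i / r k) * q i) * B k) := by
        refine Finset.sum_congr rfl fun i hi => ?_
        have hik := Finset.ne_of_mem_erase hi
        rw [if_neg hik, if_neg hik, map_mul, expand_C]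
        ring
      have e2 : expand F n Q' * (X ^ n * B k) = expand F n Q * B k := by
        rw [hQ', map_mul, expand_X]
        ring
      have e3 : expand F n Q = expand F n (q k) +
          ∑ i ∈ (Finset.range n).erase k, expand F n (C (r i / r k) * q i) := by
        have : Q = ∑ i ∈ Finset.range n, C (r i / r k) * q i := rfl
        rw [this, ← Finset.add_sum_erase _ _ hk', map_add, map_sum, div_self hr, C_1, one_mul]
      rw [e1, e2, e3, Finset.sum_sub_distrib, hPq, ← Finset.add_sum_erase _ _ hk',
        ← Finset.sum_mul]
      ring

/-- The series are interleaved in increasing and the polynomials in decreasing order. At index `n (t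
+ 1) - 1` of the product, component `k` therefore meets only the series `G k`, and the single
residue is a coefficient of the combination. -/
theorem residue_eq_coeff {σ : ℕ} {G : ℕ → PowerSeries F}
    (hΨ : ∀ k < n, ∀ m < σ, Ψ (n * m + k) = PowerSeries.coeff m (G k)) {t : ℕ} (ht : t < σ)
    (q : ℕ → F[X]) :
    residue n Ψ t (∑ k ∈ Finset.range n, expand F n (q k) * X ^ (n - 1 - k)) =
      PowerSeries.coeff t (∑ k ∈ Finset.range n, (q k : PowerSeries F) * G k) := by
  rw [residue_sum, map_sum]
  refine Finset.sum_congr rfl fun k hk => ?_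
  rw [Finset.mem_range] at hk
  rw [residue_expand_mul, PowerSeries.coeff_mul, Finset.Nat.sum_antidiagonal_eq_sum_range_succ_mk]
  refine Finset.sum_congr rfl fun m hm => ?_
  rw [Finset.mem_range] at hm
  have e : n * (t - m + 1) - 1 - (n - 1 - k) = n * (t - m) + k := by
    rw [mul_add, mul_one]
    omega
  have hlt : n - 1 - k < n * (t - m + 1) := by
    rw [mul_add, mul_one]
    omega
  rw [Polynomial.coeff_coe, residue, Finset.sum_eq_single (n - 1 - k)]
  · rw [coeff_X_pow_self, one_mul, e, hΨ k hk (t - m) (by omega)]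
  · intro i _ hi
    rw [coeff_X_pow, if_neg hi, zero_mul]
  · intro h
    exact absurd (Finset.mem_range.2 hlt) h

/-- The `k`-th component of an interleaved vector of `n` polynomials. -/
noncomputable def component (n : ℕ) (b : F[X]) (k : ℕ) : F[X] :=
  ∑ m ∈ Finset.range (b.natDegree + 1), monomial m (b.coeff (n * m + (n - 1 - k)))

theorem coeff_component (hn : 0 < n) (b : F[X]) (k m : ℕ) :
    (component n b k).coeff m = b.coeff (n * m + (n - 1 - k)) := by
  simp only [component, finsetSum_coeff, coeff_monomial, Finset.sum_ite_eq', Finset.mem_range]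
  split_ifs with h
  · rfl
  · rw [coeff_eq_zero_of_natDegree_lt]
    have := Nat.le_mul_of_pos_left m hn
    omega

theorem sum_expand_component (hn : 0 < n) (b : F[X]) :
    ∑ k ∈ Finset.range n, expand F n (component n b k) * X ^ (n - 1 - k) = b := by
  ext j
  have hj := Nat.mod_lt j hn
  have hdj := Nat.div_add_mod j n
  have hterm : ∀ k < n, (expand F n (component n b k) * X ^ (n - 1 - k)).coeff j =
      if k = n - 1 - j % n then b.coeff j else 0 := fun k hk => by
    rw [coeff_expand_mul_X_pow (by omega), coeff_component hn]
    by_cases h : n - 1 - k = j % n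
    · rw [if_pos h, if_pos (by omega), h, hdj]
    · rw [if_neg h, if_neg (by omega)]
  rw [finsetSum_coeff, Finset.sum_congr rfl fun k hk => hterm k (Finset.mem_range.1 hk),
    Finset.sum_ite_eq', if_pos (Finset.mem_range.2 (by omega))]

theorem IsReducedBasis.dvd {σ : ℕ} {B : ℕ → F[X]} {δ : ℕ → ℕ} (h : IsReducedBasis n Ψ σ B δ)
    {G : ℕ → PowerSeries F} (hΨ : ∀ k < n, ∀ m < σ, Ψ (n * m + k) = PowerSeries.coeff m (G k))
    {i : ℕ} (hi : i < n) :
    PowerSeries.X ^ σ ∣ ∑ k ∈ Finset.range n, (component n (B i) k : PowerSeries F) * G k := by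
  have hn : 0 < n := by omega
  refine PowerSeries.X_pow_dvd_iff.2 fun t ht => ?_
  rw [← residue_eq_coeff hΨ ht, sum_expand_component hn]
  exact h.residue_eq_zero i hi t ht

theorem IsReducedBasis.natDegree_component_le {σ : ℕ} {B : ℕ → F[X]} {δ : ℕ → ℕ}
    (h : IsReducedBasis n Ψ σ B δ) {i : ℕ} (hi : i < n) (k : ℕ) :
    (component n (B i) k).natDegree ≤ δ i := by
  have hn : 0 < n := by omega
  rw [natDegree_le_iff_coeff_eq_zero]
  intro m hm
  rw [coeff_component hn]
  refine coeff_eq_zero_of_natDegree_lt ((h.natDegree_lt i hi).trans_le ?_)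
  exact (Nat.mul_le_mul_left _ hm).trans (Nat.le_add_right _ _)

theorem exists_component_ne_zero (hn : 0 < n) {b : F[X]} (hb : b ≠ 0) :
    ∃ k < n, component n b k ≠ 0 := by
  by_contra hcon
  push Not at hcon
  apply hb
  rw [← sum_expand_component hn b]
  exact Finset.sum_eq_zero fun k hk => by rw [hcon k (Finset.mem_range.1 hk), map_zero, zero_mul]

/-- An exact relation lies in the module. If every nonzero row had degree bound above `H`, the
predictable degree property would make all its coordinates at these rows zero. -/
theorem IsReducedBasis.exists_small {σ : ℕ} {B : ℕ → F[X]} {δ : ℕ → ℕ}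
    (h : IsReducedBasis n Ψ σ B δ) (hn : 0 < n) {G : ℕ → PowerSeries F}
    (hΨ : ∀ k < n, ∀ m < σ, Ψ (n * m + k) = PowerSeries.coeff m (G k)) {H : ℕ} {c : ℕ → F[X]}
    (hc0 : ∃ k < n, c k ≠ 0) (hc : ∀ k < n, (c k).natDegree ≤ H)
    (hcG : ∑ k ∈ Finset.range n, (c k : PowerSeries F) * G k = 0) :
    ∃ i < n, B i ≠ 0 ∧ δ i ≤ H := by
  set P := ∑ k ∈ Finset.range n, expand F n (c k) * X ^ (n - 1 - k) with hP
  have hPc : ∀ k < n, ∀ m, P.coeff (n * m + (n - 1 - k)) = (c k).coeff m := fun k hk m => by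
    rw [hP, finsetSum_coeff, Finset.sum_eq_single k]
    · rw [coeff_expand_mul_X_pow (by omega), Nat.mul_add_mod, Nat.mod_eq_of_lt (by omega),
        if_pos rfl, Nat.mul_add_div hn, Nat.div_eq_of_lt (by omega), add_zero]
    · intro l hl hlk
      rw [Finset.mem_range] at hl
      rw [coeff_expand_mul_X_pow (by omega), Nat.mul_add_mod, Nat.mod_eq_of_lt (by omega),
        if_neg (by omega)]
    · intro hk'
      exact absurd (Finset.mem_range.2 hk) hk'
  have hP0 : P ≠ 0 := by
    obtain ⟨k, hk, hck⟩ := hc0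
    intro h0
    apply hck
    ext m
    rw [← hPc k hk, h0, coeff_zero, coeff_zero]
  have hPdeg : P.natDegree < n * (H + 1) := by
    have : P.natDegree ≤ n * (H + 1) - 1 := natDegree_sum_le_of_forall_le _ _ fun k hk => by
      rw [Finset.mem_range] at hk
      refine natDegree_mul_le.trans ?_
      rw [natDegree_expand, natDegree_X_pow, mul_add, mul_one]
      have := Nat.mul_le_mul_right n (hc k hk)
      rw [mul_comm H n] at this
      omega
    have : 0 < n * (H + 1) := by positivity
    omega
  obtain ⟨q, hq, hPq⟩ := h.exists_coordinates P H hPdeg fun t ht => by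
    rw [hP, residue_eq_coeff hΨ ht, hcG, map_zero]
  by_contra hcon
  push Not at hcon
  apply hP0
  rw [hPq]
  refine Finset.sum_eq_zero fun i hi => ?_
  rw [Finset.mem_range] at hi
  by_cases hqi : q i = 0
  · rw [hqi, map_zero, zero_mul]
  by_cases hBi : B i = 0
  · rw [hBi, mul_zero]
  have h1 := hcon i hi hBi
  have h2 := hq i hi hqi
  omega

end

end MahlerMethod

namespace FieldRAM

variable {p : ℕ} [Fact p.Prime]

/-! ## The first program: a Mahler equation of minimal order -/

/-- The powers of `p` up to the exponent `d`. -/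
def powTable : Prog :=
  .seq (.setNat 11 0 1)
    (forUp 20 (.var 2)
      (.seq (mulInto 21 22 (.var 0) (.load 11 (.var 20)))
        (.setNat 11 (.var 20 + 1) (.var 21))))

theorem runs_powTable {s : State p} {d : ℕ} (h0 : s.nat 0 0 = p) (h2 : s.nat 2 0 = d) :
    Runs powTable s (d * (p * 20 + 40) + 20) fun s' => ∀ k ≤ d, s'.nat 11 k = p ^ k := by
  refine (Runs.seq (R₁ := fun s' => s'.nat 11 0 = 1) (T₁ := 3) (Runs.setNat (by simp) (by simp))
    fun s₁ k₁ r₁ => ?_).mono (T := 3 + (d * (p * 19 + 19 + 2 + 9) + 2 + 6)) (fun s' _ h => h) (by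
      have : d * (p * 19 + 19 + 2 + 9) ≤ d * (p * 20 + 40) := Nat.mul_le_mul_left _ (by omega)
      omega)
  refine Runs.forUp (T := p * 19 + 19) (N := d) (fun i s' => ∀ k ≤ i, s'.nat 11 k = p ^ k)
    (by simp [k₁.nat 2 rfl, h2]) rfl rfl (by simpa using r₁) ?_
  intro i hi s₂ k₂ hv hI
  refine (Runs.seq (Runs.mulInto (N := p) (M := p ^ i) (by simp [k₂.nat 0 rfl, k₁.nat 0 rfl, h0])
    (by simp [hv, hI]) (by simp) rfl rfl) fun s₃ k₃ r₃ => Runs.setNat ?_ (le_refl _)).mono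
      (fun _ _ h => h) (by simp)
  intro k hk
  by_cases h : k = i + 1
  · subst h
    simp [k₃.nat 20 rfl, hv, r₃, pow_succ']
  · simp [k₃.nat 20 rfl, k₃.nat 11 rfl, hv, h, hI k (by omega)]

/-- The degree bound `H = d * p ^ d * h` and the precision `(d + 2) * H + 1`. -/
def boundsProg : Prog :=
  .seq (mulInto 12 22 (.load 11 (.var 2)) (.var 1))
    (.seq (mulInto 23 22 (.var 2) (.var 12))
      (.seq (.setNat 12 0 (.var 23))
        (.seq (mulInto 23 22 (.var 2 + 2) (.var 12))
          (.seq (.setNat 13 0 (.var 23 + 1)) (.setNat 5 0 (.var 12 + 1))))))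

theorem runs_boundsProg {s : State p} {d h Q : ℕ} (h1 : s.nat 1 0 = h) (h2 : s.nat 2 0 = d)
    (hQ : s.nat 11 d = Q) :
    Runs boundsProg s (Q * 20 + d * 40 + 120) fun s' => s'.nat 12 0 = d * (Q * h) ∧
      s'.nat 13 0 = (d + 2) * (d * (Q * h)) + 1 ∧ s'.nat 5 0 = d * (Q * h) + 1 := by
  apply Runs.le
  · apply Runs.seq
    · exact Runs.mulInto (N := Q) (M := h) (by simp [h2, hQ]) (by simp [h1]) (by simp) rfl rfl
    intro s₁ k₁ r₁
    apply Runs.seq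
    · exact Runs.mulInto (N := d) (M := Q * h) (by simp [k₁.nat 2 rfl, h2]) (by simp [r₁])
        (by simp) rfl rfl
    intro s₂ k₂ r₂
    apply Runs.seq (R₁ := fun s' => s'.nat 12 0 = d * (Q * h))
    · exact Runs.setNat (by simp [r₂]) le_rfl
    intro s₃ k₃ r₃
    apply Runs.seq
    · exact Runs.mulInto (N := d + 2) (M := d * (Q * h))
        (by simp [k₃.nat 2 rfl, k₂.nat 2 rfl, k₁.nat 2 rfl, h2]) (by simp [r₃]) (by simp) rfl rfl
    intro s₄ k₄ r₄
    apply Runs.seq (R₁ := fun s' => s'.nat 13 0 = (d + 2) * (d * (Q * h)) + 1)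
    · exact Runs.setNat (by simp [r₄]) le_rfl
    intro s₅ k₅ r₅
    refine Runs.setNat ?_ le_rfl
    simp [k₅.nat 12 rfl, k₄.nat 12 rfl, r₃, r₅]
  · simp; ring_nf; omega

/-- The powers `f, …, f ^ d` of the root, up to the precision; row `j` holds the `j`-th power. -/
def seriesProg : Prog :=
  .seq (.setFld 9 0 0 1)
    (forUp 20 (.var 13)
      (.seq
        (forUp 21 (.var 2 - 1)
          (.seq
            (sumInto 10 22 (.var 20) (.natEq 0 0)
              (.load 9 1 (.var 22) * .load 9 (.var 21 + 1) (.var 20 - .var 22)))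
            (.setFld 9 (.var 21 + 2) (.var 20) (.load 10 0 0))))
        (.seq (.setFld 11 0 0 0)
          (.seq
            (forUp 21 (.var 2 + 1)
              (.seq
                (sumInto 10 22 (.var 1 + 1) (.neg (.natLt (.var 20) (.var 22)))
                  (.load 0 (.var 22) (.var 21) * .load 9 (.var 21) (.var 20 - .var 22)))
                (.setFld 11 0 0 (.load 11 0 0 + .load 10 0 0))))
            (.setFld 9 1 (.var 20) ((0 - .load 11 0 0) / .load 0 0 1))))))

open Polynomial in
theorem coeff_eval₂_coe {F : Type*} [Field F] {E : F[X][X]} {d h : ℕ} (hd : E.natDegree ≤ d)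
    (hh : ∀ j, (E.coeff j).natDegree ≤ h) (f : PowerSeries F) (n : ℕ) :
    PowerSeries.coeff n (E.eval₂ coeToPowerSeries.ringHom f) =
      ∑ j ∈ Finset.range (d + 1), ∑ i ∈ Finset.range (h + 1),
        if i ≤ n then (E.coeff j).coeff i * PowerSeries.coeff (n - i) (f ^ j) else 0 := by
  rw [eval₂_eq_sum_range' _ (Nat.lt_succ_of_le hd), map_sum]
  refine Finset.sum_congr rfl fun j _ => ?_
  rw [PowerSeries.coeff_mul, Finset.Nat.sum_antidiagonal_eq_sum_range_succ_mk]
  simp only [coeToPowerSeries.ringHom_apply, coeff_coe]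
  rw [← Finset.sum_filter]
  refine (Finset.sum_subset_zero_on_sdiff (fun i hi => ?_) (fun i hi => ?_) fun _ _ => rfl).symm
  · simp only [Finset.mem_filter, Finset.mem_range] at hi ⊢
    omega
  · simp only [Finset.mem_sdiff, Finset.mem_filter, Finset.mem_range] at hi
    rw [coeff_eq_zero_of_natDegree_lt (lt_of_le_of_lt (hh j) (by omega)), zero_mul]

theorem coeff_mul_of_constantCoeff_eq_zero {F : Type*} [Field F] (f g : PowerSeries F)
    (hg : PowerSeries.constantCoeff g = 0) (n : ℕ) :
    PowerSeries.coeff n (f * g) =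
      ∑ i ∈ Finset.range n, PowerSeries.coeff i f * PowerSeries.coeff (n - i) g := by
  rw [PowerSeries.coeff_mul, Finset.Nat.sum_antidiagonal_eq_sum_range_succ_mk,
    Finset.sum_range_succ, Nat.sub_self, PowerSeries.coeff_zero_eq_constantCoeff_apply, hg,
    mul_zero, add_zero]

/-- Because `f(0) = 0`, coefficient `n` of `f^j` for `j ≥ 2` involves only earlier coefficients of
`f`. In coefficient `n` of `E(x, f) = 0` the unknown `f_n` then occurs only in `E_y(0,0) f_n`, and
one division determines it. -/
theorem runs_seriesProg {s : State p} {d h σ : ℕ} (h1 : s.nat 1 0 = h) (h2 : s.nat 2 0 = d)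
    (hσ : s.nat 13 0 = σ) (hd2 : 2 ≤ d) (h9 : ∀ j m, s.fld 9 j m = 0)
    {E : Polynomial (Polynomial (ZMod p))} (h0 : ∀ i j, s.fld 0 i j = (E.coeff j).coeff i)
    (hd : E.natDegree ≤ d) (hh : ∀ j, (E.coeff j).natDegree ≤ h)
    (h01 : (E.coeff 1).coeff 0 ≠ 0) {f : PowerSeries (ZMod p)}
    (hf0 : PowerSeries.constantCoeff f = 0)
    (hf : E.eval₂ Polynomial.coeToPowerSeries.ringHom f = 0) :
    Runs seriesProg s (σ * (d * (σ * 50 + 100) + (d + 1) * (h * 60 + 200) + 100) + 50)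
      fun s' => ∀ m < σ, s'.fld 9 1 m = PowerSeries.coeff m f := by
  apply Runs.le
  · apply Runs.seq (R₁ := fun s' => (∀ j, 1 ≤ j → ∀ m, s'.fld 9 j m = 0) ∧
      ∀ m, s'.fld 9 0 m = PowerSeries.coeff m (1 : PowerSeries (ZMod p)))
    · refine Runs.setFld ⟨fun j hj m => ?_, fun m => ?_⟩ le_rfl
      · simp [h9, show j ≠ 0 by omega]
      · simp [h9, PowerSeries.coeff_one]
    intro s₁ k₁ r₁
    refine Runs.mono (Runs.forUp (N := σ) (T := d * (σ * 50 + 90) + (d + 1) * (h * 60 + 150) + 60)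
      (fun n s' => (∀ j ≤ d, 1 ≤ j → ∀ m < n, s'.fld 9 j m =
        PowerSeries.coeff m (f ^ j)) ∧ (∀ m, n ≤ m → s'.fld 9 1 m = 0) ∧
        ∀ m, s'.fld 9 0 m = PowerSeries.coeff m (1 : PowerSeries (ZMod p)))
      (by simp [k₁.nat 13 rfl, hσ]) rfl rfl
      ⟨fun _ _ _ m hm => absurd hm (Nat.not_lt_zero m), fun m _ => r₁.1 1 le_rfl m, r₁.2⟩ ?_)
      (fun s' _ hs' m hm => by simpa using hs'.1 1 (by omega) le_rfl m hm) le_rfl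
    intro n hn s₂ k₂ hv I₂
    have e1 : s₂.nat 1 0 = h := by simp [k₂.nat 1 rfl, k₁.nat 1 rfl, h1]
    have e2 : s₂.nat 2 0 = d := by simp [k₂.nat 2 rfl, k₁.nat 2 rfl, h2]
    have e0 : ∀ i j, s₂.fld 0 i j = (E.coeff j).coeff i := by
      simp [k₂.fld 0 rfl, k₁.fld 0 rfl, h0]
    apply Runs.le
    · apply Runs.seq
      · refine Runs.forUp (N := d - 1) (T := n * 38 + 60) (fun i s' =>
          ((∀ j ≤ d, 1 ≤ j → ∀ m < n, s'.fld 9 j m =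
            PowerSeries.coeff m (f ^ j)) ∧ (∀ m, n ≤ m → s'.fld 9 1 m = 0) ∧
            ∀ m, s'.fld 9 0 m = PowerSeries.coeff m (1 : PowerSeries (ZMod p))) ∧
            ∀ j < i + 2, 2 ≤ j → s'.fld 9 j n = PowerSeries.coeff n (f ^ j))
          (by simp [e2]) rfl rfl ⟨I₂, fun j _ _ => by omega⟩ ?_
        intro j hj s₃ k₃ hv₃ I₃
        apply Runs.le
        · apply Runs.seq
          · refine Runs.sumInto (N := n) (fun i => PowerSeries.coeff i f *
              PowerSeries.coeff (n - i) (f ^ (j + 1))) (by simp [k₃.nat 20 rfl, hv]) rfl ?_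
            intro i hi s₄ k₄ hv₄
            have h3 : s₃.fld 9 1 i = PowerSeries.coeff i f := by
              simpa using I₃.1.1 1 (by omega) le_rfl i hi
            simp only [Test.holds_natEq, if_true, FldExpr.eval_mul, FldExpr.eval_load,
              NatExpr.eval_var, NatExpr.eval_one, NatExpr.eval_add, NatExpr.eval_sub, hv₄,
              k₄.fld 9 rfl, k₄.nat 20 rfl, k₄.nat 21 rfl, k₃.nat 20 rfl, hv, hv₃, h3]
            -- For `i = 0` and `j = 0` the second factor is the still unknown `f_n`, but it is
            -- multiplied by `f(0) = 0`.
            rcases Nat.eq_zero_or_pos i with rfl | hi0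
            · simp [hf0]
            · rw [I₃.1.1 (j + 1) (by omega) (by omega) (n - i) (by omega)]
          intro s₄ k₄ r₄
          have h20 : s₄.nat 20 0 = n := by simp [k₄.nat 20 rfl, k₃.nat 20 rfl, hv]
          have h21 : s₄.nat 21 0 = j := by simp [k₄.nat 21 rfl, hv₃]
          refine Runs.setFld ?_ le_rfl
          rw [← coeff_mul_of_constantCoeff_eq_zero _ _ (by simp [hf0]), ← pow_succ'] at r₄
          simp only [FldExpr.eval_load, NatExpr.eval_add, NatExpr.eval_var, NatExpr.eval_two,
 NatExpr.eval_zero, State.setNat_fld, State.setFld_fld, h20, h21, r₄,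
            k₄.fld 9 rfl]
          refine ⟨⟨fun i hi hi1 m hm => ?_, fun m hm => ?_, fun m => ?_⟩, fun i hi hi2 => ?_⟩
          · rw [if_neg (by omega)]
            exact I₃.1.1 i hi hi1 m hm
          · rw [if_neg (by omega)]
            exact I₃.1.2.1 m hm
          · rw [if_neg (by omega)]
            exact I₃.1.2.2 m
          · by_cases hij : i = j + 2
            · rw [if_pos (by simp [hij]), hij]
            · rw [if_neg (by omega)]
              exact I₃.2 i (by omega) hi2
        · simp
      intro s₃ k₃ r₃
      have hd1 : d - 1 + 2 = d + 1 := by omega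
      rw [hd1] at r₃
      have h20 : s₃.nat 20 0 = n := by simp [k₃.nat 20 rfl, hv]
      -- The terms of coefficient `n` of `E(x, f)`, with zero in place of the not yet assigned
      -- `f_n`, which belongs to `j = 1`, `i = 0`.
      let a : ℕ → ℕ → ZMod p := fun j i => if i ≤ n then (E.coeff j).coeff i *
        (if j = 1 ∧ i = 0 then 0 else PowerSeries.coeff (n - i) (f ^ j)) else 0
      have hval : ∀ j ≤ d, ∀ i ≤ n, s₃.fld 9 j (n - i) =
          if j = 1 ∧ i = 0 then 0 else PowerSeries.coeff (n - i) (f ^ j) := by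
        intro j hj i hi
        split_ifs with hji
        · rw [hji.1, hji.2]
          exact r₃.1.2.1 n le_rfl
        · rcases Nat.eq_zero_or_pos j with rfl | hj0
          · simpa using r₃.1.2.2 (n - i)
          rcases Nat.eq_zero_or_pos i with rfl | hi0
          · exact r₃.2 j (by omega) (by omega)
          · exact r₃.1.1 j hj hj0 (n - i) (by omega)
      apply Runs.seq (R₁ := fun s' => s'.fld 11 0 0 = 0)
      · exact Runs.setFld (by simp) le_rfl
      intro s₄ k₄ r₄
      apply Runs.seq
      · refine Runs.forUp (N := d + 1) (T := (h + 1) * 42 + 60) (fun j s' =>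
          s'.fld 11 0 0 = ∑ j ∈ Finset.range j, ∑ i ∈ Finset.range (h + 1), a j i)
          (by simp [k₄.nat 2 rfl, k₃.nat 2 rfl, e2]) rfl rfl (by simp [r₄]) ?_
        intro j hj s₅ k₅ hv₅ I₅
        apply Runs.le
        · apply Runs.seq
          · refine Runs.sumInto (N := h + 1) (fun i => a j i)
              (by simp [k₅.nat 1 rfl, k₄.nat 1 rfl, k₃.nat 1 rfl, e1]) rfl ?_
            intro i hi s₆ k₆ hv₆
            simp only [Test.holds_neg, Test.holds_natLt, not_lt, FldExpr.eval_mul,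
              FldExpr.eval_load, NatExpr.eval_var, NatExpr.eval_sub, hv₆, k₆.nat 20 rfl,
              k₆.nat 21 rfl, k₆.fld 0 rfl, k₆.fld 9 rfl, k₅.nat 20 rfl, k₅.fld 0 rfl, k₅.fld 9 rfl,
              k₄.nat 20 rfl, k₄.fld 0 rfl, k₄.fld 9 rfl, h20, hv₅, k₃.fld 0 rfl, e0, a]
            by_cases hin : i ≤ n
            · rw [if_pos hin, if_pos hin, hval j (Nat.lt_succ_iff.1 hj) i hin]
            · rw [if_neg hin, if_neg hin]
          intro s₆ k₆ r₆
          refine Runs.setFld ?_ le_rfl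
          simp [k₆.fld 11 rfl, I₅, r₆, Finset.sum_range_succ _ j]
        · simp
      intro s₅ k₅ r₅
      have hsum : s₅.fld 11 0 0 = - ((E.coeff 1).coeff 0 * PowerSeries.coeff n f) := by
        have h3 := coeff_eval₂_coe hd hh f n
        rw [hf, map_zero] at h3
        have h4 : ∀ j i, a j i = (if i ≤ n then (E.coeff j).coeff i *
            PowerSeries.coeff (n - i) (f ^ j) else 0) -
            (if j = 1 then if i = 0 then (E.coeff 1).coeff 0 * PowerSeries.coeff n f else 0
              else 0) := by
          intro j i
          by_cases hj : j = 1
          · by_cases hi : i = 0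
            · simp [a, hj, hi]
            · simp [a, hj, hi]
          · simp [a, hj]
        simp only [r₅, h4, Finset.sum_sub_distrib, ← h3]
        rw [Finset.sum_comm, Finset.sum_eq_single 0]
        · rw [Finset.sum_eq_single 1]
          · simp
          · intro b _ hb
            simp [hb]
          · intro hb
            exact absurd (Finset.mem_range.2 (by omega)) hb
        · intro i _ hi
          simp [hi]
        · simp
      have h20' : s₅.nat 20 0 = n := by simp [k₅.nat 20 rfl, k₄.nat 20 rfl, h20]
      refine Runs.setFld ?_ le_rfl
      simp only [FldExpr.eval_div, FldExpr.eval_sub, FldExpr.eval_zero, FldExpr.eval_load,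
        NatExpr.eval_var, NatExpr.eval_one, NatExpr.eval_zero, State.setNat_fld, State.setFld_fld,
        h20', hsum, k₅.fld 0 rfl, k₅.fld 9 rfl, k₄.fld 0 rfl, k₄.fld 9 rfl, k₃.fld 0 rfl, e0]
      refine ⟨fun j hj hj1 m hm => ?_, fun m hm => ?_, fun m => ?_⟩
      · by_cases hjm : j = 1 ∧ m = n
        · rw [if_pos (by simp [hjm.1, hjm.2]), hjm.1, hjm.2, pow_one]
          field_simp
          simp
        · rw [if_neg (by tauto)]
          rcases Nat.lt_or_ge m n with hmn | hmn
          · exact r₃.1.1 j hj hj1 m hmn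
          · obtain rfl : m = n := by omega
            exact r₃.2 j (by omega) (by omega)
      · rw [if_neg (by omega)]
        exact r₃.1.2.1 m (by omega)
      · rw [if_neg (by omega)]
        exact r₃.1.2.2 m
    · have h3 : (d - 1) * (n * 38 + 60 + 13) ≤ d * (n * 38 + 73) :=
        Nat.mul_le_mul (by omega) (by omega)
      have h4 : d * (n * 38 + 73) ≤ d * (σ * 50 + 73) := Nat.mul_le_mul_left _ (by omega)
      simp
      ring_nf at *
      omega
  · simp; ring_nf; omega

/-! ## Filling arrays -/

/-- For all `v < n`, execute `P` and assign `e` to the entry `(i, v)` of the array `a`. -/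
def fillRow (a v : ℕ) (i n : NatExpr) (P : Prog) (e : FldExpr) : Prog :=
  forUp v n (.seq P (.setFld a i (.var v) e))

/-- The computation of entry `m` may read the entries of the row before `m`, as recursive formulas
for power series require. -/
theorem Runs.fillRow {a v : ℕ} {i n : NatExpr} {P : Prog} {e : FldExpr} {s : State p}
    {N T i₀ : ℕ} (val : ℕ → ZMod p) (hN : n.eval s = N) (hi : i.eval s = i₀)
    (hn : n.stable (fillRow a v i n P e) = true) (his : i.stable (fillRow a v i n P e) = true)
    (hv : P.writesNat v = false) (ha : P.writesFld a = false)
    (hP : ∀ m < N, ∀ s', Keeps (FieldRAM.fillRow a v i n P e) s s' → s'.nat v 0 = m →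
      (∀ r j, s'.fld a r j = if r = i₀ ∧ j < m then val j else s.fld a r j) →
      Runs P s' T fun s'' => e.eval s'' = val m) :
    Runs (FieldRAM.fillRow a v i n P e) s
      (N * (T + i.cost + e.cost + n.cost + 12) + n.cost + 6)
      fun s' => ∀ r j, s'.fld a r j = if r = i₀ ∧ j < N then val j else s.fld a r j := by
  refine Runs.le (Runs.forUp (N := N) (T := T + (i.cost + 2 + e.cost + 1))
    (fun m s' => ∀ r j, s'.fld a r j = if r = i₀ ∧ j < m then val j else s.fld a r j)
    hN hn (by simpa [Prog.writesNat] using hv) (by simp) ?_)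
    (Nat.add_le_add_right (Nat.add_le_add_right (Nat.mul_le_mul_left _ (by omega)) _) _)
  intro m hm s' k hvm hI
  refine Runs.seq (hP m hm s' k hvm hI) fun s'' k' r' => Runs.setFld ?_ (by simp)
  intro r j
  have hi' : i.eval s'' = i₀ := by
    rw [← hi]
    have hk : Keeps (FieldRAM.fillRow a v i n P e) s' s'' := k'.mono
      (fun b hb => by
        simp only [FieldRAM.fillRow, FieldRAM.forUp, Prog.writesNat, Bool.or_eq_false_iff] at hb
        exact hb.2.1.1)
      (fun b hb => by
        simp only [FieldRAM.fillRow, FieldRAM.forUp, Prog.writesFld, Bool.or_eq_false_iff] at hb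
        exact hb.2.1.1)
    exact NatExpr.eval_eq_of_stable (k.trans hk) i his
  simp only [State.setNat_fld, State.setFld_fld, hi', NatExpr.eval_var, k'.nat v hv, hvm, r',
    k'.fld a ha, hI, true_and]
  by_cases h1 : r = i₀ ∧ j = m
  · rw [if_pos h1, if_pos ⟨h1.1, by omega⟩, h1.2]
  · rw [if_neg h1]
    refine if_congr ?_ rfl rfl
    constructor
    · rintro ⟨h, h'⟩
      exact ⟨h, by omega⟩
    · rintro ⟨h, h'⟩
      exact ⟨h, by by_contra hj; exact h1 ⟨h, by omega⟩⟩

/-- For all `u < n` and `v < n'`, execute `P` and assign `e` to the entry `(u, v)` of `a`. -/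
def fillTable (a u v : ℕ) (n n' : NatExpr) (P : Prog) (e : FldExpr) : Prog :=
  forUp u n (fillRow a v (.var u) n' P e)

theorem Runs.fillTable {a u v : ℕ} {n n' : NatExpr} {P : Prog} {e : FldExpr} {s : State p}
    {N N' T : ℕ} (val : ℕ → ℕ → ZMod p) (hN : n.eval s = N) (hN' : n'.eval s = N')
    (hn : n.stable (fillTable a u v n n' P e) = true)
    (hn' : n'.stable (fillTable a u v n n' P e) = true)
    (hu : P.writesNat u = false) (hv : P.writesNat v = false) (huv : u ≠ v)
    (ha : P.writesFld a = false)
    (hP : ∀ i < N, ∀ m < N', ∀ s', Keeps (FieldRAM.fillTable a u v n n' P e) s s' →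
      s'.nat u 0 = i → s'.nat v 0 = m →
      (∀ r j, s'.fld a r j =
        if r < i ∧ j < N' ∨ r = i ∧ j < m then val r j else s.fld a r j) →
      Runs P s' T fun s'' => e.eval s'' = val i m) :
    Runs (FieldRAM.fillTable a u v n n' P e) s
      (N * (N' * (T + e.cost + n'.cost + 14) + n.cost + n'.cost + 15) + n.cost + 6)
      fun s' => ∀ r j, s'.fld a r j = if r < N ∧ j < N' then val r j else s.fld a r j := by
  have hsub : ∀ b, (FieldRAM.fillTable a u v n n' P e).writesNat b = false →
      (FieldRAM.fillRow a v (.var u) n' P e).writesNat b = false := fun b hb => by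
    simp only [FieldRAM.fillTable, FieldRAM.forUp, Prog.writesNat, Bool.or_eq_false_iff] at hb
    exact hb.2.1
  have hsub' : ∀ b, (FieldRAM.fillTable a u v n n' P e).writesFld b = false →
      (FieldRAM.fillRow a v (.var u) n' P e).writesFld b = false := fun b hb => by
    simp only [FieldRAM.fillTable, FieldRAM.forUp, Prog.writesFld, Bool.or_eq_false_iff] at hb
    exact hb.2.1
  have huw : (FieldRAM.fillRow a v (.var u) n' P e).writesNat u = false := by
    simp [FieldRAM.fillRow, FieldRAM.forUp, Prog.writesNat, hu, huv]
  refine Runs.le (Runs.forUp (N := N) (T := N' * (T + 2 + e.cost + n'.cost + 12) + n'.cost + 6)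
    (fun i s' => ∀ r j, s'.fld a r j = if r < i ∧ j < N' then val r j else s.fld a r j)
    hN hn huw (by simp) ?_)
    (Nat.add_le_add_right (Nat.add_le_add_right (Nat.mul_le_mul_left _ (by
      rw [show T + 2 + e.cost + n'.cost + 12 = T + e.cost + n'.cost + 14 by ring]
      omega)) _) _)
  intro i hi s₁ k₁ hui hI
  refine (Runs.fillRow (i₀ := i) (N := N') (val i)
    (by rw [← hN']; exact NatExpr.eval_eq_of_stable k₁ n' hn') (by simpa using hui)
    (NatExpr.stable_mono hsub n' hn') (by
      change (!(FieldRAM.fillRow a v (.var u) n' P e).writesNat u && true) = true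
      simp [huw]) hv ha ?_).mono ?_ le_rfl
  · intro m hm s₂ k₂ hvm hI₂
    refine hP i hi m hm s₂ (k₁.trans (k₂.mono hsub hsub')) (by rw [k₂.nat u huw, hui]) hvm ?_
    intro r j
    rw [hI₂, hI]
    by_cases h1 : r = i ∧ j < m
    · rw [if_pos h1, if_pos (Or.inr h1), h1.1]
    · rw [if_neg h1]
      exact if_congr (by tauto) rfl rfl
  · intro s₂ k₂ h₂ r j
    simp only [State.setNat_fld, h₂, hI]
    by_cases h1 : r = i ∧ j < N'
    · rw [if_pos h1, if_pos ⟨by omega, h1.2⟩, h1.1]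
    · rw [if_neg h1]
      exact if_congr ⟨fun h => ⟨by omega, h.2⟩, fun h => ⟨by
        by_contra hr
        exact h1 ⟨by omega, h.2⟩, h.2⟩⟩ rfl rfl

/-! ### Interleaved series and a single step of the basis reduction -/

theorem coeff_pow_prime_pow (k m : ℕ) (f : PowerSeries (ZMod p)) :
    PowerSeries.coeff m (f ^ p ^ k) =
      if p ^ k ∣ m then PowerSeries.coeff (m / p ^ k) f else 0 := by
  rw [← MahlerMethod.expand_pow_eq_pow k f (pow_ne_zero _ (Fact.out : p.Prime).ne_zero),
    PowerSeries.coeff_expand]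

/-- The interleaved coefficients of `f ^ (p ^ k)`, for `k` up to the order. -/
def interleaveProg : Prog :=
  .seq (.setNat 16 0 (.var 14 + 1))
    (.seq (mulInto 17 22 (.var 16) (.var 13 + 1))
      (.seq (fillRow 12 20 0 (.var 17) .skip 0)
        (forUp 20 (.var 16)
          (.seq (mulInto 24 22 (.load 11 (.var 20)) (.var 16))
            (forUp 21 (.var 13)
              (.seq (mulInto 23 22 (.var 21) (.var 24))
                (.setFld 12 0 (.var 23 + .var 20) (.load 9 1 (.var 21)))))))))

theorem runs_interleaveProg {s : State p} {d K σ : ℕ} (h14 : s.nat 14 0 = K)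
    (h13 : s.nat 13 0 = σ) (hKd : K ≤ d) (h11 : ∀ k ≤ d, s.nat 11 k = p ^ k)
    (hσ : ∀ k ≤ d, p ^ k ≤ σ) {f : PowerSeries (ZMod p)}
    (h9 : ∀ m < σ, s.fld 9 1 m = PowerSeries.coeff m f) :
    Runs interleaveProg s ((K + 1) * ((σ + 1) * (σ * 40 + 200)) + 100) fun s' =>
      s'.nat 16 0 = K + 1 ∧ s'.nat 17 0 = (K + 1) * (σ + 1) ∧
      ∀ k < K + 1, ∀ m < σ, s'.fld 12 0 ((K + 1) * m + k) =
        PowerSeries.coeff m (f ^ p ^ k) := by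
  apply Runs.le
  · apply Runs.seq (R₁ := fun s' => s'.nat 16 0 = K + 1)
    · exact Runs.setNat (by simp [h14]) le_rfl
    intro s₁ k₁ r₁
    apply Runs.seq
    · exact Runs.mulInto (N := K + 1) (M := σ + 1) (by simp [r₁])
        (by simp [k₁.nat 13 rfl, h13]) (by simp) rfl rfl
    intro s₂ k₂ r₂
    apply Runs.seq
    · exact Runs.fillRow (N := (K + 1) * (σ + 1)) (i₀ := 0) (T := 1) (fun _ => 0) (by simp [r₂])
        (by simp) rfl rfl rfl rfl fun m _ s' _ _ _ => Runs.skip (by simp) le_rfl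
    intro s₃ k₃ r₃
    have e16 : s₃.nat 16 0 = K + 1 := by simp [k₃.nat 16 rfl, k₂.nat 16 rfl, r₁]
    have e17 : s₃.nat 17 0 = (K + 1) * (σ + 1) := by simp [k₃.nat 17 rfl, r₂]
    have e13 : s₃.nat 13 0 = σ := by simp [k₃.nat 13 rfl, k₂.nat 13 rfl, k₁.nat 13 rfl, h13]
    have e11 : ∀ k ≤ d, s₃.nat 11 k = p ^ k := fun k hk => by
      simp [k₃.nat 11 rfl, k₂.nat 11 rfl, k₁.nat 11 rfl, h11 k hk]
    have e9 : ∀ m < σ, s₃.fld 9 1 m = PowerSeries.coeff m f := fun m hm => by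
      simp [k₃.fld 9 rfl, k₂.fld 9 rfl, k₁.fld 9 rfl, h9 m hm]
    have hidx : ∀ k < K + 1, ∀ m < σ, (K + 1) * m + k < (K + 1) * (σ + 1) := fun k hk m hm => by
      have : (K + 1) * (m + 1) ≤ (K + 1) * (σ + 1) := Nat.mul_le_mul_left _ (by omega)
      rw [mul_add] at this
      omega
    refine Runs.mono (Runs.forUp (N := K + 1) (T := (σ + 1) * (σ * 19 + 60) + 50)
      (fun k₀ s' => ∀ k < K + 1, ∀ m < σ, s'.fld 12 0 ((K + 1) * m + k) =
        if k < k₀ then PowerSeries.coeff m (f ^ p ^ k) else 0) (by simp [e16]) rfl rfl ?_ ?_)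
      (fun s' k' h' => ⟨by simp [k'.nat 16 rfl, e16], by simp [k'.nat 17 rfl, e17], fun k hk m hm => by
        rw [h' k hk m hm, if_pos hk]⟩) le_rfl
    · intro k hk m hm
      simp [r₃, hidx k hk m hm]
    intro k₀ hk₀ s₄ k₄ hv₄ I₄
    have hpk := hσ k₀ (by omega)
    apply Runs.le
    · apply Runs.seq
      · exact Runs.mulInto (N := p ^ k₀) (M := K + 1) (by simp [k₄.nat 11 rfl, hv₄, e11 k₀ (by omega)])
          (by simp [k₄.nat 16 rfl, e16]) (by simp) rfl rfl
      intro s₅ k₅ r₅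
      -- The row was cleared, and only the exponents `p ^ k₀ * j` are written. Up to the next such
      -- exponent the zeros are already correct. Rounds with `p ^ k₀ * j ≥ σ` write outside the
      -- range of the invariant.
      refine Runs.mono (Runs.forUp (N := σ) (T := σ * 19 + 30)
        (fun j₀ s' => ∀ k < K + 1, ∀ m < σ, s'.fld 12 0 ((K + 1) * m + k) =
          if k < k₀ ∨ k = k₀ ∧ m < p ^ k₀ * j₀ then PowerSeries.coeff m (f ^ p ^ k) else 0)
        (by simp [k₅.nat 13 rfl, k₄.nat 13 rfl, e13]) rfl rfl ?_ ?_)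
        (fun s' k' h' => ?_) le_rfl
      · intro k hk m hm
        simp [k₅.fld 12 rfl, I₄ k hk m hm]
      · intro j hj s₆ k₆ hv₆ I₆
        apply Runs.le
        · apply Runs.seq
          · exact Runs.mulInto (N := j) (M := p ^ k₀ * (K + 1)) (by simp [hv₆])
              (by simp [k₆.nat 24 rfl, r₅]) (by simp) rfl rfl
          intro s₇ k₇ r₇
          refine Runs.setFld ?_ le_rfl
          intro k hk m hm
          have e20 : s₇.nat 20 0 = k₀ := by
            simp [k₇.nat 20 rfl, k₆.nat 20 rfl, k₅.nat 20 rfl, hv₄]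
          have e21 : s₇.nat 21 0 = j := by simp [k₇.nat 21 rfl, hv₆]
          have e9' : s₇.fld 9 1 j = PowerSeries.coeff j f := by
            simp [k₇.fld 9 rfl, k₆.fld 9 rfl, k₅.fld 9 rfl, k₄.fld 9 rfl, e9 j hj]
          simp only [State.setNat_fld, State.setFld_fld, NatExpr.eval_zero, NatExpr.eval_add,
            NatExpr.eval_var, FldExpr.eval_load, NatExpr.eval_one, r₇, e20, e21, e9', true_and,
            k₇.fld 12 rfl, I₆ k hk m hm]
          by_cases hkm : k = k₀ ∧ m = p ^ k₀ * j
          · obtain ⟨rfl, rfl⟩ := hkm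
            rw [if_pos (by ring), if_pos (Or.inr ⟨rfl, by
              have : 0 < p ^ k := pow_pos (Fact.out : p.Prime).pos _
              rw [mul_add]; omega⟩), coeff_pow_prime_pow, if_pos (Nat.dvd_mul_right _ _),
              Nat.mul_div_cancel_left _ (pow_pos (Fact.out : p.Prime).pos _)]
          · rw [if_neg]
            · by_cases hk' : k = k₀
              · subst hk'
                have hm' : m ≠ p ^ k * j := fun h => hkm ⟨rfl, h⟩
                by_cases hlt : m < p ^ k * j
                · rw [if_pos (Or.inr ⟨rfl, hlt⟩), if_pos (Or.inr ⟨rfl, by rw [mul_add]; omega⟩)]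
                · rw [if_neg (by omega)]
                  by_cases hlt' : m < p ^ k * (j + 1)
                  · rw [if_pos (Or.inr ⟨rfl, hlt'⟩), coeff_pow_prime_pow, if_neg]
                    rintro ⟨q, rfl⟩
                    have h1 : j < q := by
                      by_contra hq
                      rcases lt_or_eq_of_le (not_lt.1 hq) with hq | hq
                      · exact hlt (Nat.mul_lt_mul_of_pos_left hq (pow_pos (Fact.out : p.Prime).pos _))
                      · exact hm' (by rw [hq])
                    exact absurd (Nat.mul_le_mul_left (p ^ k) h1) (not_le.2 hlt')
                  · rw [if_neg (by omega)]
              · exact if_congr (by simp [hk']) rfl rfl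
            · intro heq
              apply hkm
              have h1 := congrArg (· % (K + 1)) heq
              have h2 := congrArg (· / (K + 1)) heq
              rw [show j * (p ^ k₀ * (K + 1)) + k₀ = (K + 1) * (p ^ k₀ * j) + k₀ by ring] at h1 h2
              simp only [Nat.mul_add_mod, Nat.mod_eq_of_lt hk, Nat.mod_eq_of_lt hk₀] at h1
              simp only [Nat.mul_add_div (Nat.succ_pos K), Nat.div_eq_of_lt hk,
                Nat.div_eq_of_lt hk₀, add_zero] at h2
              exact ⟨h1, h2⟩
        · simp; omega
      · intro k hk m hm
        have hm' : m < p ^ k₀ * σ :=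
          hm.trans_le (Nat.le_mul_of_pos_left _ (pow_pos (Fact.out : p.Prime).pos _))
        simp only [State.setNat_fld, h' k hk m hm]
        exact if_congr (by simp only [hm', and_true]; omega) rfl rfl
    · simp
      ring_nf
      ring_nf at hpk
      omega
  · simp
    ring_nf
    omega

/-- The initial basis: unit vectors, with degree bounds zero and a sentinel. -/
def unitRowsProg : Prog :=
  .seq (fillTable 13 20 21 (.var 16) (.var 17)
      (.cond (.natEq (.var 21) (.var 20)) (.setFld 11 0 0 1) (.setFld 11 0 0 0)) (.load 11 0 0))
    (.seq (forUp 20 (.var 16) (.setNat 18 (.var 20) 0)) (.setNat 18 (.var 16) (.var 13 + 1)))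

theorem runs_unitRowsProg {s : State p} {n W σ : ℕ} (h16 : s.nat 16 0 = n)
    (h17 : s.nat 17 0 = W) (h13 : s.nat 13 0 = σ) :
    Runs unitRowsProg s (n * (W * 40 + 60) + 60) fun s' =>
      (∀ i < n, ∀ j < W, s'.fld 13 i j = (Polynomial.X ^ i : Polynomial (ZMod p)).coeff j) ∧
      (∀ i < n, s'.nat 18 i = 0) ∧ s'.nat 18 n = σ + 1 := by
  apply Runs.le
  · apply Runs.seq
    · refine Runs.fillTable (N := n) (N' := W) (T := 10)
        (fun i j => (Polynomial.X ^ i : Polynomial (ZMod p)).coeff j)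
        (by simp [h16]) (by simp [h17]) rfl rfl rfl rfl (by simp) rfl ?_
      intro i hi j hj s₁ k₁ hu hv _
      apply Runs.le
      · apply Runs.cond (T := 4)
        · intro hb
          refine Runs.setFld ?_ (by simp)
          simp only [Test.holds_natEq, NatExpr.eval_var, hu, hv] at hb
          simp [Polynomial.coeff_X_pow, hb]
        · intro hb
          refine Runs.setFld ?_ (by simp)
          simp only [Test.holds_natEq, NatExpr.eval_var, hu, hv] at hb
          simp [Polynomial.coeff_X_pow, hb]
      · simp
    intro s₁ k₁ r₁
    apply Runs.seq
    · refine Runs.forUp (N := n) (T := 10) (fun i s' => ∀ j < i, s'.nat 18 j = 0)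
        (by simp [k₁.nat 16 rfl, h16]) rfl rfl (by simp) ?_
      intro i hi s₂ k₂ hv I₂
      refine Runs.setNat ?_ (by simp)
      intro j hj
      by_cases hji : j = i
      · simp [hji, hv]
      · simp [hji, hv, I₂ j (by omega)]
    intro s₂ k₂ r₂
    refine Runs.setNat ⟨fun i hi j hj => ?_, fun i hi => ?_, ?_⟩ le_rfl
    · simp [k₂.fld 13 rfl, r₁, hi, hj]
    · simp [k₂.nat 16 rfl, k₁.nat 16 rfl, h16, hi.ne, r₂ i hi]
    · simp [k₂.nat 16 rfl, k₁.nat 16 rfl, h16, k₂.nat 13 rfl, k₁.nat 13 rfl, h13]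
  · simp
    ring_nf
    omega

/-- The residues of the rows at the current position `nat 20`. -/
def residuesProg : Prog :=
  .seq (mulInto 19 22 (.var 20) (.var 16))
    (fillRow 14 21 0 (.var 16)
      (sumInto 10 22 (.var 19 + .var 16) (.natEq 0 0)
        (.load 13 (.var 21) (.var 22) * .load 12 0 (.var 19 + .var 14 - .var 22)))
      (.load 10 0 0))

theorem runs_residuesProg {s : State p} {K t σ : ℕ} (h14 : s.nat 14 0 = K)
    (h16 : s.nat 16 0 = K + 1) (h20 : s.nat 20 0 = t) (ht : t < σ)
    {B : ℕ → Polynomial (ZMod p)}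
    (h13 : ∀ i < K + 1, ∀ j < (K + 1) * (σ + 1), s.fld 13 i j = (B i).coeff j) :
    Runs residuesProg s ((K + 1) * ((K + 1) * (t + 1) * 50 + 60) + t * 20 + 60) fun s' =>
      ∀ i < K + 1, s'.fld 14 0 i = MahlerMethod.residue (K + 1) (s.fld 12 0) t (B i) := by
  apply Runs.le
  · apply Runs.seq
    · exact Runs.mulInto (N := t) (M := K + 1) (by simp [h20]) (by simp [h16]) (by simp) rfl rfl
    intro s₁ k₁ r₁
    have e19 : t * (K + 1) + (K + 1) = (K + 1) * (t + 1) := by ring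
    refine (Runs.fillRow (N := K + 1) (i₀ := 0) (T := (K + 1) * (t + 1) * 42 + 20)
      (fun i => MahlerMethod.residue (K + 1) (s.fld 12 0) t (B i)) (by simp [k₁.nat 16 rfl, h16])
      (by simp) rfl rfl rfl rfl ?_).mono (fun s' _ h' i hi => by simp [h', hi]) le_rfl
    intro i hi s₂ k₂ hv _
    refine (Runs.sumInto (N := (K + 1) * (t + 1)) (fun j => (B i).coeff j *
      s.fld 12 0 ((K + 1) * (t + 1) - 1 - j))
      (by simp [k₂.nat 16 rfl, k₂.nat 19 rfl, k₁.nat 16 rfl, h16, r₁, e19]) rfl ?_).mono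
      (fun s' _ h' => by simp [h', MahlerMethod.residue]) (by simp)
    intro j hj s₃ k₃ hv₃
    have hj' : j < (K + 1) * (σ + 1) := hj.trans_le (Nat.mul_le_mul_left _ (by omega))
    have e : t * (K + 1) + K - j = (K + 1) * (t + 1) - 1 - j := by rw [← e19]; omega
    simp [k₃.nat 21 rfl, hv, hv₃, k₃.fld 13 rfl, k₃.fld 12 rfl, k₂.fld 13 rfl, k₂.fld 12 rfl,
      k₁.fld 13 rfl, k₁.fld 12 rfl, h13 i hi j hj', k₃.nat 19 rfl, k₃.nat 14 rfl, k₂.nat 19 rfl,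
      k₂.nat 14 rfl, k₁.nat 14 rfl, h14, r₁, e]
  · simp
    ring_nf
    omega

/-- The pivot: a row of least degree bound among those whose residue does not vanish. -/
def pivotProg : Prog :=
  .seq (.setNat 25 0 (.var 16))
    (forUp 21 (.var 16)
      (.cond (.neg (.fldEq (.load 14 0 (.var 21)) 0))
        (.cond (.natLt (.load 18 (.var 21)) (.load 18 (.var 25))) (.setNat 25 0 (.var 21)) .skip)
        .skip))

/-- The pivot starts at the sentinel row `n`, whose bound exceeds all others, so the first nonzero
residue always replaces it. Ending at `n` means that all residues vanish. -/
theorem runs_pivotProg {s : State p} {n : ℕ} (h16 : s.nat 16 0 = n)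
    (h18 : ∀ i < n, s.nat 18 i < s.nat 18 n) :
    Runs pivotProg s (n * 50 + 30) fun s' =>
      s'.nat 25 0 = n ∧ (∀ i < n, s.fld 14 0 i = 0) ∨
      s'.nat 25 0 < n ∧ s.fld 14 0 (s'.nat 25 0) ≠ 0 ∧
        ∀ i < n, s.fld 14 0 i ≠ 0 → s.nat 18 (s'.nat 25 0) ≤ s.nat 18 i := by
  apply Runs.le
  · apply Runs.seq (R₁ := fun s' => s'.nat 25 0 = n)
    · exact Runs.setNat (by simp [h16]) le_rfl
    intro s₁ k₁ r₁
    refine Runs.forUp (N := n) (T := 30) (fun i s' =>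
      s'.nat 25 0 = n ∧ (∀ j < i, s.fld 14 0 j = 0) ∨
      s'.nat 25 0 < n ∧ s.fld 14 0 (s'.nat 25 0) ≠ 0 ∧
        ∀ j < i, s.fld 14 0 j ≠ 0 → s.nat 18 (s'.nat 25 0) ≤ s.nat 18 j)
      (by simp [k₁.nat 16 rfl, h16]) rfl rfl (by simp [r₁]) ?_
    intro i hi s₂ k₂ hv I₂
    apply Runs.le
    · apply Runs.cond (T := 15)
      · intro hb
        apply Runs.le
        · apply Runs.cond (T := 5)
          · intro hb'
            refine Runs.setNat ?_ (by simp)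
            simp [hv, k₂.fld 14 rfl, k₁.fld 14 rfl] at hb
            simp [hv, k₂.nat 18 rfl, k₁.nat 18 rfl] at hb'
            refine Or.inr ?_
            simp only [State.setNat_nat, NatExpr.eval_var, hv]
            simp only [NatExpr.eval_zero, if_true, and_true]
            refine ⟨hi, hb, fun j hj hj' => ?_⟩
            by_cases hji : j = i
            · simp [hji]
            rcases I₂ with h | h
            · exact absurd (h.2 j (by omega)) hj'
            · exact hb'.le.trans (h.2.2 j (by omega) hj')
          · intro hb'
            refine Runs.skip ?_ (by simp)
            simp [hv, k₂.fld 14 rfl, k₁.fld 14 rfl] at hb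
            simp [hv, k₂.nat 18 rfl, k₁.nat 18 rfl] at hb'
            simp only [State.setNat_nat]
            rcases I₂ with h | h
            · rw [h.1] at hb'
              exact absurd (h18 i hi) (not_lt.2 hb')
            · refine Or.inr ⟨h.1, h.2.1, fun j hj hj' => ?_⟩
              by_cases hji : j = i
              · rw [hji]
                exact hb'
              · exact h.2.2 j (by omega) hj'
        · simp
      · intro hb
        refine Runs.skip ?_ (by simp)
        simp [hv, k₂.fld 14 rfl, k₁.fld 14 rfl] at hb
        simp only [State.setNat_nat]
        refine I₂.imp (fun h => ⟨h.1, fun j hj => ?_⟩) fun h => ⟨h.1, h.2.1, fun j hj hj' => ?_⟩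
        · by_cases hji : j = i
          · rw [hji, hb]
          · exact h.2 j (by omega)
        · by_cases hji : j = i
          · rw [hji] at hj'
            exact absurd hb hj'
          · exact h.2.2 j (by omega) hj'
    · simp
  · simp
    omega

/-- Elimination by the row `nat 25`, which is then multiplied by the variable. -/
def eliminateProg : Prog :=
  .seq (fillTable 19 21 22 (.var 16) (.var 17)
      (.cond (.natEq (.var 21) (.var 25))
        (.cond (.natLt (.var 22) (.var 16)) (.setFld 11 0 0 0)
          (.setFld 11 0 0 (.load 13 (.var 25) (.var 22 - .var 16))))
        (.setFld 11 0 0 (.load 13 (.var 21) (.var 22) -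
          .load 14 0 (.var 21) / .load 14 0 (.var 25) * .load 13 (.var 25) (.var 22))))
      (.load 11 0 0))
    (.seq (fillTable 13 21 22 (.var 16) (.var 17) .skip (.load 19 (.var 21) (.var 22)))
      (.setNat 18 (.var 25) (.load 18 (.var 25) + 1)))

-- The new rows are built in the auxiliary array `19` and copied back afterwards, because every row
-- needs the old pivot row.
open Polynomial in
theorem runs_eliminateProg {s : State p} {n W k : ℕ} (h16 : s.nat 16 0 = n)
    (h17 : s.nat 17 0 = W) (h25 : s.nat 25 0 = k) (hk : k < n) {B : ℕ → (ZMod p)[X]}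
    {r : ℕ → ZMod p} (h13 : ∀ i < n, ∀ j < W, s.fld 13 i j = (B i).coeff j)
    (h14 : ∀ i < n, s.fld 14 0 i = r i) :
    Runs eliminateProg s (n * (W * 100 + 60) + 60) fun s' =>
      (∀ i < n, ∀ j < W, s'.fld 13 i j =
        (if i = k then X ^ n * B k else B i - C (r i / r k) * B k).coeff j) ∧
      ∀ i, s'.nat 18 i = if i = k then s.nat 18 k + 1 else s.nat 18 i := by
  apply Runs.le
  · apply Runs.seq
    · refine Runs.fillTable (N := n) (N' := W) (T := 50)
        (fun i j => (if i = k then X ^ n * B k else B i - C (r i / r k) * B k).coeff j)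
        (by simp [h16]) (by simp [h17]) rfl rfl rfl rfl (by simp) rfl ?_
      intro i hi j hj s₁ k₁ hu hv _
      have e25 : s₁.nat 25 0 = k := by simp [k₁.nat 25 rfl, h25]
      have e16 : s₁.nat 16 0 = n := by simp [k₁.nat 16 rfl, h16]
      have e13 : ∀ i < n, ∀ j < W, s₁.fld 13 i j = (B i).coeff j := by
        simpa [k₁.fld 13 rfl] using h13
      have e14 : ∀ i < n, s₁.fld 14 0 i = r i := by simpa [k₁.fld 14 rfl] using h14
      apply Runs.le
      · apply Runs.cond (T := 40)
        · intro hb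
          simp only [Test.holds_natEq, NatExpr.eval_var, hu, e25] at hb
          apply Runs.le
          · apply Runs.cond (T := 30)
            · intro hb'
              simp only [Test.holds_natLt, NatExpr.eval_var, hv, e16] at hb'
              refine Runs.setFld ?_ (by simp)
              simp [hb, coeff_X_pow_mul', not_le.2 hb']
            · intro hb'
              simp only [Test.holds_natLt, NatExpr.eval_var, hv, e16] at hb'
              refine Runs.setFld ?_ (by simp)
              simp [hb, coeff_X_pow_mul', not_lt.1 hb', hv, e16, e25,
                e13 k hk (j - n) (by omega)]
          · simp
        · intro hb
          simp only [Test.holds_natEq, NatExpr.eval_var, hu, e25] at hb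
          refine Runs.setFld ?_ (by simp)
          simp only [FldExpr.eval_sub, FldExpr.eval_mul, FldExpr.eval_div, FldExpr.eval_load,
            NatExpr.eval_var, NatExpr.eval_zero, State.setFld_fld, hu, hv, e25, e13 i hi j hj,
            e13 k hk j hj, e14 i hi, e14 k hk, if_neg hb, coeff_sub, coeff_C_mul]
          simp
      · simp
    intro s₁ k₁ r₁
    apply Runs.seq
    · refine Runs.fillTable (N := n) (N' := W) (T := 1)
        (fun i j => (if i = k then X ^ n * B k else B i - C (r i / r k) * B k).coeff j)
        (by simp [k₁.nat 16 rfl, h16]) (by simp [k₁.nat 17 rfl, h17]) rfl rfl rfl rfl (by simp)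
        rfl ?_
      intro i hi j hj s₂ k₂ hu hv _
      refine Runs.skip ?_ le_rfl
      simp only [FldExpr.eval_load, NatExpr.eval_var, hu, hv, k₂.fld 19 rfl, r₁]
      rw [if_pos ⟨hi, hj⟩]
    intro s₂ k₂ r₂
    refine Runs.setNat ⟨fun i hi j hj => ?_, fun i => ?_⟩ le_rfl
    · rw [State.setNat_fld, r₂, if_pos ⟨hi, hj⟩]
    · simp [k₂.nat 25 rfl, k₁.nat 25 rfl, h25, k₂.nat 18 rfl, k₁.nat 18 rfl]
  · simp
    ring_nf
    omega

/-! ### The reduced basis and the search for the minimal order -/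

open Polynomial MahlerMethod

/-- A reduced basis of the approximation module of order `nat 13`. -/
def basisProg : Prog :=
  .seq interleaveProg
    (.seq unitRowsProg
      (forUp 20 (.var 13)
        (.seq residuesProg
          (.seq pivotProg (.cond (.natLt (.var 25) (.var 16)) eliminateProg .skip)))))

/-- After `t` rounds the table holds a reduced basis of order `t`. The bounds satisfy `δ i ≤ t`, so
the sentinel `σ + 1` stays above them. -/
theorem runs_basisProg {s : State p} {d K σ : ℕ} (h14 : s.nat 14 0 = K)
    (h13 : s.nat 13 0 = σ) (hKd : K ≤ d) (h11 : ∀ k ≤ d, s.nat 11 k = p ^ k)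
    (hσ : ∀ k ≤ d, p ^ k ≤ σ) {f : PowerSeries (ZMod p)}
    (h9 : ∀ m < σ, s.fld 9 1 m = PowerSeries.coeff m f) :
    Runs basisProg s ((K + 1) * (K + 1) * ((σ + 1) * (σ + 1) * 1000)) fun s' =>
      s'.nat 16 0 = K + 1 ∧ s'.nat 17 0 = (K + 1) * (σ + 1) ∧
      ∃ (Ψ : ℕ → ZMod p) (B : ℕ → (ZMod p)[X]) (δ : ℕ → ℕ),
        (∀ k < K + 1, ∀ m < σ, Ψ ((K + 1) * m + k) = PowerSeries.coeff m (f ^ p ^ k)) ∧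
        IsReducedBasis (K + 1) Ψ σ B δ ∧
        (∀ i < K + 1, ∀ j < (K + 1) * (σ + 1), s'.fld 13 i j = (B i).coeff j) ∧
        ∀ i < K + 1, s'.nat 18 i = δ i := by
  apply Runs.le
  · apply Runs.seq
    · exact runs_interleaveProg h14 h13 hKd h11 hσ h9
    intro s₁ k₁ r₁
    apply Runs.seq
    · exact runs_unitRowsProg r₁.1 r₁.2.1 (σ := σ) (by simp [k₁.nat 13 rfl, h13])
    intro s₂ k₂ r₂
    refine Runs.mono (Runs.forUp (N := σ)
      (T := (K + 1) * (K + 1) * ((σ + 1) * 150) + (K + 1) * ((σ + 1) * 250) + (σ + 1) * 300)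
      (fun t s' => ∃ (B : ℕ → (ZMod p)[X]) (δ : ℕ → ℕ),
        IsReducedBasis (K + 1) (s₁.fld 12 0) t B δ ∧
        (∀ i < K + 1, ∀ j < (K + 1) * (σ + 1), s'.fld 13 i j = (B i).coeff j) ∧
        (∀ i < K + 1, s'.nat 18 i = δ i) ∧ s'.nat 18 (K + 1) = σ + 1)
      (by simp [k₂.nat 13 rfl, k₁.nat 13 rfl, h13]) rfl rfl ?_ ?_) ?_ le_rfl
    · exact ⟨_, _, .init (Nat.succ_pos K), r₂.1, by simpa using r₂.2.1, by simpa using r₂.2.2⟩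
    · rintro t ht s₃ k₃ hv ⟨B, δ, hB, h13B, h18, h18n⟩
      have e16 : s₃.nat 16 0 = K + 1 := by simp [k₃.nat 16 rfl, k₂.nat 16 rfl, r₁.1]
      have e17 : s₃.nat 17 0 = (K + 1) * (σ + 1) := by simp [k₃.nat 17 rfl, k₂.nat 17 rfl, r₁.2.1]
      have e12 : s₃.fld 12 = s₁.fld 12 := by rw [k₃.fld 12 rfl, k₂.fld 12 rfl]
      apply Runs.le
      · apply Runs.seq
        · exact runs_residuesProg (K := K) (σ := σ)
            (by simp [k₃.nat 14 rfl, k₂.nat 14 rfl, k₁.nat 14 rfl, h14]) e16 hv ht h13B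
        intro s₄ k₄ r₄
        rw [e12] at r₄
        have e18 : s₄.nat 18 = s₃.nat 18 := k₄.nat 18 rfl
        apply Runs.seq
        · refine runs_pivotProg (n := K + 1) (by simp [k₄.nat 16 rfl, e16]) ?_
          intro i hi
          rw [e18, h18 i hi, h18n]
          have := hB.le_time i hi
          omega
        intro s₅ k₅ r₅
        have e18' : s₅.nat 18 = s₃.nat 18 := by rw [k₅.nat 18 rfl, e18]
        have e13' : s₅.fld 13 = s₃.fld 13 := by rw [k₅.fld 13 rfl, k₄.fld 13 rfl]
        apply Runs.cond (T := (K + 1) * ((K + 1) * (σ + 1) * 100 + 60) + 60)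
        · intro hb
          simp only [Test.holds_natLt, NatExpr.eval_var, k₅.nat 16 rfl, k₄.nat 16 rfl, e16] at hb
          rcases r₅ with h | ⟨-, h1, h2⟩
          · exact absurd h.1 hb.ne
          refine (runs_eliminateProg (n := K + 1) (W := (K + 1) * (σ + 1))
            (by simp [k₅.nat 16 rfl, k₄.nat 16 rfl, e16])
            (by simp [k₅.nat 17 rfl, k₄.nat 17 rfl, e17]) rfl hb
            (by simpa [e13'] using h13B) (r := fun i => residue (K + 1) (s₁.fld 12 0) t (B i))
            (by simpa [k₅.fld 14 rfl] using r₄)).mono ?_ le_rfl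
          intro s₆ k₆ r₆
          refine ⟨_, _, hB.succ hb (by rw [← r₄ _ hb]; exact h1) ?_, r₆.1, ?_, ?_⟩
          · intro i hi hri
            rw [← r₄ i hi] at hri
            have := h2 i hi hri
            rwa [e18, h18 i hi, h18 _ hb] at this
          · intro i hi
            simp [r₆.2, e18', h18 i hi, h18 _ hb]
          · simp [r₆.2, hb.ne', e18', h18n]
        · intro hb
          simp only [Test.holds_natLt, NatExpr.eval_var, k₅.nat 16 rfl, k₄.nat 16 rfl, e16] at hb
          rcases r₅ with h | h
          · refine Runs.skip ⟨B, δ, hB.succ_of_residue_eq_zero fun i hi => ?_, ?_, ?_, ?_⟩ (by omega)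
            · rw [← r₄ i hi, h.2 i hi]
            · simpa [e13'] using h13B
            · simpa [e18'] using h18
            · simpa [e18'] using h18n
          · exact absurd h.1 hb
      · obtain ⟨u, rfl⟩ := Nat.exists_eq_add_of_lt ht
        simp
        ring_nf
        omega
    · intro s₃ k₃ ⟨B, δ, hB, h13B, h18, _⟩
      exact ⟨by simp [k₃.nat 16 rfl, k₂.nat 16 rfl, r₁.1],
        by simp [k₃.nat 17 rfl, k₂.nat 17 rfl, r₁.2.1], s₁.fld 12 0, B, δ, r₁.2.2, hB, h13B, h18⟩
  · simp
    ring_nf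
    omega

/-- The search for a nonzero row whose degree bound is at most `nat 12`. -/
def searchProg : Prog :=
  forUp 20 (.var 16)
    (.cond (.natLt (.var 12) (.load 18 (.var 20))) .skip
      (forUp 21 (.var 17)
        (.cond (.fldEq (.load 13 (.var 20) (.var 21)) 0) .skip
          (.seq (.setNat 15 0 1) (.setNat 26 0 (.var 20))))))

theorem runs_searchProg {s : State p} {n W H : ℕ} (h16 : s.nat 16 0 = n) (h17 : s.nat 17 0 = W)
    (h12 : s.nat 12 0 = H) (h15 : s.nat 15 0 = 0) :
    Runs searchProg s (n * (W * 40 + 60) + 20) fun s' =>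
      s'.nat 15 0 = 0 ∧ (∀ i < n, s.nat 18 i ≤ H → ∀ j < W, s.fld 13 i j = 0) ∨
      s'.nat 15 0 = 1 ∧ s'.nat 26 0 < n ∧ s.nat 18 (s'.nat 26 0) ≤ H ∧
        ∃ j < W, s.fld 13 (s'.nat 26 0) j ≠ 0 := by
  refine Runs.le (Runs.forUp (N := n) (T := W * 30 + 30) (fun q s' =>
      s'.nat 15 0 = 0 ∧ (∀ i < q, s.nat 18 i ≤ H → ∀ j < W, s.fld 13 i j = 0) ∨
      s'.nat 15 0 = 1 ∧ s'.nat 26 0 < n ∧ s.nat 18 (s'.nat 26 0) ≤ H ∧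
        ∃ j < W, s.fld 13 (s'.nat 26 0) j ≠ 0)
    (by simp [h16]) rfl rfl (by simp [h15]) ?_) ?_
  · intro i hi s₁ k₁ hu I₁
    apply Runs.le
    · apply Runs.cond (T := W * 30 + 10)
      · intro hb
        simp [k₁.nat 12 rfl, k₁.nat 18 rfl, h12, hu] at hb
        refine Runs.skip ?_ (by omega)
        refine I₁.imp (fun h => ⟨by simpa using h.1, fun j hj hj' => ?_⟩) (fun h => by simpa using h)
        refine h.2 j ?_ hj'
        rcases Nat.lt_succ_iff_lt_or_eq.1 hj with h | rfl
        · exact h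
        · omega
      · intro hb
        simp [k₁.nat 12 rfl, k₁.nat 18 rfl, h12, hu] at hb
        apply Runs.le
        · refine Runs.mono (Runs.forUp (N := W) (T := 18) (fun m s' =>
            s'.nat 15 0 = 0 ∧ ((∀ i' < i, s.nat 18 i' ≤ H → ∀ j < W, s.fld 13 i' j = 0) ∧
              ∀ j < m, s.fld 13 i j = 0) ∨
            s'.nat 15 0 = 1 ∧ s'.nat 26 0 < n ∧ s.nat 18 (s'.nat 26 0) ≤ H ∧
              ∃ j < W, s.fld 13 (s'.nat 26 0) j ≠ 0) (by simp [k₁.nat 17 rfl, h17]) rfl rfl ?_ ?_)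
            (fun s' _ h' => ?_) le_rfl
          · simpa using I₁
          · intro m hm s₂ k₂ hv I₂
            apply Runs.le
            · apply Runs.cond (T := 9)
              · intro hb'
                simp [k₂.fld 13 rfl, k₁.fld 13 rfl, hv, k₂.nat 20 rfl, hu] at hb'
                refine Runs.skip ?_ (by simp)
                refine I₂.imp (fun h => ⟨by simpa using h.1, h.2.1, fun j hj => ?_⟩)
                  (fun h => by simpa using h)
                rcases Nat.lt_succ_iff_lt_or_eq.1 hj with h' | rfl
                · exact h.2.2 j h'
                · exact hb'
              · intro hb'
                simp [k₂.fld 13 rfl, k₁.fld 13 rfl, hv, k₂.nat 20 rfl, hu] at hb'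
                apply Runs.le
                · apply Runs.seq (R₁ := fun s' => s'.nat 15 0 = 1)
                  · exact Runs.setNat (by simp) le_rfl
                  intro s₃ k₃ r₃
                  refine Runs.setNat (Or.inr ?_) le_rfl
                  simp [r₃, k₃.nat 20 rfl, k₂.nat 20 rfl, hu, hi, hb]
                  exact ⟨m, hm, hb'⟩
                · simp
            · simp
          · refine h'.imp (fun h => ⟨by simpa using h.1, fun j hj hj' => ?_⟩) (fun h => by simpa using h)
            rcases Nat.lt_succ_iff_lt_or_eq.1 hj with h'' | rfl
            · exact h.2.1 j h'' hj'
            · exact h.2.2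
        · simp
          omega
    · simp
      omega
  · simp
    ring_nf
    omega

/-- The components of the row `nat 26` become the coefficients of the Mahler equation. -/
def copyProg : Prog :=
  .seq (.setNat 4 0 (.var 14))
    (fillTable 1 20 21 (.var 16) (.var 5) (mulInto 23 22 (.var 21) (.var 16))
      (.load 13 (.var 26) (.var 23 + .var 14 - .var 20)))

theorem runs_copyProg {s : State p} {K H i : ℕ} (h14 : s.nat 14 0 = K)
    (h16 : s.nat 16 0 = K + 1) (h5 : s.nat 5 0 = H + 1) (h26 : s.nat 26 0 = i)
    (h1 : ∀ k j, s.fld 1 k j = 0) {b : (ZMod p)[X]} {W : ℕ}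
    (h13 : ∀ j < W, s.fld 13 i j = b.coeff j) (hW : (K + 1) * (H + 1) ≤ W)
    (hb : ∀ k < K + 1, (component (K + 1) b k).natDegree ≤ H) :
    Runs copyProg s ((K + 1) * ((H + 1) * (H * 18 + 60) + 40) + 20) fun s' =>
      s'.nat 4 0 = K ∧ ∀ k ≤ K, ∀ j, s'.fld 1 k j = (component (K + 1) b k).coeff j := by
  apply Runs.le
  · apply Runs.seq (R₁ := fun s' => s'.nat 4 0 = K)
    · exact Runs.setNat (by simp [h14]) le_rfl
    intro s₁ k₁ r₁
    refine (Runs.fillTable (N := K + 1) (N' := H + 1) (T := H * 18 + 20)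
      (fun k j => (component (K + 1) b k).coeff j) (by simp [k₁.nat 16 rfl, h16])
      (by simp [k₁.nat 5 rfl, h5]) rfl rfl rfl rfl (by simp) rfl ?_).mono ?_ le_rfl
    · intro k hk j hj s₂ k₂ hu hv _
      refine (Runs.mulInto (N := j) (M := K + 1) (by simp [hv])
        (by simp [k₂.nat 16 rfl, k₁.nat 16 rfl, h16]) (by simp) rfl rfl).mono ?_ (by simp; omega)
      intro s₃ k₃ r₃
      have hjW : j * (K + 1) + K - k < W := by
        have : (K + 1) * (j + 1) ≤ (K + 1) * (H + 1) := Nat.mul_le_mul_left _ hj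
        have e : (K + 1) * (j + 1) = j * (K + 1) + (K + 1) := by ring
        omega
      have e : (K + 1) * j + (K - k) = j * (K + 1) + K - k := by
        rw [mul_comm]
        omega
      simp [r₃, k₃.nat 14 rfl, k₂.nat 14 rfl, k₁.nat 14 rfl, h14, k₃.nat 20 rfl, hu, k₃.nat 26 rfl,
        k₂.nat 26 rfl, k₁.nat 26 rfl, h26, k₃.fld 13 rfl, k₂.fld 13 rfl, k₁.fld 13 rfl, h13 _ hjW,
        coeff_component, e]
    · intro s₂ k₂ r₂
      refine ⟨by simp [k₂.nat 4 rfl, r₁], fun k hk j => ?_⟩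
      rw [r₂]
      split_ifs with h
      · rfl
      · rw [k₁.fld 1 rfl, h1, coeff_eq_zero_of_natDegree_lt]
        have := hb k (by omega)
        omega
  · simp
    ring_nf
    omega

/-- The orders are tried one after the other. -/
def orderProg : Prog :=
  forUp 14 (.var 2 + 1)
    (.cond (.natEq (.var 15) 0)
      (.seq basisProg (.seq searchProg (.cond (.natEq (.var 15) 1) copyProg .skip))) .skip)

/-- The premises are the two bounds of the degree theory. A row with bound at most `H` is an exact
relation by `hzero`. If no such row exists, a relation of order `K` could be replaced by a short one
by `hsmall`, which the reduced basis would detect. At `K = d` a short relation exists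
unconditionally, so the search succeeds. -/
theorem runs_orderProg {s : State p} {d σ H : ℕ} (h2 : s.nat 2 0 = d) (h5 : s.nat 5 0 = H + 1)
    (h12 : s.nat 12 0 = H) (h13 : s.nat 13 0 = σ) (hHσ : H ≤ σ) (h15 : s.nat 15 0 = 0)
    (h11 : ∀ k ≤ d, s.nat 11 k = p ^ k) (hσ : ∀ k ≤ d, p ^ k ≤ σ)
    (h1 : ∀ k j, s.fld 1 k j = 0) {f : PowerSeries (ZMod p)}
    (h9 : ∀ m < σ, s.fld 9 1 m = PowerSeries.coeff m f)
    (hsmall : ∀ K ≤ d, (K = d ∨ ∃ c : ℕ → (ZMod p)[X], (∃ k ≤ K, c k ≠ 0) ∧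
        ∑ k ∈ Finset.range (K + 1), (c k : PowerSeries (ZMod p)) * f ^ p ^ k = 0) →
      ∃ c : ℕ → (ZMod p)[X], (∃ k ≤ K, c k ≠ 0) ∧ (∀ k, (c k).natDegree ≤ H) ∧
        ∑ k ∈ Finset.range (K + 1), (c k : PowerSeries (ZMod p)) * f ^ p ^ k = 0)
    (hzero : ∀ K ≤ d, ∀ c : ℕ → (ZMod p)[X], (∀ k, (c k).natDegree ≤ H) →
      PowerSeries.X ^ σ ∣ ∑ k ∈ Finset.range (K + 1), (c k : PowerSeries (ZMod p)) * f ^ p ^ k →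
      ∑ k ∈ Finset.range (K + 1), (c k : PowerSeries (ZMod p)) * f ^ p ^ k = 0) :
    Runs orderProg s ((d + 1) * (d + 1) * (d + 1) * ((σ + 1) * (σ + 1) * 1500)) fun s' =>
      ∃ (K : ℕ) (c : ℕ → (ZMod p)[X]), K ≤ d ∧ s'.nat 4 0 = K ∧
        (∀ k ≤ K, ∀ j, s'.fld 1 k j = (c k).coeff j) ∧ (∀ k, (c k).natDegree ≤ H) ∧
        IsMinimalMahlerEquation f K c := by
  refine Runs.mono (Runs.forUp (N := d + 1) (T := (d + 1) * (d + 1) * ((σ + 1) * (σ + 1) * 1400))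
    (fun K₀ s' => s'.nat 15 0 = 0 ∧ (∀ k j, s'.fld 1 k j = 0) ∧
        (∀ K < K₀, ∀ c : ℕ → (ZMod p)[X],
          ∑ k ∈ Finset.range (K + 1), (c k : PowerSeries (ZMod p)) * f ^ p ^ k = 0 →
            ∀ k ≤ K, c k = 0) ∨
      s'.nat 15 0 = 1 ∧ ∃ (K : ℕ) (c : ℕ → (ZMod p)[X]), K ≤ d ∧ s'.nat 4 0 = K ∧
        (∀ k ≤ K, ∀ j, s'.fld 1 k j = (c k).coeff j) ∧ (∀ k, (c k).natDegree ≤ H) ∧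
        IsMinimalMahlerEquation f K c)
    (by simp [h2]) rfl rfl (by simp [h15, h1]) ?_) ?_ ?_
  · intro K hK s₁ k₁ hv I₁
    apply Runs.le
    · apply Runs.cond (T := (d + 1) * (d + 1) * ((σ + 1) * (σ + 1) * 1390))
      · intro hb
        simp only [Test.holds_natEq, NatExpr.eval_var, NatExpr.eval_zero] at hb
        obtain ⟨-, hz, hmin⟩ := I₁.resolve_right fun h => by omega
        apply Runs.le
        · apply Runs.seq
          · exact runs_basisProg (K := K) (d := d) (σ := σ) (f := f) hv (by simp [k₁.nat 13 rfl, h13])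
              (by omega) (by simpa [k₁.nat 11 rfl] using h11) hσ (by simpa [k₁.fld 9 rfl] using h9)
          rintro s₂ k₂ ⟨e16, e17, Ψ, B, δ, hΨ, hB, h13B, h18⟩
          apply Runs.seq
          · exact runs_searchProg e16 e17 (H := H) (by simp [k₂.nat 12 rfl, k₁.nat 12 rfl, h12])
              (by simp [k₂.nat 15 rfl, hb])
          intro s₃ k₃ r₃
          have hW : (K + 1) * (H + 1) ≤ (K + 1) * (σ + 1) := Nat.mul_le_mul_left _ (by omega)
          apply Runs.cond (T := (K + 1) * ((H + 1) * (H * 18 + 60) + 40) + 20)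
          · intro hb'
            simp only [Test.holds_natEq, NatExpr.eval_var, NatExpr.eval_one] at hb'
            obtain ⟨-, hsel, hδ, j, hj, hne⟩ := r₃.resolve_left fun h => by omega
            set i := s₃.nat 26 0 with hi
            rw [h18 i hsel] at hδ
            rw [h13B i hsel j hj] at hne
            have hBi : B i ≠ 0 := fun h => hne (by rw [h, coeff_zero])
            have hdeg : ∀ k, (component (K + 1) (B i) k).natDegree ≤ H := fun k =>
              (hB.natDegree_component_le hsel k).trans hδ
            have hrel := hzero K (by omega) _ hdeg
              (hB.dvd (G := fun k => f ^ p ^ k) hΨ hsel)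
            refine (runs_copyProg (K := K) (H := H) (i := i) (b := B i)
              (W := (K + 1) * (σ + 1))
              (by simp [k₃.nat 14 rfl, k₂.nat 14 rfl, hv]) (by simp [k₃.nat 16 rfl, e16])
              (by simp [k₃.nat 5 rfl, k₂.nat 5 rfl, k₁.nat 5 rfl, h5]) rfl
              (by simpa [k₃.fld 1 rfl, k₂.fld 1 rfl] using hz)
              (by simpa [k₃.fld 13 rfl] using h13B i hsel) hW fun k _ => hdeg k).mono
              (fun s₄ k₄ r₄ => Or.inr ⟨by simp [k₄.nat 15 rfl, hb'], K, component (K + 1) (B i),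
                by omega, by simpa using r₄.1, by simpa using r₄.2, hdeg, ?_, ?_, ?_⟩) le_rfl
            -- The top coefficient is nonzero, since otherwise a nontrivial relation of lower order
            -- would remain, which the earlier rounds have excluded.
            · obtain ⟨k, hk, hck⟩ := exists_component_ne_zero (Nat.succ_pos K) hBi
              intro h0
              rcases K with _ | K
              · obtain rfl : k = 0 := by omega
                exact hck h0
              · rw [Finset.sum_range_succ, h0] at hrel
                simp only [coe_zero, zero_mul, add_zero] at hrel
                rcases Nat.lt_succ_iff_lt_or_eq.1 hk with hk | rfl
                · exact hck (hmin K (by omega) _ hrel k (by omega))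
                · exact hck h0
            · rw [mahlerOp_ofPowerSeries_eq_zero_iff]
              exact hrel
            · intro K' hK' c' hc'
              rw [mahlerOp_ofPowerSeries_eq_zero_iff] at hc'
              exact hmin K' hK' c' hc'
          · intro hb'
            simp only [Test.holds_natEq, NatExpr.eval_var, NatExpr.eval_one] at hb'
            obtain ⟨h15', hrow⟩ := r₃.resolve_right fun h => hb' h.1
            refine Runs.skip (Or.inl ⟨by simp [h15'],
              by simpa [k₃.fld 1 rfl, k₂.fld 1 rfl] using hz, ?_⟩) (by omega)
            intro K' hK' c' hc'
            rcases Nat.lt_succ_iff_lt_or_eq.1 hK' with hK' | rfl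
            · exact hmin K' hK' c' hc'
            by_contra hcon
            push Not at hcon
            obtain ⟨c, ⟨k, hk, hck⟩, hdeg, hrel⟩ := hsmall K' (by omega) (Or.inr ⟨c', hcon, hc'⟩)
            obtain ⟨i, hi, hBi, hδi⟩ := hB.exists_small (Nat.succ_pos K')
              (G := fun k => f ^ p ^ k) hΨ ⟨k, by omega, hck⟩ (fun k _ => hdeg k) hrel
            apply hBi
            ext j
            rw [coeff_zero]
            by_cases hj : j < (K' + 1) * (σ + 1)
            · rw [← h13B i hi j hj]
              exact hrow i hi (by rw [h18 i hi]; exact hδi) j hj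
            · refine coeff_eq_zero_of_natDegree_lt ((hB.natDegree_lt i hi).trans_le ?_)
              exact (Nat.mul_le_mul_left _ (by omega)).trans (not_lt.1 hj)
        · obtain ⟨u, rfl⟩ := Nat.exists_eq_add_of_le hHσ
          obtain ⟨w, rfl⟩ := Nat.exists_eq_add_of_le (Nat.lt_succ_iff.1 hK)
          simp
          ring_nf
          omega
      · intro hb
        simp only [Test.holds_natEq, NatExpr.eval_var, NatExpr.eval_zero] at hb
        refine Runs.skip (Or.inr ?_) (by
          have : 0 < (d + 1) * (d + 1) * ((σ + 1) * (σ + 1) * 1390) := by positivity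
          omega)
        simpa using I₁.resolve_left fun h => hb h.1
    · simp
      ring_nf
      omega
  · intro s₁ k₁ h
    rcases h with ⟨-, -, h⟩ | h
    · obtain ⟨c, ⟨k, hk, hck⟩, -, hrel⟩ := hsmall d le_rfl (Or.inl rfl)
      exact absurd (h d (by omega) c hrel k hk) hck
    · exact h.2
  · simp
    ring_nf
    omega

/-- The degree and the lowest degree of the trailing coefficient. -/
def degreesProg : Prog :=
  .seq (forUp 20 (.var 5) (.cond (.fldEq (.load 1 0 (.var 20)) 0) .skip (.setNat 7 0 (.var 20))))
    (forUp 20 (.var 5) (.cond (.fldEq (.load 1 0 (.var 12 - .var 20)) 0) .skip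
      (.setNat 6 0 (.var 12 - .var 20))))

/-- The last nonzero entry met on the way up is the degree; the last one met on the way down is the
lowest degree. -/
theorem runs_degreesProg {s : State p} {H : ℕ} (h5 : s.nat 5 0 = H + 1) (h12 : s.nat 12 0 = H)
    {c : (ZMod p)[X]} (hc : c ≠ 0) (h1 : ∀ j, s.fld 1 0 j = c.coeff j)
    (hdeg : c.natDegree ≤ H) :
    Runs degreesProg s (H * 80 + 150) fun s' =>
      s'.nat 6 0 = c.natTrailingDegree ∧ s'.nat 7 0 = c.natDegree := by
  have hlow : c.natTrailingDegree ≤ c.natDegree := natTrailingDegree_le_natDegree c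
  apply Runs.le
  · apply Runs.seq
    · refine Runs.forUp (N := H + 1) (T := 12) (fun m s' =>
        c.natDegree < m → s'.nat 7 0 = c.natDegree) (by simp [h5]) rfl rfl
        (fun h => absurd h (Nat.not_lt_zero _)) ?_
      intro m hm s₁ k₁ hv I₁
      apply Runs.le
      · apply Runs.cond (T := 4)
        · intro hb
          simp [k₁.fld 1 rfl, hv, h1] at hb
          refine Runs.skip (fun hlt => ?_) (by simp)
          rcases Nat.lt_succ_iff_lt_or_eq.1 hlt with h | h
          · simpa using I₁ h
          · rw [← h, coeff_natDegree, leadingCoeff_eq_zero] at hb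
            exact absurd hb hc
        · intro hb
          simp [k₁.fld 1 rfl, hv, h1] at hb
          refine Runs.setNat (fun hlt => ?_) (by simp)
          have := le_natDegree_of_ne_zero hb
          simp [hv]
          omega
      · simp
    intro s₁ k₁ r₁
    refine Runs.mono (Runs.forUp (N := H + 1) (T := 20) (fun m s' =>
        H - c.natTrailingDegree < m → s'.nat 6 0 = c.natTrailingDegree)
        (by simp [k₁.nat 5 rfl, h5]) rfl rfl (fun h => absurd h (Nat.not_lt_zero _)) ?_)
        (fun s' k' h' => ⟨h' (by omega), by simpa [k'.nat 7 rfl] using r₁ (by omega)⟩) le_rfl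
    intro m hm s₂ k₂ hv I₂
    apply Runs.le
    · apply Runs.cond (T := 8)
      · intro hb
        simp [k₂.fld 1 rfl, k₁.fld 1 rfl, hv, h1, k₂.nat 12 rfl, k₁.nat 12 rfl, h12] at hb
        refine Runs.skip (fun hlt => ?_) (by simp)
        rcases Nat.lt_succ_iff_lt_or_eq.1 hlt with h | h
        · simpa using I₂ h
        · rw [← h, show H - (H - c.natTrailingDegree) = c.natTrailingDegree by omega] at hb
          exact absurd hb (trailingCoeff_nonzero_iff_nonzero.2 hc)
      · intro hb
        simp [k₂.fld 1 rfl, k₁.fld 1 rfl, hv, h1, k₂.nat 12 rfl, k₁.nat 12 rfl, h12] at hb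
        refine Runs.setNat (fun hlt => ?_) (by simp)
        have := natTrailingDegree_le_of_ne_zero hb
        simp [hv, k₂.nat 12 rfl, k₁.nat 12 rfl, h12]
        omega
    · simp
  · simp
    omega

/-- The first program finds a Mahler equation of minimal order. -/
def mahlerEquationProg : Prog :=
  .seq powTable (.seq boundsProg (.seq seriesProg (.seq orderProg degreesProg)))

/-- The memory after the first program. -/
structure HasMahlerEquation (d N H σ : ℕ) (f : PowerSeries (ZMod p)) (K : ℕ) (c : ℕ → (ZMod p)[X])
    (s : State p) : Prop where
  order_le : K ≤ d
  nat_0 : s.nat 0 0 = p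
  nat_2 : s.nat 2 0 = d
  nat_3 : s.nat 3 0 = N
  nat_4 : s.nat 4 0 = K
  nat_5 : s.nat 5 0 = H + 1
  nat_6 : s.nat 6 0 = (c 0).natTrailingDegree
  nat_7 : s.nat 7 0 = (c 0).natDegree
  nat_11 : ∀ k ≤ d, s.nat 11 k = p ^ k
  nat_12 : s.nat 12 0 = H
  fld_1 : ∀ k ≤ K, ∀ j, s.fld 1 k j = (c k).coeff j
  fld_9 : ∀ m < σ, s.fld 9 1 m = PowerSeries.coeff m f
  natDegree_le : ∀ k, (c k).natDegree ≤ H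
  minimal : IsMinimalMahlerEquation f K c

/-- For concrete programs both list conditions hold by `rfl`, which carries the facts of the first
program through all the following ones. -/
theorem HasMahlerEquation.of_keeps {d N H σ : ℕ} {f : PowerSeries (ZMod p)} {K : ℕ}
    {c : ℕ → (ZMod p)[X]} {s s' : State p} {P : Prog} (h : HasMahlerEquation d N H σ f K c s)
    (hs : Keeps P s s')
    (hn : ([0, 2, 3, 4, 5, 6, 7, 11, 12].all fun a => !P.writesNat a) = true)
    (hf : ([1, 9].all fun a => !P.writesFld a) = true) :
    HasMahlerEquation d N H σ f K c s' := by
  simp only [List.all_cons, List.all_nil, Bool.and_true, Bool.and_eq_true,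
    Bool.not_eq_true'] at hn hf
  obtain ⟨n0, n2, n3, n4, n5, n6, n7, n11, n12⟩ := hn
  obtain ⟨f1, f9⟩ := hf
  exact {
    order_le := h.order_le
    nat_0 := by rw [hs.nat 0 n0, h.nat_0]
    nat_2 := by rw [hs.nat 2 n2, h.nat_2]
    nat_3 := by rw [hs.nat 3 n3, h.nat_3]
    nat_4 := by rw [hs.nat 4 n4, h.nat_4]
    nat_5 := by rw [hs.nat 5 n5, h.nat_5]
    nat_6 := by rw [hs.nat 6 n6, h.nat_6]
    nat_7 := by rw [hs.nat 7 n7, h.nat_7]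
    nat_11 := by simpa [hs.nat 11 n11] using h.nat_11
    nat_12 := by rw [hs.nat 12 n12, h.nat_12]
    fld_1 := by simpa [hs.fld 1 f1] using h.fld_1
    fld_9 := by simpa [hs.fld 9 f9] using h.fld_9
    natDegree_le := h.natDegree_le
    minimal := h.minimal }

theorem runs_mahlerEquationProg {h d N Q H σ : ℕ} (hQ : Q = p ^ d) (hH : H = d * (Q * h))
    (hσ : σ = (d + 2) * H + 1) (hh1 : 1 ≤ h) (hd2 : 2 ≤ d) {E : (ZMod p)[X][X]}
    (hd : E.natDegree ≤ d) (hh : ∀ j, (E.coeff j).natDegree ≤ h)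
    (h01 : (E.coeff 1).coeff 0 ≠ 0) {f : PowerSeries (ZMod p)} (hf : IsRoot E f) :
    Runs mahlerEquationProg (inputState p h d N E)
      ((d + 1) * (d + 1) * (d + 1) * ((σ + 1) * (σ + 1) * 3000))
      fun s' => ∃ K c, HasMahlerEquation d N H σ f K c s' := by
  have hp := (Fact.out : p.Prime)
  have hpQ : p ≤ Q := by
    rw [hQ]
    exact Nat.le_self_pow (by omega) p
  have hdQ : d ≤ Q := by
    rw [hQ]
    exact (Nat.lt_pow_self hp.one_lt).le
  have hQH : Q ≤ H := by
    rw [hH, ← mul_assoc, mul_comm d Q, mul_assoc]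
    exact Nat.le_mul_of_pos_right _ (by positivity)
  have hhH : h ≤ H := by
    rw [hH, ← mul_assoc]
    exact Nat.le_mul_of_pos_left _ (Nat.mul_pos (by omega) (by rw [hQ]; exact pow_pos hp.pos _))
  have hHσ : H ≤ σ := by
    rw [hσ]
    have : H ≤ (d + 2) * H := Nat.le_mul_of_pos_left _ (by omega)
    omega
  have hpow : ∀ k ≤ d, p ^ k ≤ Q := fun k hk => hQ ▸ Nat.pow_le_pow_right hp.pos hk
  have hE0 : E ≠ 0 := by
    rintro rfl
    simp at h01
  obtain ⟨m, hm, hpos, hmd, hmh, hmin⟩ := exists_minimal_factor hE0 hf.2 hd hh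
  apply Runs.le
  · apply Runs.seq
    · exact runs_powTable (d := d) (by simp [inputState]) (by simp [inputState])
    intro s₁ k₁ r₁
    apply Runs.seq
    · exact runs_boundsProg (d := d) (h := h) (Q := Q) (by simp [k₁.nat 1 rfl, inputState])
        (by simp [k₁.nat 2 rfl, inputState]) (by rw [r₁ d le_rfl, hQ])
    intro s₂ k₂ r₂
    rw [← hH, ← hσ] at r₂
    apply Runs.seq
    · exact runs_seriesProg (d := d) (h := h) (by simp [k₂.nat 1 rfl, k₁.nat 1 rfl, inputState])
        (by simp [k₂.nat 2 rfl, k₁.nat 2 rfl, inputState]) r₂.2.1 hd2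
        (by simp [k₂.fld 9 rfl, k₁.fld 9 rfl, inputState])
        (by simp [k₂.fld 0 rfl, k₁.fld 0 rfl, inputState]) hd hh h01 hf.1 hf.2
    intro s₃ k₃ r₃
    apply Runs.seq
    · refine runs_orderProg (d := d) (σ := σ) (H := H) (f := f)
        (by simp [k₃.nat 2 rfl, k₂.nat 2 rfl, k₁.nat 2 rfl, inputState])
        (by simp [k₃.nat 5 rfl, r₂.2.2]) (by simp [k₃.nat 12 rfl, r₂.1])
        (by simp [k₃.nat 13 rfl, r₂.2.1]) hHσ
        (by simp [k₃.nat 15 rfl, k₂.nat 15 rfl, k₁.nat 15 rfl, inputState])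
        (by simpa [k₃.nat 11 rfl, k₂.nat 11 rfl] using r₁)
        (fun k hk => (hpow k hk).trans (hQH.trans hHσ))
        (by simp [k₃.fld 1 rfl, k₂.fld 1 rfl, k₁.fld 1 rfl, inputState]) r₃ ?_ ?_
      · intro K hK hor
        obtain ⟨c, hc0, hcdeg, hc⟩ := exists_small_relation hm hpos hmh hmin (K := K) (Q := Q)
          (fun k => p ^ k) (fun k hk => hpow k (by omega))
          (hor.imp (fun h => by omega) id)
        refine ⟨c, hc0, fun k => (hcdeg k).trans ?_, hc⟩
        rw [hH, mul_comm Q h]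
        exact Nat.mul_le_mul_right _ hK
      · intro K hK c hc hdvd
        refine eq_zero_of_X_pow_dvd hm hpos hmh hmin (Q := Q) (fun k => p ^ k)
          (fun k hk => hpow k (by omega)) c (fun k _ => hc k) ?_ hdvd
        -- With `δ ≤ d ≤ Q` the required bound `δ (H + h (Q + δ))` is at most `d (H + 2 h Q) = (d +
        -- 2) H`. This is the origin of the precision `σ`.
        refine lt_of_le_of_lt (Nat.mul_le_mul hmd (Nat.add_le_add_left (Nat.mul_le_mul_left h
          (Nat.add_le_add_left (hmd.trans hdQ) Q)) H)) ?_
        rw [hσ, Nat.lt_succ_iff]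
        have e : d * (H + h * (Q + Q)) = d * H + (d * (Q * h) + d * (Q * h)) := by ring
        rw [e, ← hH]
        linarith
    rintro s₄ k₄ ⟨K, c, hKd, h4, h1, hdeg, hmin⟩
    have h5 : s₄.nat 5 0 = H + 1 := by simp [k₄.nat 5 rfl, k₃.nat 5 rfl, r₂.2.2]
    have h12 : s₄.nat 12 0 = H := by simp [k₄.nat 12 rfl, k₃.nat 12 rfl, r₂.1]
    refine (runs_degreesProg h5 h12 (trailing_ne_zero_of_minimal hmin) (h1 0 (by omega)) (hdeg 0)).mono
      (fun s₅ k₅ r₅ => ⟨K, c, ?_⟩) le_rfl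
    exact {
      order_le := hKd
      nat_0 := by simp [k₅.nat 0 rfl, k₄.nat 0 rfl, k₃.nat 0 rfl, k₂.nat 0 rfl, k₁.nat 0 rfl,
        inputState]
      nat_2 := by simp [k₅.nat 2 rfl, k₄.nat 2 rfl, k₃.nat 2 rfl, k₂.nat 2 rfl, k₁.nat 2 rfl,
        inputState]
      nat_3 := by simp [k₅.nat 3 rfl, k₄.nat 3 rfl, k₃.nat 3 rfl, k₂.nat 3 rfl, k₁.nat 3 rfl,
        inputState]
      nat_4 := by simp [k₅.nat 4 rfl, h4]
      nat_5 := by simp [k₅.nat 5 rfl, h5]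
      nat_6 := r₅.1
      nat_7 := r₅.2
      nat_11 := by simpa [k₅.nat 11 rfl, k₄.nat 11 rfl, k₃.nat 11 rfl, k₂.nat 11 rfl] using r₁
      nat_12 := by simp [k₅.nat 12 rfl, h12]
      fld_1 := by simpa [k₅.fld 1 rfl] using h1
      fld_9 := by simpa [k₅.fld 9 rfl, k₄.fld 9 rfl] using r₃
      natDegree_le := hdeg
      minimal := hmin }
  · have h1 : d * (p * 20 + 40) ≤ d * (σ * 20 + 40) := Nat.mul_le_mul_left _ (by omega)
    have h2 : (d + 1) * (h * 60 + 200) ≤ (d + 1) * (σ * 60 + 200) := Nat.mul_le_mul_left _ (by omega)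
    have h3 : σ * (d * (σ * 50 + 100) + (d + 1) * (h * 60 + 200) + 100) ≤
        σ * (d * (σ * 50 + 100) + (d + 1) * (σ * 60 + 200) + 100) :=
      Nat.mul_le_mul_left _ (by omega)
    have hQσ := hQH.trans hHσ
    refine (Nat.add_le_add (Nat.add_le_add_right h1 20) (Nat.add_le_add
      (Nat.add_le_add_right (Nat.add_le_add_right (Nat.mul_le_mul_right 20 hQσ) _) _)
      (Nat.add_le_add (Nat.add_le_add_right h3 50) (Nat.add_le_add_left
        (Nat.add_le_add_right (Nat.mul_le_mul_right 80 hHσ) 150) _)))).trans ?_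
    ring_nf
    omega

end FieldRAM

/-! ### Sparse products and the coefficients of the monic equation -/

namespace MahlerMethod

variable {p : ℕ} [Fact p.Prime]

open Polynomial

/-- `f ^ p ^ k` is sparse, so a coefficient of the product costs `L` terms, independently of `p ^
k`. Vanishing of `f` is needed only at indices that can contribute, so `L = ⌊m / p^k⌋ + 1` is always
allowed. -/
theorem coeff_pow_prime_pow_mul {k L m : ℕ} {f : PowerSeries (ZMod p)}
    (hf : ∀ i, L ≤ i → p ^ k * i ≤ m → PowerSeries.coeff i f = 0) (g : PowerSeries (ZMod p)) :
    PowerSeries.coeff m (f ^ p ^ k * g) = ∑ i ∈ Finset.range L,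
      if p ^ k * i ≤ m then PowerSeries.coeff i f * PowerSeries.coeff (m - p ^ k * i) g else 0 := by
  have hp : 0 < p ^ k := pow_pos (Fact.out : p.Prime).pos _
  rw [PowerSeries.coeff_mul, Finset.Nat.sum_antidiagonal_eq_sum_range_succ_mk]
  have h : ∀ b ∈ Finset.range (m + 1),
      PowerSeries.coeff b (f ^ p ^ k) * PowerSeries.coeff (m - b) g =
        ∑ i ∈ Finset.range L, if p ^ k * i = b then
          PowerSeries.coeff i f * PowerSeries.coeff (m - p ^ k * i) g else 0 := fun b hb => by
    rw [FieldRAM.coeff_pow_prime_pow]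
    split_ifs with hd
    · obtain ⟨j, rfl⟩ := hd
      rw [Nat.mul_div_cancel_left _ hp]
      simp only [Nat.mul_right_inj hp.ne', Finset.sum_ite_eq', Finset.mem_range]
      split_ifs with hj
      · rfl
      · rw [hf j (not_lt.1 hj) (Nat.lt_succ_iff.1 (Finset.mem_range.1 hb)), zero_mul]
    · rw [zero_mul, Finset.sum_eq_zero]
      intro i _
      rw [if_neg fun h' => hd ⟨i, h'.symm⟩]
  rw [Finset.sum_congr rfl h, Finset.sum_comm]
  refine Finset.sum_congr rfl fun i _ => ?_
  simp

theorem coeff_coe_pow_mul {q : (ZMod p)[X]} {L : ℕ} (hq : q.natDegree < L) (k : ℕ)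
    (g : PowerSeries (ZMod p)) (m : ℕ) :
    PowerSeries.coeff m ((q : PowerSeries (ZMod p)) ^ p ^ k * g) =
      ∑ i ∈ Finset.range L,
        if p ^ k * i ≤ m then q.coeff i * PowerSeries.coeff (m - p ^ k * i) g else 0 := by
  rw [coeff_pow_prime_pow_mul (L := L) fun i hi _ => by
    rw [coeff_coe, coeff_eq_zero_of_natDegree_lt (by omega)]]
  simp only [coeff_coe]

theorem coeff_coe_mul {q : (ZMod p)[X]} {L : ℕ} (hq : q.natDegree < L)
    (g : PowerSeries (ZMod p)) (m : ℕ) :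
    PowerSeries.coeff m ((q : PowerSeries (ZMod p)) * g) =
      ∑ i ∈ Finset.range L, if i ≤ m then q.coeff i * PowerSeries.coeff (m - i) g else 0 := by
  simpa using coeff_coe_pow_mul hq 0 g m

/-- The coefficients of the equation with trailing coefficient `1`. -/
noncomputable def monicCoeff (c : ℕ → (ZMod p)[X]) (k : ℕ) : (ZMod p)[X] :=
  if k = 0 then 1 else c k * c 0 ^ (p ^ k - 2)

theorem two_le_prime_pow {k : ℕ} (hk : k ≠ 0) : 2 ≤ p ^ k :=
  (Fact.out : p.Prime).two_le.trans (Nat.le_self_pow hk p)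

/-- The form used for computing: `c_0^(p^k)` is just `c_0(x^(p^k))`, so dividing by `c_0^2` is
cheaper than forming the power with exponent `p^k - 2`. -/
theorem monicCoeff_mul_sq (c : ℕ → (ZMod p)[X]) {k : ℕ} (hk : k ≠ 0) :
    monicCoeff c k * c 0 ^ 2 = c k * c 0 ^ p ^ k := by
  rw [monicCoeff, if_neg hk, mul_assoc, ← pow_add, Nat.sub_add_cancel (two_le_prime_pow hk)]

theorem natDegree_monicCoeff_le {c : ℕ → (ZMod p)[X]} {H : ℕ} (hc : ∀ k, (c k).natDegree ≤ H)
    (k : ℕ) : (monicCoeff c k).natDegree ≤ H * (p ^ k - 1) := by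
  by_cases hk : k = 0
  · simp [monicCoeff, hk]
  · have h2 := two_le_prime_pow (p := p) hk
    rw [monicCoeff, if_neg hk]
    refine (natDegree_mul_le_of_le (hc k) (natDegree_pow_le_of_le _ (hc 0))).trans ?_
    rw [show p ^ k - 1 = 1 + (p ^ k - 2) by omega, mul_add, mul_one, mul_comm H]

end MahlerMethod

/-! ### The second program: the monic equation -/

namespace FieldRAM

variable {p : ℕ} [Fact p.Prime]

open Polynomial MahlerMethod

/-- The multiples of the entry `x` of the table of powers by the numbers up to `n`. -/
def strideProg (n x : NatExpr) : Prog :=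
  .seq (.setNat 31 0 0)
    (forUp 23 n (.setNat 31 (.var 23 + 1) (.load 31 (.var 23) + .load 11 x)))

theorem runs_strideProg {n x : NatExpr} {s : State p} {H e : ℕ} (hH : n.eval s = H)
    (hn : n.stable (strideProg n x) = true) (hx : x.stable (strideProg n x) = true)
    (he : s.nat 11 (x.eval s) = e) :
    Runs (strideProg n x) s (H * (x.cost + n.cost + 30) + n.cost + 20)
      fun s' => ∀ i ≤ H, s'.nat 31 i = e * i := by
  apply Runs.le
  · apply Runs.seq (R₁ := fun s' => s'.nat 31 0 = 0)
    · exact Runs.setNat (by simp) le_rfl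
    intro s₁ k₁ r₁
    refine Runs.forUp (N := H) (T := x.cost + 15) (fun i s' => ∀ j ≤ i, s'.nat 31 j = e * j)
      (by rw [← hH]; exact NatExpr.eval_eq_of_stable k₁.seq_left n hn)
      (NatExpr.stable_mono (fun a ha => by
        simp only [strideProg, Prog.writesNat, Bool.or_eq_false_iff] at ha
        exact ha.2) n hn) rfl (by simpa using r₁) ?_
    intro i hi s₂ k₂ hv I₂
    refine Runs.setNat ?_ (by simp; omega)
    have hx' : x.eval s₂ = x.eval s := NatExpr.eval_eq_of_stable
      (k₁.seq_left.trans (k₂.seq_right (P := .setNat 31 0 0))) x hx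
    intro j hj
    by_cases hji : j = i + 1
    · simp [hji, hv, I₂, hx', k₂.nat 11 rfl, k₁.nat 11 rfl, he]
      ring
    · simp [hji, hv, I₂ j (by omega)]
  · simp
    ring_nf
    omega

/-- The inverses of the trailing coefficient, without its power of the variable, and of its
square; the rows are those of the first, second and third power of exponent zero, one and two. -/
def inverseProg : Prog :=
  .seq (.setFld 15 0 0 1)
    (forUp 20 2
      (fillRow 15 21 (.var 20 + 1) (.var 30)
        (sumInto 10 22 (.var 12) (.natLt (.var 22) (.var 21))
          (.load 1 0 (.var 6 + .var 22 + 1) * .load 15 (.var 20 + 1) (.var 21 - .var 22 - 1)))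
        ((.load 15 (.var 20) (.var 21) - .load 10 0 0) / .load 1 0 (.var 6))))

/-- Row `r + 1` solves `q u^(r+1) = u^r` coefficient by coefficient, with `q` the unit part of
`c_0`. The same recurrence, run twice from the row of `1`, gives `u` and `u^2`. -/
theorem runs_inverseProg {s : State p} {H L v : ℕ} (h12 : s.nat 12 0 = H) (h30 : s.nat 30 0 = L)
    (h6 : s.nat 6 0 = v) (h15 : ∀ i j, s.fld 15 i j = 0) {c : (ZMod p)[X]}
    (h1 : ∀ j, s.fld 1 0 (v + j) = c.coeff j) (hc : c.natDegree ≤ H) (hc0 : c.coeff 0 ≠ 0)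
    {u : PowerSeries (ZMod p)} (hu : (c : PowerSeries (ZMod p)) * u = 1) :
    Runs inverseProg s (L * (H * 100 + 160) + 60) fun s' =>
      ∀ m < L, s'.fld 15 1 m = PowerSeries.coeff m u ∧ s'.fld 15 2 m = PowerSeries.coeff m (u ^ 2) := by
  apply Runs.le
  · apply Runs.seq (R₁ := fun s' => ∀ m, s'.fld 15 0 m = PowerSeries.coeff m (u ^ 0))
    · refine Runs.setFld ?_ le_rfl
      intro m
      simp [h15, PowerSeries.coeff_one]
    intro s₁ k₁ r₁
    refine Runs.mono (Runs.forUp (N := 2) (T := L * (H * 47 + 70) + 10)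
      (fun r s' => ∀ i ≤ r, ∀ m < L, s'.fld 15 i m = PowerSeries.coeff m (u ^ i)) (by simp) rfl rfl
      ?_ ?_) (fun s' _ h' m hm => ⟨by simpa using h' 1 (by omega) m hm, h' 2 le_rfl m hm⟩) le_rfl
    · intro i hi m hm
      obtain rfl : i = 0 := by omega
      simp only [State.setNat_fld, r₁]
    intro r hr s₂ k₂ hv₂ I₂
    have e1 : ∀ j, s₂.fld 1 0 (v + j) = c.coeff j := by simpa [k₂.fld 1 rfl, k₁.fld 1 rfl] using h1
    have e6 : s₂.nat 6 0 = v := by simp [k₂.nat 6 rfl, k₁.nat 6 rfl, h6]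
    refine (Runs.fillRow (N := L) (i₀ := r + 1) (T := H * 47 + 20)
      (fun m => PowerSeries.coeff m (u ^ (r + 1)))
      (by simp [k₂.nat 30 rfl, k₁.nat 30 rfl, h30]) (by simp [hv₂]) rfl rfl rfl rfl ?_).mono ?_
      (by simp; ring_nf; omega)
    · intro m hm s₃ k₃ hv₃ h₃
      refine (Runs.sumInto (N := H) (fun i => if i < m then c.coeff (i + 1) *
        PowerSeries.coeff (m - i - 1) (u ^ (r + 1)) else 0)
        (by simp [k₃.nat 12 rfl, k₂.nat 12 rfl, k₁.nat 12 rfl, h12]) rfl ?_).mono ?_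
        (by simp)
      · intro i hi s₄ k₄ hv₄
        simp only [Test.holds_natLt, NatExpr.eval_var, hv₄, k₄.nat 21 rfl, hv₃]
        refine if_ctx_congr Iff.rfl (fun him => ?_) fun _ => rfl
        simp [hv₄, k₄.nat 20 rfl, k₃.nat 20 rfl, hv₂, k₄.nat 21 rfl, hv₃, k₄.nat 6 rfl,
          k₃.nat 6 rfl, e6, add_assoc, k₄.fld 1 rfl, k₃.fld 1 rfl, e1, k₄.fld 15 rfl, h₃,
          show m - i - 1 < m by omega]
      · intro s₄ k₄ r₄
        have hm' : s₃.fld 15 r m = PowerSeries.coeff m (u ^ r) := by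
          rw [h₃, if_neg (by omega), I₂ r le_rfl m hm]
        have e1' : s₃.fld 1 0 v = c.coeff 0 := by simpa [k₃.fld 1 rfl] using e1 0
        have key : PowerSeries.coeff m (u ^ r) =
            ∑ i ∈ Finset.range H, (if i < m then c.coeff (i + 1) *
              PowerSeries.coeff (m - i - 1) (u ^ (r + 1)) else 0) +
            c.coeff 0 * PowerSeries.coeff m (u ^ (r + 1)) := by
          have h : (c : PowerSeries (ZMod p)) * u ^ (r + 1) = u ^ r := by
            rw [pow_succ', ← mul_assoc, hu, one_mul]
          rw [← h, coeff_coe_mul (Nat.lt_succ_of_le hc), Finset.sum_range_succ']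
          simp [Nat.sub_sub]
        simp only [FldExpr.eval_div, FldExpr.eval_sub, FldExpr.eval_load, NatExpr.eval_var,
          NatExpr.eval_zero, k₄.nat 20 rfl, k₃.nat 20 rfl, hv₂, k₄.nat 21 rfl, hv₃, k₄.nat 6 rfl,
          k₃.nat 6 rfl, e6, r₄, k₄.fld 15 rfl, k₄.fld 1 rfl, e1', hm', key]
        field_simp
        ring
    · intro s₃ k₃ h₃ i hi m hm
      rw [State.setNat_fld, h₃]
      by_cases hir : i = r + 1
      · rw [if_pos ⟨hir, hm⟩, hir]
      · rw [if_neg (by omega), I₂ i (by omega) m hm]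
  · simp
    ring_nf
    omega

/-- The second program computes the equation with trailing coefficient `1`. -/
def monicProg : Prog :=
  .seq (mulInto 10 22 (.load 11 (.var 2)) (.var 12))
    (.seq (.setNat 8 0 (.var 10 + 1))
      (.seq (.setNat 30 0 (.var 10 + .var 12 + .var 12 + 1))
        (.seq inverseProg
          (.seq (.setFld 2 0 0 1)
            (forUp 14 (.var 4)
              (.seq (strideProg (.var 12) (.var 14 + 1))
                (.seq
                  (fillRow 16 21 0 (.var 30)
                    (sumInto 10 22 (.var 5) (.neg (.natLt (.var 21) (.load 31 (.var 22))))
                      (.load 1 0 (.var 22) * .load 15 2 (.var 21 - .load 31 (.var 22))))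
                    (.load 10 0 0))
                  (fillRow 2 21 (.var 14 + 1) (.var 8)
                    (sumInto 10 22 (.var 5) (.neg (.natLt (.var 21 + .var 6 + .var 6) (.var 22)))
                      (.load 1 (.var 14 + 1) (.var 22) *
                        .load 16 0 (.var 21 + .var 6 + .var 6 - .var 22)))
                    (.load 10 0 0)))))))))

/-- The memory after the second program; `u` is the inverse of the trailing coefficient, without
its power of the variable. -/
structure HasMonicEquation (H M K : ℕ) (c : ℕ → (ZMod p)[X]) (u : PowerSeries (ZMod p))
    (s : State p) : Prop where
  nat_8 : s.nat 8 0 = M + 1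
  nat_10 : s.nat 10 0 = M
  fld_2 : ∀ k ≤ K, ∀ j, s.fld 2 k j = (monicCoeff c k).coeff j
  fld_15 : ∀ m ≤ H, s.fld 15 1 m = PowerSeries.coeff m u

theorem HasMonicEquation.of_keeps {H M K : ℕ} {c : ℕ → (ZMod p)[X]} {u : PowerSeries (ZMod p)}
    {s s' : State p} {P : Prog} (h : HasMonicEquation H M K c u s) (hs : Keeps P s s')
    (hn : ([8, 10].all fun a => !P.writesNat a) = true)
    (hf : ([2, 15].all fun a => !P.writesFld a) = true) : HasMonicEquation H M K c u s' := by
  simp only [List.all_cons, List.all_nil, Bool.and_true, Bool.and_eq_true,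
    Bool.not_eq_true'] at hn hf
  exact {
    nat_8 := by rw [hs.nat 8 hn.1, h.nat_8]
    nat_10 := by rw [hs.nat 10 hn.2, h.nat_10]
    fld_2 := by simpa [hs.fld 2 hf.1] using h.fld_2
    fld_15 := by simpa [hs.fld 15 hf.2] using h.fld_15 }

/-- With `c_0 = x^v q` and `q u = 1`, the product `c_k c_0(x^(p^k)) u^2` equals `x^(2v) c'_k`. Hence
`c'_k` is read off after a shift by `2 v ≤ 2 H`, which is why `u^2` is needed to precision `M + 2 H
+ 1`. Each coefficient costs a number of operations linear in `H`. -/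
theorem runs_monicProg {d N H σ Q M : ℕ} {f : PowerSeries (ZMod p)} {K : ℕ}
    {c : ℕ → (ZMod p)[X]} {s : State p} (h : HasMahlerEquation d N H σ f K c s) (hQ : Q = p ^ d)
    (hM : M = H * Q) (h2 : ∀ i j, s.fld 2 i j = 0) (h15 : ∀ i j, s.fld 15 i j = 0)
    {q : (ZMod p)[X]} (hq : c 0 = X ^ (c 0).natTrailingDegree * q) (hq0 : q.coeff 0 ≠ 0)
    {u : PowerSeries (ZMod p)} (hu : (q : PowerSeries (ZMod p)) * u = 1) :
    Runs monicProg s ((d + 1) * ((M + 2 * H + 2) * (H * 500 + 1000)) + Q * 20) fun s' =>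
      HasMonicEquation H M K c u s' := by
  set v := (c 0).natTrailingDegree with hv
  have hqc : ∀ j, (c 0).coeff (v + j) = q.coeff j := fun j => by
    rw [hq, coeff_X_pow_mul', if_pos (Nat.le_add_right v j), Nat.add_sub_cancel_left]
  have hqdeg : q.natDegree ≤ H := natDegree_le_iff_coeff_eq_zero.2 fun m hm => by
    rw [← hqc, coeff_eq_zero_of_natDegree_lt]
    have := h.natDegree_le 0
    omega
  have hvH : v ≤ H := (natTrailingDegree_le_natDegree _).trans (h.natDegree_le 0)
  have hMle : ∀ k ≤ d, (monicCoeff c k).natDegree ≤ M := fun k hk => by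
    refine (natDegree_monicCoeff_le h.natDegree_le k).trans ?_
    rw [hM, hQ]
    refine Nat.mul_le_mul_left _ ((Nat.sub_le _ _).trans ?_)
    exact Nat.pow_le_pow_right (Fact.out : p.Prime).pos hk
  apply Runs.le
  · apply Runs.seq
    · exact Runs.mulInto (N := Q) (M := H) (by simp [h.nat_2, h.nat_11, hQ]) (by simp [h.nat_12])
        (by simp) rfl rfl
    intro s₁ k₁ r₁
    rw [mul_comm, ← hM] at r₁
    have H₁ := h.of_keeps k₁ rfl rfl
    apply Runs.seq (R₁ := fun s' => s'.nat 8 0 = M + 1)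
    · exact Runs.setNat (by simp [r₁]) le_rfl
    intro s₂ k₂ r₂
    have H₂ := H₁.of_keeps k₂ rfl rfl
    apply Runs.seq (R₁ := fun s' => s'.nat 30 0 = M + H + H + 1)
    · exact Runs.setNat (by simp [k₂.nat 10 rfl, r₁, H₂.nat_12]) le_rfl
    intro s₃ k₃ r₃
    have H₃ := H₂.of_keeps k₃ rfl rfl
    apply Runs.seq
    · refine runs_inverseProg H₃.nat_12 r₃ H₃.nat_6 ?_ (c := q) (fun j => ?_) hqdeg hq0 hu
      · simpa [k₃.fld 15 rfl, k₂.fld 15 rfl, k₁.fld 15 rfl] using h15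
      · rw [H₃.fld_1 0 (Nat.zero_le _), hqc]
    intro s₄ k₄ r₄
    have H₄ := H₃.of_keeps k₄ rfl rfl
    have h2₄ : ∀ i j, s₄.fld 2 i j = 0 := by
      simpa [k₄.fld 2 rfl, k₃.fld 2 rfl, k₂.fld 2 rfl, k₁.fld 2 rfl] using h2
    have e30 : s₄.nat 30 0 = M + H + H + 1 := by simp [k₄.nat 30 rfl, r₃]
    have e8 : s₄.nat 8 0 = M + 1 := by simp [k₄.nat 8 rfl, k₃.nat 8 rfl, r₂]
    have e10 : s₄.nat 10 0 = M := by simp [k₄.nat 10 rfl, k₃.nat 10 rfl, k₂.nat 10 rfl, r₁]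
    apply Runs.seq (R₁ := fun s' => ∀ i j, s'.fld 2 i j =
        if i < 1 then (monicCoeff c i).coeff j else 0)
    · refine Runs.setFld (fun i j => ?_) le_rfl
      rcases Nat.eq_zero_or_pos i with rfl | hi
      · by_cases hj : j = 0
        · simp [hj, monicCoeff]
        · simp [hj, h2₄, monicCoeff, coeff_one]
      · simp [hi.ne', h2₄]
    intro s₅ k₅ r₅
    refine Runs.mono (Runs.forUp (N := K) (T := (M + 2 * H + 2) * (H * 140 + 300)) (fun k s' =>
        ∀ i j, s'.fld 2 i j = if i < k + 1 then (monicCoeff c i).coeff j else 0)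
        (by simp [k₅.nat 4 rfl, H₄.nat_4]) rfl rfl (by simpa using r₅) ?_) ?_ le_rfl
    · intro k hk s₆ k₆ hv₆ I₆
      have hkd : k + 1 ≤ d := by
        have := h.order_le
        omega
      have H₆ := (H₄.of_keeps k₅ rfl rfl).of_keeps k₆ rfl rfl
      have r15 : ∀ m < M + H + H + 1, s₆.fld 15 2 m = PowerSeries.coeff m (u ^ 2) := fun m hm => by
        rw [k₆.fld 15 rfl, k₅.fld 15 rfl, (r₄ m hm).2]
      apply Runs.le
      · apply Runs.seq
        · exact runs_strideProg (H := H) (e := p ^ (k + 1)) H₆.nat_12 rfl rfl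
            (by simp [hv₆, H₆.nat_11 _ hkd])
        intro s₇ k₇ r₇
        have H₇ := H₆.of_keeps k₇ rfl rfl
        apply Runs.seq
        · refine Runs.fillRow (N := M + H + H + 1) (i₀ := 0) (T := (H + 1) * 40 + 20)
            (fun m => PowerSeries.coeff m ((c 0 : PowerSeries (ZMod p)) ^ p ^ (k + 1) * u ^ 2))
            (by simp [k₇.nat 30 rfl, k₆.nat 30 rfl, k₅.nat 30 rfl, e30]) (by simp) rfl rfl rfl rfl ?_
          intro m hm s₈ k₈ hv₈ h₈
          have H₈ := H₇.of_keeps k₈ rfl rfl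
          refine (Runs.sumInto (N := H + 1) (fun i => if p ^ (k + 1) * i ≤ m then (c 0).coeff i *
            PowerSeries.coeff (m - p ^ (k + 1) * i) (u ^ 2) else 0) (by simp [H₈.nat_5]) rfl
            ?_).mono (fun s₉ k₉ r₉ => ?_) (by simp)
          · intro i hi s₉ k₉ hv₉
            have H₉ := H₈.of_keeps k₉ rfl rfl
            have e31 : s₉.nat 31 i = p ^ (k + 1) * i := by
              rw [k₉.nat 31 rfl, k₈.nat 31 rfl, r₇ i (by omega)]
            simp only [Test.holds_neg, Test.holds_natLt, NatExpr.eval_var, NatExpr.eval_load, hv₉,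
              e31, k₉.nat 21 rfl, hv₈, not_lt]
            refine if_ctx_congr Iff.rfl (fun him => ?_) fun _ => rfl
            simp [hv₉, H₉.fld_1, e31, k₉.nat 21 rfl, hv₈, k₉.fld 15 rfl, k₈.fld 15 rfl,
              k₇.fld 15 rfl]
            left
            exact r15 _ (by omega)
          · rw [coeff_coe_pow_mul (Nat.lt_succ_of_le (h.natDegree_le 0))]
            simpa using r₉
        intro s₈ k₈ r₈
        have H₈ := H₇.of_keeps k₈ rfl rfl
        refine (Runs.fillRow (N := M + 1) (i₀ := k + 1) (T := (H + 1) * 53 + 20)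
            (fun m => (monicCoeff c (k + 1)).coeff m)
            (by simp [k₈.nat 8 rfl, k₇.nat 8 rfl, k₆.nat 8 rfl, k₅.nat 8 rfl, e8])
            (by simp [k₈.nat 14 rfl, k₇.nat 14 rfl, hv₆]) rfl rfl rfl rfl ?_).mono ?_ le_rfl
        · intro m hm s₉ k₉ hv₉ h₉
          have H₉ := H₈.of_keeps k₉ rfl rfl
          refine (Runs.sumInto (N := H + 1) (fun i => if i ≤ m + v + v then (c (k + 1)).coeff i *
            PowerSeries.coeff (m + v + v - i)
              ((c 0 : PowerSeries (ZMod p)) ^ p ^ (k + 1) * u ^ 2) else 0)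
            (by simp [H₉.nat_5]) rfl ?_).mono (fun s₀ k₀ r₀ => ?_) (by simp)
          · intro i hi s₀ k₀ hv₀
            have H₀ := H₉.of_keeps k₀ rfl rfl
            simp only [Test.holds_neg, Test.holds_natLt, NatExpr.eval_var, NatExpr.eval_add, hv₀,
              H₀.nat_6, ← hv, k₀.nat 21 rfl, hv₉, not_lt]
            refine if_ctx_congr Iff.rfl (fun him => ?_) fun _ => rfl
            simp [hv₀, H₀.nat_6, ← hv, k₀.nat 21 rfl, hv₉, k₀.nat 14 rfl, k₉.nat 14 rfl,
              k₈.nat 14 rfl, k₇.nat 14 rfl, hv₆, H₀.fld_1 (k + 1) (by omega), k₀.fld 16 rfl,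
              k₉.fld 16 rfl]
            left
            rw [r₈, if_pos ⟨rfl, by omega⟩]
          · rw [← coeff_coe_mul (Nat.lt_succ_of_le (h.natDegree_le _))] at r₀
            -- The two factors `u` cancel against `c_0^2 = x^(2v) q^2` in `c'_k c_0^2 = c_k
            -- c_0^(p^k)`.
            have e : (c (k + 1) : PowerSeries (ZMod p)) *
                ((c 0 : PowerSeries (ZMod p)) ^ p ^ (k + 1) * u ^ 2) =
                PowerSeries.X ^ (v + v) * (monicCoeff c (k + 1) : PowerSeries (ZMod p)) := by
              have e1 : ((c (k + 1) * c 0 ^ p ^ (k + 1) : (ZMod p)[X]) : PowerSeries (ZMod p)) *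
                  u ^ 2 = (monicCoeff c (k + 1) : PowerSeries (ZMod p)) *
                    ((c 0 : (ZMod p)[X]) : PowerSeries (ZMod p)) ^ 2 * u ^ 2 := by
                rw [← monicCoeff_mul_sq c (Nat.succ_ne_zero k), coe_mul, coe_pow]
              have e2 : ((c 0 : (ZMod p)[X]) : PowerSeries (ZMod p)) * u = PowerSeries.X ^ v := by
                rw [hq, coe_mul, mul_assoc, hu, mul_one, coe_pow, coe_X]
              rw [coe_mul, coe_pow] at e1
              rw [← mul_assoc, e1, mul_assoc, ← mul_pow, e2, mul_comm, ← pow_mul, mul_two]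
            rw [e, add_assoc, PowerSeries.coeff_X_pow_mul', if_pos (by omega),
              Nat.add_sub_cancel_right, coeff_coe] at r₀
            simpa using r₀
        · intro s₉ k₉ h₉ i j
          rw [State.setNat_fld, h₉, k₈.fld 2 rfl, k₇.fld 2 rfl, I₆]
          by_cases hi : i = k + 1
          · by_cases hj : j < M + 1
            · rw [if_pos ⟨hi, hj⟩, if_pos (by omega), hi]
            · rw [if_neg (by omega), if_neg (by omega), if_pos (by omega), hi,
                coeff_eq_zero_of_natDegree_lt]
              have := hMle (k + 1) hkd
              omega
          · rw [if_neg (by omega)]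
            exact if_congr (by omega) rfl rfl
      · simp
        ring_nf
        omega
    · intro s₆ k₆ h₆
      exact {
        nat_8 := by simp [k₆.nat 8 rfl, k₅.nat 8 rfl, e8]
        nat_10 := by simp [k₆.nat 10 rfl, k₅.nat 10 rfl, e10]
        fld_2 := fun k hk j => by rw [h₆, if_pos (by omega)]
        fld_15 := fun m hm => by rw [k₆.fld 15 rfl, k₅.fld 15 rfl, (r₄ m (by omega)).1] }
  · obtain ⟨w, rfl⟩ := Nat.exists_eq_add_of_le h.order_le
    simp
    ring_nf
    omega

end FieldRAM

/-! ### The quotient by the trailing coefficient, its negative and nonnegative parts -/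

namespace MahlerMethod

variable {p : ℕ} [Fact p.Prime]

open Polynomial

instance : CharP (LaurentSeries (ZMod p)) p :=
  charP_of_injective_ringHom (HahnSeries.C_injective (Γ := ℤ) (R := ZMod p)) p

theorem mahlerOp_add (K : ℕ) (c : ℕ → (ZMod p)[X]) (a b : LaurentSeries (ZMod p)) :
    mahlerOp K c (a + b) = mahlerOp K c a + mahlerOp K c b := by
  simp only [mahlerOp_eq, add_pow_char_pow, mul_add, Finset.sum_add_distrib]

theorem mahlerOp_congr {K : ℕ} {c c' : ℕ → (ZMod p)[X]} (h : ∀ k ≤ K, c k = c' k)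
    (a : LaurentSeries (ZMod p)) : mahlerOp K c a = mahlerOp K c' a :=
  Finset.sum_congr rfl fun k hk => by rw [h k (Nat.lt_succ_iff.1 (Finset.mem_range.1 hk))]

theorem polyToLaurent_ne_zero {q : (ZMod p)[X]} (hq : q ≠ 0) : polyToLaurent q ≠ 0 := by
  rw [polyToLaurent, Ne, map_eq_zero_iff _ HahnSeries.ofPowerSeries_injective]
  simpa using hq

/-- Multiplication by `c_0^2` turns the `k`-th term into `c_k (c_0 g)^(p^k) = c_k f^(p^k)`. -/
theorem mahlerOp_monicCoeff_eq_zero {K : ℕ} {c : ℕ → (ZMod p)[X]} {f : PowerSeries (ZMod p)}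
    (hc : c 0 ≠ 0) (h : mahlerOp K c (HahnSeries.ofPowerSeries ℤ (ZMod p) f) = 0) :
    mahlerOp K (monicCoeff c)
      (HahnSeries.ofPowerSeries ℤ (ZMod p) f / polyToLaurent (c 0)) = 0 := by
  have hL := polyToLaurent_ne_zero hc
  have hmul : ∀ a b : (ZMod p)[X], polyToLaurent (a * b) = polyToLaurent a * polyToLaurent b :=
    fun a b => by simp [polyToLaurent]
  have hpow : ∀ (a : (ZMod p)[X]) (n : ℕ), polyToLaurent (a ^ n) = polyToLaurent a ^ n :=
    fun a n => by simp [polyToLaurent]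
  rw [mahlerOp_eq] at h ⊢
  refine (mul_eq_zero.1 (?_ : polyToLaurent (c 0) ^ 2 * _ = 0)).resolve_left (pow_ne_zero 2 hL)
  rw [← h, Finset.mul_sum]
  refine Finset.sum_congr rfl fun k _ => ?_
  by_cases hk : k = 0
  · subst hk
    rw [monicCoeff, if_pos rfl]
    have : polyToLaurent (1 : (ZMod p)[X]) = 1 := by simp [polyToLaurent]
    rw [this, pow_zero, pow_one, pow_one]
    field_simp
  · have e := congrArg polyToLaurent (monicCoeff_mul_sq c hk)
    rw [hmul, hmul, hpow, hpow] at e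
    rw [← mul_assoc, mul_comm (_ ^ 2), e, div_pow]
    field_simp

theorem coeff_negPart (g : LaurentSeries (ZMod p)) (n : ℤ) :
    (negPart g).coeff n = if n < 0 then g.coeff n else 0 := by
  rw [negPart, HahnSeries.coeff_sub]
  rcases lt_or_ge n 0 with h | h
  · have := PowerSeries.coeff_coe (nonnegPart g) n
    rw [if_pos h] at this
    rw [if_pos h, this, sub_zero]
  · obtain ⟨m, rfl⟩ := Int.eq_ofNat_of_zero_le h
    rw [if_neg (by omega), HahnSeries.ofPowerSeries_apply_coeff, nonnegPart, PowerSeries.coeff_mk,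
      sub_self]

/-- The quotient is `x^(-v) f u`, as `u` inverts the unit part of `c`. -/
theorem coeff_quotient {c q : (ZMod p)[X]} {v : ℕ} (hc : c ≠ 0) (hq : c = X ^ v * q)
    {f u : PowerSeries (ZMod p)} (hu : (q : PowerSeries (ZMod p)) * u = 1) (n : ℤ) :
    (HahnSeries.ofPowerSeries ℤ (ZMod p) f / polyToLaurent c).coeff n =
      if n + v < 0 then 0 else PowerSeries.coeff (n + v).natAbs (f * u) := by
  have e : HahnSeries.ofPowerSeries ℤ (ZMod p) f / polyToLaurent c =
      HahnSeries.single (-(v : ℤ)) 1 * HahnSeries.ofPowerSeries ℤ (ZMod p) (f * u) := by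
    rw [div_eq_iff (polyToLaurent_ne_zero hc), hq, polyToLaurent, coe_mul, coe_pow, coe_X,
      map_mul _ (PowerSeries.X ^ v), HahnSeries.ofPowerSeries_X_pow]
    have h1 : HahnSeries.single (-(v : ℤ)) (1 : ZMod p) * HahnSeries.single (v : ℤ) 1 = 1 := by
      rw [HahnSeries.single_mul_single]
      simp
    have h2 : HahnSeries.ofPowerSeries ℤ (ZMod p) (f * u) *
        HahnSeries.ofPowerSeries ℤ (ZMod p) (q : PowerSeries (ZMod p)) =
          HahnSeries.ofPowerSeries ℤ (ZMod p) f := by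
      rw [← map_mul, mul_assoc, mul_comm u, hu, mul_one]
    rw [← h2]
    linear_combination (-HahnSeries.ofPowerSeries ℤ (ZMod p) (f * u) *
        HahnSeries.ofPowerSeries ℤ (ZMod p) (q : PowerSeries (ZMod p))) * h1
  have h3 := HahnSeries.coeff_single_mul_add (r := (1 : ZMod p))
    (x := HahnSeries.ofPowerSeries ℤ (ZMod p) (f * u)) (a := n + v) (b := -(v : ℤ))
  rw [one_mul] at h3
  rw [e, ← PowerSeries.coeff_coe, ← h3]
  congr 1
  ring

theorem negPart_eq_sum {g : LaurentSeries (ZMod p)} {v : ℕ} {w : ℕ → ZMod p}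
    (h : ∀ j : ℕ, g.coeff (-((j : ℤ) + 1)) = if j < v then w j else 0) :
    negPart g = ∑ j ∈ Finset.range v, HahnSeries.single (-((j : ℤ) + 1)) (w j) := by
  ext n
  rw [coeff_negPart, HahnSeries.coeff_sum]
  rcases lt_or_ge n 0 with hn | hn
  · obtain ⟨j, rfl⟩ : ∃ j : ℕ, n = -((j : ℤ) + 1) := ⟨(-n - 1).toNat, by omega⟩
    rw [if_pos hn, h]
    have : ∀ i ∈ Finset.range v, (HahnSeries.single (-((i : ℤ) + 1)) (w i)).coeff (-((j : ℤ) + 1))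
        = if i = j then w j else 0 := fun i _ => by
      rw [HahnSeries.coeff_single]
      by_cases hij : i = j
      · rw [if_pos (by rw [hij]), if_pos hij, hij]
      · rw [if_neg (by omega), if_neg hij]
    rw [Finset.sum_congr rfl this, Finset.sum_ite_eq']
    simp
  · rw [if_neg (by omega), Finset.sum_eq_zero]
    intro i _
    rw [HahnSeries.coeff_single, if_neg (by omega)]

/-- A `p^k`-th power is additive and fixes the scalars `w j`; it sends `x^(-(j+1))` to `x^(-p^k
(j+1))`, and multiplying by `c_k` shifts its coefficients. -/
theorem coeff_mahlerOp_sum_single (K v : ℕ) (c : ℕ → (ZMod p)[X]) (w : ℕ → ZMod p) (n : ℕ) :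
    (mahlerOp K c (∑ j ∈ Finset.range v, HahnSeries.single (-((j : ℤ) + 1)) (w j))).coeff n =
      ∑ k ∈ Finset.range (K + 1), ∑ j ∈ Finset.range v,
        w j * (c k).coeff (n + p ^ k * (j + 1)) := by
  rw [mahlerOp_eq, HahnSeries.coeff_sum]
  refine Finset.sum_congr rfl fun k _ => ?_
  rw [sum_pow_char_pow, Finset.mul_sum, HahnSeries.coeff_sum]
  refine Finset.sum_congr rfl fun j _ => ?_
  rw [HahnSeries.single_pow, ZMod.pow_card_pow]
  have h := HahnSeries.coeff_mul_single_add (r := w j) (x := polyToLaurent (c k))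
    (a := ((n + p ^ k * (j + 1) : ℕ) : ℤ)) (b := p ^ k • (-((j : ℤ) + 1)))
  rw [polyToLaurent, HahnSeries.ofPowerSeries_apply_coeff, coeff_coe] at h
  rw [mul_comm (w j), ← h]
  congr 1
  push_cast
  rw [nsmul_eq_mul]
  push_cast
  ring

/-- By additivity the operator maps `η` to minus the image of the negative part. That image is a
power series, because it comes from `η`, so taking nonnegative parts loses nothing. -/
theorem mahlerOp_nonnegPart {K : ℕ} {c : ℕ → (ZMod p)[X]} {g : LaurentSeries (ZMod p)}
    (h : mahlerOp K c g = 0) {b : (ZMod p)[X]}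
    (hb : (b : PowerSeries (ZMod p)) = nonnegPart (-(mahlerOp K c (negPart g)))) :
    mahlerOp K c (HahnSeries.ofPowerSeries ℤ (ZMod p) (nonnegPart g)) = polyToLaurent b ∧
    ∑ k ∈ Finset.range (K + 1), (c k : PowerSeries (ZMod p)) * nonnegPart g ^ p ^ k = b := by
  have e : mahlerOp K c (HahnSeries.ofPowerSeries ℤ (ZMod p) (nonnegPart g)) =
      -(mahlerOp K c (negPart g)) := by
    rw [eq_neg_iff_add_eq_zero, ← mahlerOp_add, negPart, add_sub_cancel, h]
  have hn : ∀ w : PowerSeries (ZMod p),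
      nonnegPart (HahnSeries.ofPowerSeries ℤ (ZMod p) w) = w := fun w => by
    ext n
    rw [nonnegPart, PowerSeries.coeff_mk, HahnSeries.ofPowerSeries_apply_coeff]
  rw [← e, mahlerOp_ofPowerSeries, hn] at hb
  exact ⟨by rw [mahlerOp_ofPowerSeries, ← hb, polyToLaurent], hb.symm⟩

theorem coeff_eq_sum_coeff_quotient {c : (ZMod p)[X]} {f : PowerSeries (ZMod p)} (hc : c ≠ 0)
    (N : ℕ) : PowerSeries.coeff N f = ∑ i ∈ Finset.Icc c.natTrailingDegree c.natDegree,
      c.coeff i * (HahnSeries.ofPowerSeries ℤ (ZMod p) f / polyToLaurent c).coeff ((N : ℤ) - i) := by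
  set g := HahnSeries.ofPowerSeries ℤ (ZMod p) f / polyToLaurent c with hg
  have h1 : HahnSeries.ofPowerSeries ℤ (ZMod p) f = polyToLaurent c * g := by
    rw [hg, mul_div_cancel₀ _ (polyToLaurent_ne_zero hc)]
  have h2 : polyToLaurent c =
      ∑ i ∈ Finset.Icc c.natTrailingDegree c.natDegree, HahnSeries.single (i : ℤ) (c.coeff i) := by
    ext n
    rw [HahnSeries.coeff_sum]
    simp only [HahnSeries.coeff_single]
    rcases lt_or_ge n 0 with hn | hn
    · have := PowerSeries.coeff_coe (c : PowerSeries (ZMod p)) n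
      rw [if_pos hn] at this
      rw [polyToLaurent, this, Finset.sum_eq_zero]
      intro i _
      rw [if_neg (by omega)]
    · obtain ⟨m, rfl⟩ := Int.eq_ofNat_of_zero_le hn
      rw [polyToLaurent, HahnSeries.ofPowerSeries_apply_coeff, coeff_coe]
      simp only [Nat.cast_inj, Finset.sum_ite_eq, Finset.mem_Icc]
      split_ifs with hm
      · rfl
      · by_contra hne
        exact hm ⟨natTrailingDegree_le_of_ne_zero hne, le_natDegree_of_ne_zero hne⟩
  rw [← HahnSeries.ofPowerSeries_apply_coeff (Γ := ℤ) (R := ZMod p), h1, h2, Finset.sum_mul,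
    HahnSeries.coeff_sum]
  refine Finset.sum_congr rfl fun i _ => ?_
  rw [← HahnSeries.coeff_single_mul_add]
  congr 1
  simp

end MahlerMethod

/-! ### The third, fourth and fifth programs: initial data, right-hand side, linear representation
-/

namespace FieldRAM

variable {p : ℕ} [Fact p.Prime]

open Polynomial MahlerMethod

/-- The third program computes the initial segment of the root and the negative part of its
quotient by the trailing coefficient. -/
def negPartProg : Prog :=
  .seq (fillRow 17 21 0 (.var 6 + 1)
      (sumInto 10 22 (.var 21 + 1) (.natEq 0 0) (.load 9 1 (.var 22) * .load 15 1 (.var 21 - .var 22)))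
      (.load 10 0 0))
    (.seq (fillRow 3 21 0 (.var 6) .skip (.load 9 1 (.var 21)))
      (fillRow 3 21 1 (.var 6) .skip (.load 17 0 (.var 6 - 1 - .var 21))))

/-- As `g = x^(-v) f u`, the coefficients of `f u` below `v`, in reverse order, are the negative
part. Entry `v` is the constant term of `η`, kept in array `17` for the fifth program. -/
theorem runs_negPartProg {d N H σ M : ℕ} {f : PowerSeries (ZMod p)} {K : ℕ}
    {c : ℕ → (ZMod p)[X]} {u : PowerSeries (ZMod p)} {s : State p}
    (h : HasMahlerEquation d N H σ f K c s) (hm : HasMonicEquation H M K c u s) (hHσ : H < σ)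
    (h3 : ∀ i j, s.fld 3 i j = 0) {v : ℕ} (hv : v = (c 0).natTrailingDegree) :
    Runs negPartProg s ((H + 1) * ((H + 1) * 40 + 100) + 100) fun s' =>
      (∀ j, s'.fld 3 0 j = if j < v then PowerSeries.coeff j f else 0) ∧
      (∀ j, s'.fld 3 1 j = if j < v then PowerSeries.coeff (v - 1 - j) (f * u) else 0) ∧
      s'.fld 17 0 v = PowerSeries.coeff v (f * u) := by
  have hvH : v ≤ H := hv ▸ (natTrailingDegree_le_natDegree _).trans (h.natDegree_le 0)
  have h6 := h.nat_6
  rw [← hv] at h6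
  apply Runs.le
  · apply Runs.seq
    · refine Runs.fillRow (N := v + 1) (i₀ := 0) (T := (v + 1) * 38 + 20)
        (fun m => PowerSeries.coeff m (f * u)) (by simp [h6]) (by simp) rfl rfl rfl rfl ?_
      intro m hmv s₁ k₁ hv₁ _
      refine (Runs.sumInto (N := m + 1) (fun i => PowerSeries.coeff i f *
        PowerSeries.coeff (m - i) u) (by simp [hv₁]) rfl ?_).mono (fun s₂ k₂ r₂ => ?_)
        (by simp; omega)
      · intro i hi s₂ k₂ hv₂
        simp [k₂.fld 9 rfl, k₁.fld 9 rfl, k₂.fld 15 rfl, k₁.fld 15 rfl, hv₂, k₂.nat 21 rfl, hv₁,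
          h.fld_9 i (by omega), hm.fld_15 (m - i) (by omega)]
      · rw [PowerSeries.coeff_mul, Finset.Nat.sum_antidiagonal_eq_sum_range_succ_mk]
        simpa using r₂
    intro s₁ k₁ r₁
    apply Runs.seq
    · refine Runs.fillRow (N := v) (i₀ := 0) (T := 1)
        (fun m => PowerSeries.coeff m f) (by simp [k₁.nat 6 rfl, h6]) (by simp) rfl rfl rfl rfl ?_
      intro m hmv s₂ k₂ hv₂ _
      refine Runs.skip ?_ le_rfl
      simp [k₂.fld 9 rfl, k₁.fld 9 rfl, hv₂, h.fld_9 m (by omega)]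
    intro s₂ k₂ r₂
    refine (Runs.fillRow (N := v) (i₀ := 1) (T := 1)
        (fun m => PowerSeries.coeff (v - 1 - m) (f * u)) (by simp [k₂.nat 6 rfl, k₁.nat 6 rfl, h6])
        (by simp) rfl rfl rfl rfl ?_).mono (fun s₃ k₃ r₃ => ?_) le_rfl
    · intro m hmv s₃ k₃ hv₃ _
      refine Runs.skip ?_ le_rfl
      simp [k₃.fld 17 rfl, k₂.fld 17 rfl, hv₃, k₃.nat 6 rfl, k₂.nat 6 rfl, k₁.nat 6 rfl, h6, r₁,
        show v - 1 - m < v + 1 by omega]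
    · refine ⟨fun j => ?_, fun j => ?_, ?_⟩
      · simp [r₃, r₂, k₁.fld 3 rfl, h3]
      · simp [r₃, r₂, k₁.fld 3 rfl, h3]
      · simp [k₃.fld 17 rfl, k₂.fld 17 rfl, r₁]
  · obtain ⟨w, rfl⟩ := Nat.exists_eq_add_of_le hvH
    simp
    ring_nf
    omega

/-- The fourth program computes the right-hand side of the inhomogeneous equation. -/
def rhsProg : Prog :=
  .seq (.setNat 9 0 (.var 8))
    (forUp 20 (.var 4 + 1)
      (.seq (strideProg (.var 12) (.var 20))
        (fillRow 4 21 0 (.var 8)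
          (sumInto 10 22 (.var 6) (.natEq 0 0)
            (.load 3 1 (.var 22) * .load 2 (.var 20) (.var 21 + .load 31 (.var 22 + 1))))
          (.load 4 0 (.var 21) - .load 10 0 0))))

theorem runs_rhsProg {d N H σ M : ℕ} {f : PowerSeries (ZMod p)} {K : ℕ}
    {c : ℕ → (ZMod p)[X]} {u : PowerSeries (ZMod p)} {s : State p}
    (h : HasMahlerEquation d N H σ f K c s) (hm : HasMonicEquation H M K c u s)
    (h4 : ∀ i j, s.fld 4 i j = 0) {v : ℕ} (hv : v = (c 0).natTrailingDegree) {w : ℕ → ZMod p}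
    (h3 : ∀ j < v, s.fld 3 1 j = w j) :
    Runs rhsProg s ((d + 1) * ((M + 1) * (H * 60 + 100) + H * 50 + 100) + 20) fun s' =>
      s'.nat 9 0 = M + 1 ∧ ∀ n, s'.fld 4 0 n = if n < M + 1 then
        -∑ k ∈ Finset.range (K + 1), ∑ j ∈ Finset.range v,
          w j * (monicCoeff c k).coeff (n + p ^ k * (j + 1)) else 0 := by
  have hvH : v ≤ H := hv ▸ (natTrailingDegree_le_natDegree _).trans (h.natDegree_le 0)
  have h6 := h.nat_6
  rw [← hv] at h6
  apply Runs.le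
  · apply Runs.seq (R₁ := fun s' => s'.nat 9 0 = M + 1)
    · exact Runs.setNat (by simp [hm.nat_8]) le_rfl
    intro s₁ k₁ r₁
    refine (Runs.forUp (N := K + 1) (T := (M + 1) * (v * 39 + 60) + H * 50 + 60)
      (fun k₀ s' => ∀ n, s'.fld 4 0 n = if n < M + 1 then
        -∑ k ∈ Finset.range k₀, ∑ j ∈ Finset.range v,
          w j * (monicCoeff c k).coeff (n + p ^ k * (j + 1)) else 0)
      (by simp [k₁.nat 4 rfl, h.nat_4]) rfl rfl (by simp [k₁.fld 4 rfl, h4]) ?_).mono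
      (fun s₂ k₂ r₂ => ⟨by simp [k₂.nat 9 rfl, r₁], r₂⟩) le_rfl
    intro k hk s₂ k₂ hv₂ I₂
    have H₂ := (h.of_keeps k₁ rfl rfl).of_keeps k₂ rfl rfl
    have M₂ := (hm.of_keeps k₁ rfl rfl).of_keeps k₂ rfl rfl
    have hkd := h.order_le
    apply Runs.le
    · apply Runs.seq
      · exact runs_strideProg (H := H) (e := p ^ k) H₂.nat_12 rfl rfl
          (by simp [hv₂, H₂.nat_11 k (by omega)])
      intro s₃ k₃ r₃
      have H₃ := H₂.of_keeps k₃ rfl rfl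
      have M₃ := M₂.of_keeps k₃ rfl rfl
      refine (Runs.fillRow (N := M + 1) (i₀ := 0) (T := v * 39 + 20) (fun n =>
        -∑ k ∈ Finset.range (k + 1), ∑ j ∈ Finset.range v,
          w j * (monicCoeff c k).coeff (n + p ^ k * (j + 1))) (by simp [M₃.nat_8]) (by simp) rfl rfl rfl rfl
          ?_).mono (fun s₄ k₄ r₄ n => ?_) le_rfl
      · intro n hn s₄ k₄ hv₄ h₄
        have H₄ := H₃.of_keeps k₄ rfl rfl
        have M₄ := M₃.of_keeps k₄ rfl rfl
        refine (Runs.sumInto (N := v) (fun j => w j * (monicCoeff c k).coeff (n + p ^ k * (j + 1)))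
          (by simp [H₄.nat_6, hv]) rfl ?_).mono (fun s₅ k₅ r₅ => ?_) (by simp)
        · intro j hj s₅ k₅ hv₅
          have M₅ := M₄.of_keeps k₅ rfl rfl
          simp [k₅.fld 3 rfl, k₄.fld 3 rfl, k₃.fld 3 rfl, k₂.fld 3 rfl, k₁.fld 3 rfl, hv₅, h3 j hj,
            k₅.nat 20 rfl, k₄.nat 20 rfl, k₃.nat 20 rfl, hv₂, k₅.nat 21 rfl, hv₄, k₅.nat 31 rfl,
            k₄.nat 31 rfl, r₃ (j + 1) (by omega), M₅.fld_2 k (by omega)]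
        · simp [k₅.fld 4 rfl, h₄, k₃.fld 4 rfl, I₂, k₅.nat 21 rfl, hv₄, hn, r₅,
            Finset.sum_range_succ _ k]
          ring
      · rw [State.setNat_fld, r₄, k₃.fld 4 rfl, I₂]
        split_ifs <;> simp_all
    · obtain ⟨x, rfl⟩ := Nat.exists_eq_add_of_le hvH
      simp
      ring_nf
      omega
  · obtain ⟨x, rfl⟩ := Nat.exists_eq_add_of_le hvH
    obtain ⟨y, rfl⟩ := Nat.exists_eq_add_of_le h.order_le
    simp
    ring_nf
    omega

/-- The fifth program sets up the linear representation. -/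
def representationProg : Prog :=
  .seq (fillTable 5 20 21 (.var 4 + 1) (.var 8)
      (.cond (.natEq (.var 20) 0) (.setFld 11 0 0 (.load 4 0 (.var 21)))
        (.setFld 11 0 0 (0 - .load 2 (.var 20) (.var 21))))
      (.load 11 0 0))
    (.setFld 6 0 0 (.load 17 0 (.var 6)))

/-- The coefficients of the equation, solved for the series. -/
noncomputable def solvedCoeff (c : ℕ → (ZMod p)[X]) (b : (ZMod p)[X]) (k : ℕ) : (ZMod p)[X] :=
  if k = 0 then b else -monicCoeff c k

theorem runs_representationProg {d N H σ M : ℕ} {f : PowerSeries (ZMod p)} {K : ℕ}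
    {c : ℕ → (ZMod p)[X]} {u : PowerSeries (ZMod p)} {s : State p}
    (h : HasMahlerEquation d N H σ f K c s) (hm : HasMonicEquation H M K c u s)
    (h5 : ∀ i j, s.fld 5 i j = 0) {v : ℕ} (hv : v = (c 0).natTrailingDegree)
    {b : (ZMod p)[X]} (h4 : ∀ n, s.fld 4 0 n = b.coeff n)
    (hdeg : ∀ k ≤ K, (solvedCoeff c b k).natDegree ≤ M) :
    Runs representationProg s ((d + 1) * ((M + 1) * 50 + 50) + 50) fun s' =>
      (∀ k ≤ K, ∀ j, s'.fld 5 k j = (solvedCoeff c b k).coeff j) ∧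
      s'.fld 6 0 0 = s.fld 17 0 v := by
  apply Runs.le
  · apply Runs.seq
    · refine Runs.fillTable (N := K + 1) (N' := M + 1) (T := 20)
        (fun k j => (solvedCoeff c b k).coeff j) (by simp [h.nat_4]) (by simp [hm.nat_8]) rfl rfl rfl
        rfl (by simp) rfl ?_
      intro k hk j hj s₁ k₁ hu₁ hv₁ _
      apply Runs.le
      · apply Runs.cond (T := 12)
        · intro hb
          simp [hu₁] at hb
          refine Runs.setFld ?_ (by simp)
          simp [k₁.fld 4 rfl, hv₁, h4, solvedCoeff, hb]
        · intro hb
          simp [hu₁] at hb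
          refine Runs.setFld ?_ (by simp)
          simp [k₁.fld 2 rfl, hu₁, hv₁, solvedCoeff, hb, hm.fld_2 k (by omega)]
      · simp
    intro s₁ k₁ r₁
    refine Runs.setFld ⟨fun k hk j => ?_, ?_⟩ le_rfl
    · have := hdeg k hk
      simp only [State.setFld_fld, r₁, h5]
      rw [if_neg (by omega)]
      split_ifs with hkj
      · rfl
      · rw [coeff_eq_zero_of_natDegree_lt (by omega)]
    · simp [k₁.fld 17 rfl, k₁.nat 6 rfl, h.nat_6, hv]
  · obtain ⟨y, rfl⟩ := Nat.exists_eq_add_of_le h.order_le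
    simp
    ring_nf
    omega

end FieldRAM

/-! ### Windows of coefficients -/

namespace MahlerMethod

variable {p : ℕ} [Fact p.Prime]

open Polynomial

/-- The coefficient of index `n - s`, which is zero if `n < s`. -/
noncomputable def windowCoeff (h : PowerSeries (ZMod p)) (n s : ℕ) : ZMod p :=
  if s ≤ n then PowerSeries.coeff (n - s) h else 0

/-- Write `P = p^k`. The coefficient of `h` at `⌊n/P⌋ - t` meets that of `q` at `n mod P + P t - s`.
For `s ≤ 2H < t` the latter index exceeds `H (P - 1)`, so windows of length `2 H + 1` suffice to
compute windows of the same length. -/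
theorem windowCoeff_mul_pow {q : (ZMod p)[X]} {H k : ℕ} (hq : q.natDegree ≤ H * (p ^ k - 1))
    (h : PowerSeries (ZMod p)) (n : ℕ) {s : ℕ} (hs : s ≤ 2 * H) :
    windowCoeff ((q : PowerSeries (ZMod p)) * h ^ p ^ k) n s =
      ∑ t ∈ Finset.range (2 * H + 1), if s ≤ n % p ^ k + p ^ k * t then
        q.coeff (n % p ^ k + p ^ k * t - s) * windowCoeff h (n / p ^ k) t else 0 := by
  have hP : 0 < p ^ k := pow_pos (Fact.out : p.Prime).pos _
  obtain ⟨P', hP'⟩ : ∃ P', p ^ k = P' + 1 := ⟨p ^ k - 1, by omega⟩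
  have hn := Nat.mod_add_div n (p ^ k)
  set F : ℕ → ZMod p := fun t => if s ≤ n % p ^ k + p ^ k * t then
        q.coeff (n % p ^ k + p ^ k * t - s) * windowCoeff h (n / p ^ k) t else 0 with hF
  have hF1 : ∀ t, n / p ^ k < t → F t = 0 := fun t ht => by
    simp only [hF, windowCoeff, if_neg (not_le.2 ht), mul_zero, ite_self]
  have hF2 : ∀ t, 2 * H < t → F t = 0 := fun t ht => by
    have : q.natDegree < n % p ^ k + p ^ k * t - s := by
      refine lt_of_le_of_lt hq ?_
      rw [hP', Nat.add_sub_cancel]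
      have h1 : (P' + 1) * (2 * H + 1) ≤ (P' + 1) * t := Nat.mul_le_mul_left _ ht
      have h2 : (P' + 1) * (2 * H + 1) = H * P' + H * P' + P' + 2 * H + 1 := by ring
      omega
    simp only [hF, coeff_eq_zero_of_natDegree_lt this, zero_mul, ite_self]
  have hext : ∀ a b, a ≤ b → (∀ t, a ≤ t → F t = 0) →
      ∑ t ∈ Finset.range a, F t = ∑ t ∈ Finset.range b, F t := fun a b hab hz =>
    Finset.sum_subset (Finset.range_subset_range.2 hab) fun t _ ht =>
      hz t (by simpa using ht)
  -- Terms with `t > ⌊n/P⌋` vanish for want of a coefficient of `h`, those with `t > 2H` by the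
  -- degree of `q`, so both ranges of summation give the same value.
  have hsum : ∑ t ∈ Finset.range (2 * H + 1), F t = ∑ t ∈ Finset.range (n / p ^ k + 1), F t := by
    rcases le_total (2 * H + 1) (n / p ^ k + 1) with hle | hle
    · exact hext _ _ hle fun t ht => hF2 t ht
    · exact (hext _ _ hle fun t ht => hF1 t ht).symm
  rw [hsum]
  by_cases hsn : s ≤ n
  · rw [windowCoeff, if_pos hsn, mul_comm, coeff_pow_prime_pow_mul (L := n / p ^ k + 1),
      ← Finset.sum_range_reflect]
    · refine Finset.sum_congr rfl fun t ht => ?_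
      rw [Finset.mem_range] at ht
      have e : n / p ^ k + 1 - 1 - t = n / p ^ k - t := by omega
      have e2 : p ^ k * (n / p ^ k - t) + p ^ k * t = p ^ k * (n / p ^ k) := by
        rw [← mul_add, Nat.sub_add_cancel (by omega)]
      rw [e]
      simp only [hF, windowCoeff]
      rw [if_pos (by omega : t ≤ n / p ^ k)]
      refine if_congr (by omega) ?_ rfl
      rw [coeff_coe, mul_comm]
      congr 2
      omega
    · intro i hi hle
      have h1 : p ^ k * (n / p ^ k + 1) ≤ p ^ k * i := Nat.mul_le_mul_left _ hi
      have h2 := Nat.mod_lt n hP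
      rw [mul_add] at h1
      omega
  · rw [windowCoeff, if_neg hsn]
    refine (Finset.sum_eq_zero fun t ht => ?_).symm
    have h1 : p ^ k * t ≤ p ^ k * (n / p ^ k) :=
      Nat.mul_le_mul_left _ (Nat.lt_succ_iff.1 (Finset.mem_range.1 ht))
    simp only [hF]
    rw [if_neg (by omega)]

theorem windowCoeff_add (h h' : PowerSeries (ZMod p)) (n s : ℕ) :
    windowCoeff (h + h') n s = windowCoeff h n s + windowCoeff h' n s := by
  unfold windowCoeff
  split_ifs <;> simp

theorem windowCoeff_sum (h : ℕ → PowerSeries (ZMod p)) (K n s : ℕ) :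
    windowCoeff (∑ k ∈ Finset.range K, h k) n s = ∑ k ∈ Finset.range K, windowCoeff (h k) n s := by
  unfold windowCoeff
  split_ifs <;> simp

end MahlerMethod

/-! ### The sixth and seventh programs: values of the representation, and the output -/

namespace FieldRAM

variable {p : ℕ} [Fact p.Prime]

open Polynomial MahlerMethod

/-- The powers of `p` up to the first one that exceeds `nat 3`. -/
def scaleProg : Prog :=
  .seq (.setNat 32 0 1)
    (.seq (.setNat 33 0 0)
      (.loop (.neg (.natLt (.var 3) (.load 32 (.var 33))))
        (.seq (mulInto 34 22 (.var 0) (.load 32 (.var 33)))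
          (.seq (.setNat 32 (.var 33 + 1) (.var 34)) (.setNat 33 0 (.var 33 + 1))))))

/-- `Nat.clog p (N + 1)` is the first exponent `L` with `N < p ^ L`, so it counts the rounds of the
loop. -/
theorem runs_scaleProg {s : State p} {N : ℕ} (h0 : s.nat 0 0 = p) (h3 : s.nat 3 0 = N) :
    Runs scaleProg s (Nat.clog p (N + 1) * (p * 20 + 60) + 30) fun s' =>
      s'.nat 33 0 = Nat.clog p (N + 1) ∧ ∀ j ≤ Nat.clog p (N + 1), s'.nat 32 j = p ^ j := by
  have hp := (Fact.out : p.Prime)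
  apply Runs.le
  · apply Runs.seq (R₁ := fun s' => s'.nat 32 0 = 1)
    · exact Runs.setNat (by simp) le_rfl
    intro s₁ k₁ r₁
    apply Runs.seq (R₁ := fun s' => s'.nat 33 0 = 0)
    · exact Runs.setNat (by simp) le_rfl
    intro s₂ k₂ r₂
    refine (Runs.loop (T := p * 19 + 30) (fun i s' => s'.nat 0 0 = p ∧ s'.nat 3 0 = N ∧
      ∃ l, l + i = Nat.clog p (N + 1) ∧ s'.nat 33 0 = l ∧ ∀ j ≤ l, s'.nat 32 j = p ^ j) ?_ ?_
      (Nat.clog p (N + 1)) s₂ ⟨by simp [k₂.nat 0 rfl, k₁.nat 0 rfl, h0],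
        by simp [k₂.nat 3 rfl, k₁.nat 3 rfl, h3], 0, by simp, r₂, ?_⟩).mono ?_ le_rfl
    · rintro i s' ⟨-, e3, l, hl, e33, e32⟩
      simp only [Test.holds_neg, Test.holds_natLt, NatExpr.eval_var, NatExpr.eval_load, e3, e33,
        e32 l le_rfl, not_lt]
      constructor
      · intro hle
        have : l < Nat.clog p (N + 1) := (Nat.lt_clog_iff_pow_lt hp.one_lt).2 (by omega)
        omega
      · intro hi
        have := (Nat.lt_clog_iff_pow_lt hp.one_lt).1 (by omega : l < Nat.clog p (N + 1))
        omega
    · rintro i s' ⟨e0, e3, l, hl, e33, e32⟩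
      apply Runs.le
      · apply Runs.seq
        · exact Runs.mulInto (N := p) (M := p ^ l) (by simp [e0]) (by simp [e33, e32]) (by simp)
            rfl rfl
        intro s₃ k₃ r₃
        apply Runs.seq (R₁ := fun s' => ∀ j ≤ l + 1, s'.nat 32 j = p ^ j)
        · refine Runs.setNat (fun j hj => ?_) le_rfl
          by_cases hj' : j = l + 1
          · simp [hj', k₃.nat 33 rfl, e33, r₃, pow_succ']
          · simp [hj', k₃.nat 33 rfl, e33, k₃.nat 32 rfl, e32 j (by omega)]
        intro s₄ k₄ r₄
        refine Runs.setNat ⟨?_, ?_, l + 1, by omega, ?_, ?_⟩ le_rfl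
        · simp [k₄.nat 0 rfl, k₃.nat 0 rfl, e0]
        · simp [k₄.nat 3 rfl, k₃.nat 3 rfl, e3]
        · simp [k₄.nat 33 rfl, k₃.nat 33 rfl, e33]
        · simpa using r₄
      · simp
    · simp [k₂.nat 32 rfl, r₁]
    · rintro s' - ⟨-, -, l, hl, e33, e32⟩
      rw [add_zero] at hl
      rw [← hl]
      exact ⟨e33, e32⟩
  · simp
    ring_nf
    omega

/-- The quotients of `nat 3` by the powers of `p`. -/
def quotientsProg : Prog :=
  .seq (.setNat 35 0 (.var 3))
    (forUp 20 (.var 33)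
      (.seq (.setNat 37 0 (.var 33 - 1 - .var 20))
        (forUp 21 (.var 0)
          (.seq (.setNat 36 (.var 37) (.load 36 (.var 37) + .load 36 (.var 37 + 1)))
            (.cond (.natLt (.var 35) (.load 32 (.var 37))) .skip
              (.seq (.setNat 35 0 (.var 35 - .load 32 (.var 37)))
                (.setNat 36 (.var 37) (.load 36 (.var 37) + 1))))))))

/-- The machine cannot divide natural numbers. The quotient at level `l` is `p` times the quotient
at level `l + 1` plus a digit. In `p` rounds the program adds the higher quotient `p` times and
finds the digit by subtracting `p ^ l` from the remainder while possible. -/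
theorem runs_quotientsProg {s : State p} {N L : ℕ} (h0 : s.nat 0 0 = p) (h3 : s.nat 3 0 = N)
    (h33 : s.nat 33 0 = L) (h32 : ∀ j ≤ L, s.nat 32 j = p ^ j) (hN : N < p ^ L)
    (h36 : ∀ j, s.nat 36 j = 0) :
    Runs quotientsProg s (L * (p * 80 + 60) + 30) fun s' => ∀ l, s'.nat 36 l = N / p ^ l := by
  have hp := (Fact.out : p.Prime)
  apply Runs.le
  · apply Runs.seq (R₁ := fun s' => s'.nat 35 0 = N)
    · exact Runs.setNat (by simp [h3]) le_rfl
    intro s₁ k₁ r₁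
    refine (Runs.forUp (N := L) (T := p * 65 + 40) (fun i s' => s'.nat 35 0 = N % p ^ (L - i) ∧
      ∀ l, s'.nat 36 l = if L - i ≤ l then N / p ^ l else 0) (by simp [k₁.nat 33 rfl, h33]) rfl rfl
      ⟨by simp [r₁, Nat.mod_eq_of_lt hN], fun l => ?_⟩ ?_).mono
      (fun s₂ k₂ r₂ l => by simpa using r₂.2 l) le_rfl
    · simp only [State.setNat_nat, k₁.nat 36 rfl, h36]
      split_ifs with h1 h2 h2
      · simp at h1
      · rfl
      · rw [Nat.div_eq_of_lt (hN.trans_le (Nat.pow_le_pow_right hp.pos (by omega)))]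
      · rfl
    rintro i hi s₂ k₂ hv₂ ⟨i35, i36⟩
    have e33 : s₂.nat 33 0 = L := by simp [k₂.nat 33 rfl, k₁.nat 33 rfl, h33]
    obtain ⟨l, hl⟩ : ∃ l, L = l + 1 + i := ⟨L - 1 - i, by omega⟩
    have hLi : L - i = l + 1 := by omega
    rw [hLi] at i35 i36
    set R := N % p ^ (l + 1) with hR
    set D := N / p ^ (l + 1) with hD
    have hRlt : R < p ^ l * p := by
      rw [← pow_succ]
      exact Nat.mod_lt _ (pow_pos hp.pos _)
    apply Runs.le
    · apply Runs.seq (R₁ := fun s' => s'.nat 37 0 = l)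
      · refine Runs.setNat ?_ le_rfl
        simp [e33, hv₂]
        omega
      intro s₃ k₃ r₃
      -- `q` counts the successful subtractions. The clause `q < j → …` records that one failed
      -- attempt means that the remainder is already reduced. After `p` rounds `q = p` is
      -- impossible, since `R < p ^ l * p`.
      refine (Runs.forUp (N := p) (T := 50) (fun j s' => ∃ q ≤ j, s'.nat 35 0 + p ^ l * q = R ∧
        (q < j → s'.nat 35 0 < p ^ l) ∧
        ∀ m, s'.nat 36 m = if m = l then j * D + q else s₂.nat 36 m)
        (by simp [k₃.nat 0 rfl, k₂.nat 0 rfl, k₁.nat 0 rfl, h0]) rfl rfl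
        ⟨0, le_rfl, by simp [k₃.nat 35 rfl, i35], by simp, fun m => ?_⟩ ?_).mono ?_ le_rfl
      · simp only [State.setNat_nat, k₃.nat 36 rfl]
        by_cases hm : m = l
        · simp [hm, i36]
        · simp [hm]
      · rintro j hj s₄ k₄ hv₄ ⟨q, hqj, j35, hq, j36⟩
        have e37 : s₄.nat 37 0 = l := by simp [k₄.nat 37 rfl, r₃]
        have e32 : s₄.nat 32 l = p ^ l := by
          simp [k₄.nat 32 rfl, k₃.nat 32 rfl, k₂.nat 32 rfl, k₁.nat 32 rfl, h32 l (by omega)]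
        have eD : s₂.nat 36 (l + 1) = D := by rw [i36, if_pos le_rfl]
        apply Runs.le
        · apply Runs.seq (R₁ := fun s' => ∀ m, s'.nat 36 m =
            if m = l then (j + 1) * D + q else s₂.nat 36 m)
          · refine Runs.setNat (fun m => ?_) le_rfl
            by_cases hm : m = l
            · simp [hm, e37, j36, eD]
              ring
            · simp [hm, e37, j36]
          intro s₅ k₅ r₅
          have f37 : s₅.nat 37 0 = l := by rw [k₅.nat 37 rfl, e37]
          have f32 : s₅.nat 32 l = p ^ l := by rw [k₅.nat 32 rfl, e32]
          apply Runs.cond (T := 30)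
          · intro hb
            simp [f37, f32, k₅.nat 35 rfl] at hb
            refine Runs.skip ⟨q, by omega, ?_, fun _ => ?_, fun m => ?_⟩ (by omega)
            · simp [k₅.nat 35 rfl, j35]
            · simpa [k₅.nat 35 rfl] using hb
            · simpa using r₅ m
          · intro hb
            simp [f37, f32, k₅.nat 35 rfl] at hb
            have hqj' : q = j := by
              by_contra hne
              have := hq (by omega)
              omega
            apply Runs.le
            · apply Runs.seq (R₁ := fun s' => s'.nat 35 0 = s₄.nat 35 0 - p ^ l)
              · exact Runs.setNat (by simp [k₅.nat 35 rfl, f37, f32]) le_rfl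
              intro s₆ k₆ r₆
              refine Runs.setNat ⟨q + 1, by omega, ?_, fun h => absurd h (by omega), fun m => ?_⟩ le_rfl
              · simp [r₆]
                rw [mul_add, mul_one]
                omega
              · by_cases hm : m = l
                · simp [hm, k₆.nat 37 rfl, f37, k₆.nat 36 rfl, r₅]
                  ring
                · simp [hm, k₆.nat 37 rfl, f37, k₆.nat 36 rfl, r₅]
            · simp
        · simp
      · rintro s₄ k₄ ⟨q, hqp, j35, hq, j36⟩
        have hlt : s₄.nat 35 0 < p ^ l := by
          rcases lt_or_eq_of_le hqp with h | h
          · exact hq h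
          · rw [h] at j35
            omega
        have hN' : N = s₄.nat 35 0 + p ^ l * (p * D + q) := by
          have := Nat.mod_add_div N (p ^ (l + 1))
          rw [← hR, ← hD, pow_succ] at this
          rw [← this, ← j35]
          ring
        have hLi' : L - (i + 1) = l := by omega
        rw [hLi']
        refine ⟨?_, fun m => ?_⟩
        · simp only [State.setNat_nat]
          rw [hN', Nat.add_mul_mod_self_left, Nat.mod_eq_of_lt hlt]
          simp
        · have hdiv : N / p ^ l = p * D + q := by
            rw [hN', Nat.add_mul_div_left _ _ (pow_pos hp.pos _), Nat.div_eq_of_lt hlt, zero_add]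
          simp only [State.setNat_nat, j36, i36]
          by_cases hm : m = l
          · subst hm
            simp [hdiv]
          · simp only [hm, if_false]
            rw [if_neg (by simp)]
            exact if_congr (by omega) rfl rfl
    · simp
      omega
  · simp
    ring_nf
    omega

/-- Windows of coefficients below the quotients of the index, by the functional equation. -/
def levelsProg : Prog :=
  .seq (forUp 20 (.var 2 + 1) (.setFld 18 (.var 33 + .var 20) 0 (.load 6 0 0)))
    (.seq (.setNat 38 0 (.var 12 + .var 12 + 1))
      (forUp 14 (.var 33)
        (.seq (.setNat 37 0 (.var 33 - 1 - .var 14))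
          (.seq
            (fillRow 18 21 (.var 37) (.var 38)
              (.cond (.natLt (.load 36 (.var 37)) (.var 21)) (.setFld 11 0 0 0)
                (.setFld 11 0 0 (.load 5 0 (.load 36 (.var 37) - .var 21))))
              (.load 11 0 0))
            (forUp 20 (.var 4)
              (.seq (strideProg (.var 38) (.var 20 + 1))
                (.seq (mulInto 35 22 (.load 11 (.var 20 + 1)) (.load 36 (.var 37 + .var 20 + 1)))
                  (.seq (.setNat 35 0 (.load 36 (.var 37) - .var 35))
                    (fillRow 18 21 (.var 37) (.var 38)
                      (sumInto 10 22 (.var 38)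
                        (.neg (.natLt (.var 35 + .load 31 (.var 22)) (.var 21)))
                        (.load 5 (.var 20 + 1) (.var 35 + .load 31 (.var 22) - .var 21) *
                          .load 18 (.var 37 + .var 20 + 1) (.var 22)))
                      (.load 18 (.var 37) (.var 21) + .load 10 0 0))))))))))

/-- At levels `l ≥ L` the quotient `⌊N/p^l⌋` is zero and the window contains only `η_0`. These rows
are set up for `L ≤ l ≤ L + d`, enough since `K ≤ d`. The levels below `L` are processed downwards,
level `l` using the levels `l + 1, …, l + K`. -/
theorem runs_levelsProg {d N H σ : ℕ} {f : PowerSeries (ZMod p)} {K : ℕ} {c : ℕ → (ZMod p)[X]}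
    {s : State p} (h : HasMahlerEquation d N H σ f K c s) {L : ℕ} (h33 : s.nat 33 0 = L)
    (h36 : ∀ l, s.nat 36 l = N / p ^ l) (hN : N < p ^ L) {a : ℕ → (ZMod p)[X]}
    (h5 : ∀ k ≤ K, ∀ j, s.fld 5 k j = (a k).coeff j) {η : PowerSeries (ZMod p)}
    (h6 : s.fld 6 0 0 = PowerSeries.coeff 0 η) (h18 : ∀ i j, s.fld 18 i j = 0)
    (hη : η = (a 0 : PowerSeries (ZMod p)) +
      ∑ k ∈ Finset.range K, (a (k + 1) : PowerSeries (ZMod p)) * η ^ p ^ (k + 1))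
    (hdeg : ∀ k < K, (a (k + 1)).natDegree ≤ H * (p ^ (k + 1) - 1)) :
    Runs levelsProg s (L * ((d + 1) * ((2 * H + 1) * ((2 * H + 1) * 100 + 300) + p ^ d * 50 + 200)
        + 100) + d * 30 + 100)
      fun s' => ∀ t ≤ 2 * H, s'.fld 18 0 t = windowCoeff η N t := by
  have hp := (Fact.out : p.Prime)
  have hKd := h.order_le
  apply Runs.le
  · apply Runs.seq
    · refine Runs.forUp (N := d + 1) (T := 15) (fun i s' => ∀ r t, s'.fld 18 r t =
        if L ≤ r ∧ r < L + i ∧ t = 0 then PowerSeries.coeff 0 η else 0) (by simp [h.nat_2]) rfl rfl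
        (fun r t => ?_) ?_
      · rw [State.setNat_fld, h18, if_neg (by omega)]
      · intro i hi s₁ k₁ hv₁ I₁
        refine Runs.setFld (fun r t => ?_) (by simp)
        simp only [State.setNat_fld, State.setFld_fld, NatExpr.eval_add, NatExpr.eval_var, hv₁,
          k₁.nat 33 rfl, h33, NatExpr.eval_zero, FldExpr.eval_load, k₁.fld 6 rfl, h6, I₁, true_and]
        by_cases hr : r = L + i ∧ t = 0
        · rw [if_pos hr, if_pos (by omega)]
        · rw [if_neg hr]
          exact if_congr (by omega) rfl rfl
    intro s₁ k₁ r₁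
    have H₁ := h.of_keeps k₁ rfl rfl
    apply Runs.seq (R₁ := fun s' => s'.nat 38 0 = 2 * H + 1)
    · refine Runs.setNat ?_ le_rfl
      simp [H₁.nat_12]
      omega
    intro s₂ k₂ r₂
    have H₂ := H₁.of_keeps k₂ rfl rfl
    refine (Runs.forUp (N := L)
      (T := (d + 1) * ((2 * H + 1) * ((2 * H + 1) * 100 + 300) + p ^ d * 50 + 200) + 80)
      (fun i s' => ∀ l, L - i ≤ l → l ≤ L + K → ∀ t ≤ 2 * H,
        s'.fld 18 l t = windowCoeff η (N / p ^ l) t)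
      (by simp [k₂.nat 33 rfl, k₁.nat 33 rfl, h33]) rfl rfl ?_ ?_).mono
      (fun s' _ h' t ht => by simpa using h' 0 (by omega) (by omega) t ht) le_rfl
    · intro l hl hlK t ht
      rw [State.setNat_fld, k₂.fld 18 rfl, r₁,
        Nat.div_eq_of_lt (hN.trans_le (Nat.pow_le_pow_right hp.pos (by omega)))]
      unfold windowCoeff
      by_cases ht0 : t = 0
      · rw [if_pos ⟨by omega, by omega, ht0⟩, if_pos (by omega), ht0]
      · rw [if_neg (by omega), if_neg (by omega)]
    intro i hi s₃ k₃ hv₃ I₃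
    have H₃ := H₂.of_keeps k₃ rfl rfl
    obtain ⟨l, hl⟩ : ∃ l, L = l + 1 + i := ⟨L - 1 - i, by omega⟩
    have hLi : L - i = l + 1 := by omega
    have hLi' : L - (i + 1) = l := by omega
    rw [hLi] at I₃
    set n := N / p ^ l with hn
    apply Runs.le
    · apply Runs.seq (R₁ := fun s' => s'.nat 37 0 = l)
      · refine Runs.setNat ?_ le_rfl
        simp [k₃.nat 33 rfl, k₂.nat 33 rfl, k₁.nat 33 rfl, h33, hv₃]
        omega
      intro s₄ k₄ r₄
      have H₄ := H₃.of_keeps k₄ rfl rfl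
      have e36 : ∀ m, s₄.nat 36 m = N / p ^ m := by
        simpa [k₄.nat 36 rfl, k₃.nat 36 rfl, k₂.nat 36 rfl, k₁.nat 36 rfl] using h36
      have e38 : s₄.nat 38 0 = 2 * H + 1 := by simp [k₄.nat 38 rfl, k₃.nat 38 rfl, r₂]
      have e5 : ∀ k ≤ K, ∀ j, s₄.fld 5 k j = (a k).coeff j := by
        simpa [k₄.fld 5 rfl, k₃.fld 5 rfl, k₂.fld 5 rfl, k₁.fld 5 rfl] using h5
      apply Runs.seq
      · refine Runs.fillRow (N := 2 * H + 1) (i₀ := l) (T := 30)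
          (fun t => windowCoeff (a 0 : PowerSeries (ZMod p)) n t) (by simp [e38]) (by simp [r₄])
          rfl rfl rfl rfl ?_
        intro t ht s₅ k₅ hv₅ _
        have f36 : s₅.nat 36 l = n := by rw [k₅.nat 36 rfl, e36]
        have f37 : s₅.nat 37 0 = l := by rw [k₅.nat 37 rfl, r₄]
        apply Runs.le
        · apply Runs.cond (T := 15)
          · intro hb
            simp [f36, f37, hv₅] at hb
            refine Runs.setFld ?_ (by simp)
            simp [windowCoeff, not_le.2 hb]
          · intro hb
            simp [f36, f37, hv₅] at hb
            refine Runs.setFld ?_ (by simp)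
            simp [windowCoeff, hb, f36, f37, hv₅, k₅.fld 5 rfl, e5 0 (Nat.zero_le _)]
        · simp
      intro s₅ k₅ r₅
      have H₅ := H₄.of_keeps k₅ rfl rfl
      have f36 : ∀ m, s₅.nat 36 m = N / p ^ m := by simpa [k₅.nat 36 rfl] using e36
      have f37 : s₅.nat 37 0 = l := by rw [k₅.nat 37 rfl, r₄]
      have f38 : s₅.nat 38 0 = 2 * H + 1 := by rw [k₅.nat 38 rfl, e38]
      -- Row `l` accumulates the terms of the functional equation. That the other rows are untouched
      -- must be part of the invariant, as all rows share one array.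
      refine (Runs.forUp (N := K)
        (T := (2 * H + 1) * ((2 * H + 1) * 60 + 130) + p ^ d * 40 + 100)
        (fun k s' => (∀ r, r ≠ l → ∀ t, s'.fld 18 r t = s₅.fld 18 r t) ∧
          ∀ t ≤ 2 * H, s'.fld 18 l t = windowCoeff (a 0 : PowerSeries (ZMod p)) n t +
            ∑ k' ∈ Finset.range k,
              windowCoeff ((a (k' + 1) : PowerSeries (ZMod p)) * η ^ p ^ (k' + 1)) n t)
        (by simp [H₅.nat_4]) rfl rfl ⟨fun r _ t => rfl, fun t ht => ?_⟩ ?_).mono ?_ le_rfl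
      · simp [r₅, Nat.lt_succ_of_le ht]
      · rintro k hk s₆ k₆ hv₆ ⟨J₆, I₆⟩
        have H₆ := H₅.of_keeps k₆ rfl rfl
        have hpk : p ^ (k + 1) ≤ p ^ d := Nat.pow_le_pow_right hp.pos (by omega)
        have g36 : ∀ m, s₆.nat 36 m = N / p ^ m := by simpa [k₆.nat 36 rfl] using f36
        have g37 : s₆.nat 37 0 = l := by rw [k₆.nat 37 rfl, f37]
        have g38 : s₆.nat 38 0 = 2 * H + 1 := by rw [k₆.nat 38 rfl, f38]
        apply Runs.le
        · apply Runs.seq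
          · exact runs_strideProg (H := 2 * H + 1) (e := p ^ (k + 1)) (by simp [g38]) rfl rfl
              (by simp [hv₆, H₆.nat_11 (k + 1) (by omega)])
          intro s₇ k₇ r₇
          have H₇ := H₆.of_keeps k₇ rfl rfl
          apply Runs.seq
          · exact Runs.mulInto (N := p ^ (k + 1)) (M := N / p ^ (l + k + 1))
              (by simp [k₇.nat 20 rfl, hv₆, H₇.nat_11 (k + 1) (by omega)])
              (by simp [k₇.nat 20 rfl, hv₆, k₇.nat 37 rfl, g37, k₇.nat 36 rfl, g36]) (by simp)
              rfl rfl
          intro s₈ k₈ r₈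
          apply Runs.seq (R₁ := fun s' => s'.nat 35 0 = n % p ^ (k + 1))
          · refine Runs.setNat ?_ le_rfl
            have e : N / p ^ (l + k + 1) = n / p ^ (k + 1) := by
              rw [hn, Nat.div_div_eq_div_mul, ← pow_add, add_assoc]
            simp [k₈.nat 37 rfl, k₇.nat 37 rfl, g37, k₈.nat 36 rfl, k₇.nat 36 rfl, g36, r₈]
            rw [e, ← hn]
            exact (Nat.mod_eq_sub _ _).symm
          intro s₉ k₉ r₉
          refine (Runs.fillRow (N := 2 * H + 1) (i₀ := l) (T := (2 * H + 1) * 55 + 20)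
            (fun t => windowCoeff (a 0 : PowerSeries (ZMod p)) n t +
              ∑ k' ∈ Finset.range (k + 1),
                windowCoeff ((a (k' + 1) : PowerSeries (ZMod p)) * η ^ p ^ (k' + 1)) n t)
            (by simp [k₉.nat 38 rfl, k₈.nat 38 rfl, k₇.nat 38 rfl, g38])
            (by simp [k₉.nat 37 rfl, k₈.nat 37 rfl, k₇.nat 37 rfl, g37]) rfl rfl rfl rfl ?_).mono
            ?_ le_rfl
          · intro t ht s₀ k₀ hv₀ h₀
            have h18₀ : ∀ r, r ≠ l → ∀ t, s₀.fld 18 r t = s₅.fld 18 r t := fun r hr t => by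
              rw [h₀, if_neg (fun h => hr h.1), k₉.fld 18 rfl, k₈.fld 18 rfl, k₇.fld 18 rfl,
                J₆ r hr]
            have i35 : s₀.nat 35 0 = n % p ^ (k + 1) := by rw [k₀.nat 35 rfl, r₉]
            have i31 : ∀ j ≤ 2 * H + 1, s₀.nat 31 j = p ^ (k + 1) * j := fun j hj => by
              rw [k₀.nat 31 rfl, k₉.nat 31 rfl, k₈.nat 31 rfl, r₇ j hj]
            have i20 : s₀.nat 20 0 = k := by
              rw [k₀.nat 20 rfl, k₉.nat 20 rfl, k₈.nat 20 rfl, k₇.nat 20 rfl, hv₆]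
            have i37 : s₀.nat 37 0 = l := by
              rw [k₀.nat 37 rfl, k₉.nat 37 rfl, k₈.nat 37 rfl, k₇.nat 37 rfl, g37]
            have i5 : ∀ k ≤ K, ∀ j, s₀.fld 5 k j = (a k).coeff j := by
              simpa [k₀.fld 5 rfl, k₉.fld 5 rfl, k₈.fld 5 rfl, k₇.fld 5 rfl, k₆.fld 5 rfl,
                k₅.fld 5 rfl] using e5
            refine (Runs.sumInto (N := 2 * H + 1) (fun j => if t ≤ n % p ^ (k + 1) + p ^ (k + 1) * j
                then (a (k + 1)).coeff (n % p ^ (k + 1) + p ^ (k + 1) * j - t) *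
                  windowCoeff η (n / p ^ (k + 1)) j else 0)
              (by simp [k₀.nat 38 rfl, k₉.nat 38 rfl, k₈.nat 38 rfl, k₇.nat 38 rfl, g38]) rfl
              ?_).mono (fun s' k' r' => ?_) (by simp)
            · intro j hj s' k' hv'
              have e : n / p ^ (k + 1) = N / p ^ (l + k + 1) := by
                rw [hn, Nat.div_div_eq_div_mul, ← pow_add, add_assoc]
              have hw : s₀.fld 18 (l + k + 1) j = windowCoeff η (n / p ^ (k + 1)) j := by
                rw [h18₀ _ (by omega), r₅, if_neg (by omega), k₄.fld 18 rfl, e]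
                exact I₃ _ (by omega) (by omega) j (by omega)
              simp only [Test.holds_neg, Test.holds_natLt, NatExpr.eval_add, NatExpr.eval_var,
                NatExpr.eval_load, hv', k'.nat 21 rfl, hv₀, k'.nat 35 rfl, i35, k'.nat 31 rfl,
                i31 j (by omega), not_lt]
              refine if_ctx_congr Iff.rfl (fun _ => ?_) fun _ => rfl
              simp only [FldExpr.eval_mul, FldExpr.eval_load, NatExpr.eval_add, NatExpr.eval_sub,
                NatExpr.eval_var, NatExpr.eval_load, NatExpr.eval_one, hv', k'.nat 21 rfl, hv₀,
                k'.nat 35 rfl, i35, k'.nat 31 rfl, i31 j (by omega), k'.nat 20 rfl, i20,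
                k'.nat 37 rfl, i37, k'.fld 5 rfl, i5 (k + 1) (by omega), k'.fld 18 rfl, hw]
            · rw [← windowCoeff_mul_pow (hdeg k hk) η n (by omega)] at r'
              have ht' : s₀.fld 18 l t = windowCoeff (a 0 : PowerSeries (ZMod p)) n t +
                  ∑ k' ∈ Finset.range k,
                    windowCoeff ((a (k' + 1) : PowerSeries (ZMod p)) * η ^ p ^ (k' + 1)) n t := by
                rw [h₀, if_neg (by omega), k₉.fld 18 rfl, k₈.fld 18 rfl, k₇.fld 18 rfl,
                  I₆ t (by omega)]
              simp only [FldExpr.eval_add, FldExpr.eval_load, NatExpr.eval_var, NatExpr.eval_zero,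
                k'.nat 37 rfl, i37, k'.nat 21 rfl, hv₀, k'.fld 18 rfl, ht', r',
                Finset.sum_range_succ _ k, add_assoc]
          · intro s' k' r'
            refine ⟨fun r hr t => ?_, fun t ht => ?_⟩
            · rw [State.setNat_fld, r', if_neg (fun h => hr h.1), k₉.fld 18 rfl, k₈.fld 18 rfl,
                k₇.fld 18 rfl, J₆ r hr]
            · rw [State.setNat_fld, r', if_pos ⟨rfl, by omega⟩]
        · have h1 : p ^ (k + 1) * 40 ≤ p ^ d * 40 := Nat.mul_le_mul_right _ hpk
          simp
          ring_nf at h1 ⊢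
          omega
      · rintro s' k' ⟨J', I'⟩ m hm hmK t ht
        rw [hLi'] at hm
        rw [State.setNat_fld]
        by_cases hml : m = l
        · rw [hml, I' t ht, ← windowCoeff_sum, ← windowCoeff_add, ← hη]
        · rw [J' m hml, r₅, if_neg (fun h => hml h.1), k₄.fld 18 rfl]
          exact I₃ m (by omega) hmK t ht
    · obtain ⟨y, rfl⟩ := Nat.exists_eq_add_of_le hKd
      simp
      ring_nf
      omega
  · simp
    ring_nf
    omega

/-- The sixth program computes the values of the linear representation. -/
def valuesProg : Prog :=
  .seq scaleProg
    (.seq quotientsProg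
      (.seq levelsProg (fillRow 7 21 0 (.var 5) .skip (.load 18 0 (.var 21)))))

theorem runs_valuesProg {d N H σ : ℕ} {f : PowerSeries (ZMod p)} {K : ℕ} {c : ℕ → (ZMod p)[X]}
    {s : State p} (h : HasMahlerEquation d N H σ f K c s) {L : ℕ} (hL : L = Nat.clog p (N + 1))
    (h36 : ∀ l, s.nat 36 l = 0) {a : ℕ → (ZMod p)[X]}
    (h5 : ∀ k ≤ K, ∀ j, s.fld 5 k j = (a k).coeff j) {η : PowerSeries (ZMod p)}
    (h6 : s.fld 6 0 0 = PowerSeries.coeff 0 η) (h18 : ∀ i j, s.fld 18 i j = 0)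
    (hη : η = (a 0 : PowerSeries (ZMod p)) +
      ∑ k ∈ Finset.range K, (a (k + 1) : PowerSeries (ZMod p)) * η ^ p ^ (k + 1))
    (hdeg : ∀ k < K, (a (k + 1)).natDegree ≤ H * (p ^ (k + 1) - 1)) :
    Runs valuesProg s (L * ((d + 1) * ((2 * H + 1) * ((2 * H + 1) * 100 + 300) + p ^ d * 50 + 200)
        + p * 100 + 300) + d * 30 + H * 30 + 300)
      fun s' => ∀ i ≤ H, s'.fld 7 0 i = windowCoeff η N i := by
  have hp := (Fact.out : p.Prime)
  have hNL : N < p ^ L := hL ▸ Nat.le_pow_clog hp.one_lt (N + 1)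
  apply Runs.le
  · apply Runs.seq
    · exact runs_scaleProg h.nat_0 h.nat_3
    intro s₁ k₁ r₁
    have H₁ := h.of_keeps k₁ rfl rfl
    rw [← hL] at r₁
    apply Runs.seq
    · exact runs_quotientsProg H₁.nat_0 H₁.nat_3 r₁.1 r₁.2 hNL (by simpa [k₁.nat 36 rfl] using h36)
    intro s₂ k₂ r₂
    have H₂ := H₁.of_keeps k₂ rfl rfl
    apply Runs.seq
    · exact runs_levelsProg H₂ (L := L) (by simp [k₂.nat 33 rfl, r₁.1]) r₂ hNL (a := a)
        (by simpa [k₂.fld 5 rfl, k₁.fld 5 rfl] using h5) (by simpa [k₂.fld 6 rfl, k₁.fld 6 rfl] using h6)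
        (by simpa [k₂.fld 18 rfl, k₁.fld 18 rfl] using h18) hη hdeg
    intro s₃ k₃ r₃
    have H₃ := H₂.of_keeps k₃ rfl rfl
    refine (Runs.fillRow (N := H + 1) (i₀ := 0) (T := 1) (fun i => windowCoeff η N i)
      (by simp [H₃.nat_5]) (by simp) rfl rfl rfl rfl ?_).mono
      (fun s' _ h' i hi => by simp [h', Nat.lt_succ_of_le hi]) le_rfl
    intro i hi s₄ k₄ hv₄ _
    refine Runs.skip ?_ le_rfl
    simp [hv₄, k₄.fld 18 rfl, r₃ i (by omega)]
  · rw [← hL]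
    simp
    ring_nf
    omega

/-- The seventh program combines the values. -/
def outputProg : Prog :=
  .seq (sumInto 10 22 (.var 5) (.neg (.natLt (.var 3) (.var 22)))
      (.load 1 0 (.var 22) * .load 7 0 (.var 22)))
    (.seq (.setFld 11 0 0 (.load 10 0 0))
      (.seq (sumInto 10 22 (.var 5) (.natLt (.var 3) (.var 22))
          (.load 1 0 (.var 22) * .load 3 1 (.var 22 - .var 3 - 1)))
        (.setFld 8 0 0 (.load 11 0 0 + .load 10 0 0))))

theorem runs_outputProg {d N H σ : ℕ} {f : PowerSeries (ZMod p)} {K : ℕ} {c : ℕ → (ZMod p)[X]}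
    {s : State p} (h : HasMahlerEquation d N H σ f K c s) :
    Runs outputProg s (H * 100 + 200) fun s' => s'.fld 8 0 0 =
      ∑ i ∈ Finset.Icc (c 0).natTrailingDegree (c 0).natDegree, (c 0).coeff i *
        if i ≤ N then s.fld 7 0 i else s.fld 3 1 (i - N - 1) := by
  -- The program sums over all indices up to `H`; outside the stated interval the coefficients of
  -- `c_0` vanish.
  have hsum : ∀ w : ℕ → ZMod p,
      ∑ i ∈ Finset.Icc (c 0).natTrailingDegree (c 0).natDegree, (c 0).coeff i * w i =
        ∑ i ∈ Finset.range (H + 1), (c 0).coeff i * w i := fun w => by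
    refine Finset.sum_subset (fun i hi => ?_) fun i _ hi => ?_
    · have := h.natDegree_le 0
      rw [Finset.mem_Icc] at hi
      exact Finset.mem_range.2 (by omega)
    · by_contra hne
      exact hi (Finset.mem_Icc.2 ⟨natTrailingDegree_le_of_ne_zero (left_ne_zero_of_mul hne),
        le_natDegree_of_ne_zero (left_ne_zero_of_mul hne)⟩)
  apply Runs.le
  · apply Runs.seq
    · refine Runs.sumInto (N := H + 1) (fun i => if i ≤ N then (c 0).coeff i * s.fld 7 0 i else 0)
        (by simp [h.nat_5]) rfl ?_
      intro i hi s₁ k₁ hv₁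
      have H₁ := h.of_keeps k₁ rfl rfl
      simp only [Test.holds_neg, Test.holds_natLt, NatExpr.eval_var, H₁.nat_3, hv₁, not_lt]
      refine if_ctx_congr Iff.rfl (fun _ => ?_) fun _ => rfl
      simp [hv₁, H₁.fld_1 0 (Nat.zero_le _), k₁.fld 7 rfl]
    intro s₁ k₁ r₁
    have H₁ := h.of_keeps k₁ rfl rfl
    apply Runs.seq (R₁ := fun s' => s'.fld 11 0 0 =
        ∑ i ∈ Finset.range (H + 1), if i ≤ N then (c 0).coeff i * s.fld 7 0 i else 0)
    · exact Runs.setFld (by simp [r₁]) le_rfl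
    intro s₂ k₂ r₂
    have H₂ := H₁.of_keeps k₂ rfl rfl
    apply Runs.seq
    · refine Runs.sumInto (N := H + 1)
        (fun i => if N < i then (c 0).coeff i * s.fld 3 1 (i - N - 1) else 0)
        (by simp [H₂.nat_5]) rfl ?_
      intro i hi s₃ k₃ hv₃
      have H₃ := H₂.of_keeps k₃ rfl rfl
      simp only [Test.holds_natLt, NatExpr.eval_var, H₃.nat_3, hv₃]
      refine if_ctx_congr Iff.rfl (fun _ => ?_) fun _ => rfl
      simp [hv₃, H₃.nat_3, H₃.fld_1 0 (Nat.zero_le _), k₃.fld 3 rfl, k₂.fld 3 rfl, k₁.fld 3 rfl]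
    intro s₃ k₃ r₃
    refine Runs.setFld ?_ le_rfl
    simp only [FldExpr.eval_add, FldExpr.eval_load, NatExpr.eval_zero, State.setFld_fld, r₃,
      k₃.fld 11 rfl, r₂, hsum]
    simp only [true_and, if_true, ← Finset.sum_add_distrib]
    refine Finset.sum_congr rfl fun i _ => ?_
    by_cases hi : i ≤ N
    · simp [hi, not_lt.2 hi]
    · simp [hi, not_le.1 hi]
  · simp
    ring_nf
    omega

end FieldRAM

/-! ### Composition of the seven programs -/

namespace FieldRAM

variable {p : ℕ}

open Polynomial

theorem State.poly_eq {s : State p} {a i len : ℕ} {q : (ZMod p)[X]}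
    (h : ∀ j, s.fld a i j = q.coeff j) (hq : q.natDegree < len) : s.poly a i len = q := by
  rw [State.poly, q.as_sum_range' len hq]
  simp only [h]

end FieldRAM

namespace MahlerMethod

variable {p : ℕ} [Fact p.Prime]

open Polynomial FieldRAM

theorem exists_eq_X_pow_natTrailingDegree_mul {c : (ZMod p)[X]} (hc : c ≠ 0) :
    ∃ (q : (ZMod p)[X]) (u : PowerSeries (ZMod p)), c = X ^ c.natTrailingDegree * q ∧
      q.coeff 0 ≠ 0 ∧ (q : PowerSeries (ZMod p)) * u = 1 := by
  obtain ⟨q, hq⟩ : X ^ c.natTrailingDegree ∣ c :=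
    X_pow_dvd_iff.2 fun _ h => coeff_eq_zero_of_lt_natTrailingDegree h
  have h0 : q.coeff 0 ≠ 0 := by
    have : c.trailingCoeff ≠ 0 := trailingCoeff_nonzero_iff_nonzero.2 hc
    refine fun h => this ?_
    rw [trailingCoeff, show c.coeff c.natTrailingDegree =
      (X ^ c.natTrailingDegree * q).coeff c.natTrailingDegree from by rw [← hq],
      coeff_X_pow_mul', if_pos le_rfl, Nat.sub_self, h]
  exact ⟨q, (q : PowerSeries (ZMod p))⁻¹, hq, h0, PowerSeries.mul_inv_cancel _ (by simpa using h0)⟩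

/-- The right-hand side of the equation for the nonnegative part of a Laurent series with
negative part `∑_{j < v} w_j x ^ (-(j + 1))`. -/
noncomputable def rhsPoly (K v M : ℕ) (c : ℕ → (ZMod p)[X]) (w : ℕ → ZMod p) : (ZMod p)[X] :=
  ∑ n ∈ Finset.range (M + 1), monomial n (-∑ k ∈ Finset.range (K + 1), ∑ j ∈ Finset.range v,
    w j * (c k).coeff (n + p ^ k * (j + 1)))

theorem coeff_rhsPoly (K v M : ℕ) (c : ℕ → (ZMod p)[X]) (w : ℕ → ZMod p) (n : ℕ) :
    (rhsPoly K v M c w).coeff n = if n < M + 1 then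
      -∑ k ∈ Finset.range (K + 1), ∑ j ∈ Finset.range v,
        w j * (c k).coeff (n + p ^ k * (j + 1)) else 0 := by
  simp only [rhsPoly, finsetSum_coeff, coeff_monomial, Finset.sum_ite_eq', Finset.mem_range]

theorem natDegree_rhsPoly_le (K v M : ℕ) (c : ℕ → (ZMod p)[X]) (w : ℕ → ZMod p) :
    (rhsPoly K v M c w).natDegree ≤ M :=
  natDegree_le_iff_coeff_eq_zero.2 fun n hn => by
    rw [coeff_rhsPoly, if_neg (by omega)]

theorem coe_rhsPoly {K v M : ℕ} {c : ℕ → (ZMod p)[X]} {w : ℕ → ZMod p}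
    (hc : ∀ k ≤ K, (c k).natDegree ≤ M) {g : LaurentSeries (ZMod p)}
    (hg : negPart g = ∑ j ∈ Finset.range v, HahnSeries.single (-((j : ℤ) + 1)) (w j)) :
    (rhsPoly K v M c w : PowerSeries (ZMod p)) = nonnegPart (-(mahlerOp K c (negPart g))) := by
  ext n
  rw [coeff_coe, coeff_rhsPoly, nonnegPart, PowerSeries.coeff_mk, HahnSeries.coeff_neg, hg,
    coeff_mahlerOp_sum_single]
  split_ifs with hn
  · rfl
  · rw [Finset.sum_eq_zero, neg_zero]
    intro k hk
    refine Finset.sum_eq_zero fun j _ => ?_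
    rw [coeff_eq_zero_of_natDegree_lt, mul_zero]
    have := hc k (Nat.lt_succ_iff.1 (Finset.mem_range.1 hk))
    omega

theorem eq_solvedCoeff_of_eq {K : ℕ} {c : ℕ → (ZMod p)[X]} {b : (ZMod p)[X]}
    {η : PowerSeries (ZMod p)}
    (h : ∑ k ∈ Finset.range (K + 1), (monicCoeff c k : PowerSeries (ZMod p)) * η ^ p ^ k = b) :
    η = (solvedCoeff c b 0 : PowerSeries (ZMod p)) + ∑ k ∈ Finset.range K,
      (solvedCoeff c b (k + 1) : PowerSeries (ZMod p)) * η ^ p ^ (k + 1) := by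
  rw [Finset.sum_range_succ'] at h
  simp only [solvedCoeff, if_pos, Nat.succ_ne_zero, if_false]
  rw [← h]
  simp [monicCoeff]

theorem coeff_nonnegPart_quotient {c q : (ZMod p)[X]} {v : ℕ} (hc : c ≠ 0) (hq : c = X ^ v * q)
    {f u : PowerSeries (ZMod p)} (hu : (q : PowerSeries (ZMod p)) * u = 1) (n : ℕ) :
    PowerSeries.coeff n (nonnegPart (HahnSeries.ofPowerSeries ℤ (ZMod p) f / polyToLaurent c)) =
      PowerSeries.coeff (n + v) (f * u) := by
  rw [nonnegPart, PowerSeries.coeff_mk, coeff_quotient hc hq hu, if_neg (by omega)]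
  congr 1

theorem negPart_quotient {c q : (ZMod p)[X]} {v : ℕ} (hc : c ≠ 0) (hq : c = X ^ v * q)
    {f u : PowerSeries (ZMod p)} (hu : (q : PowerSeries (ZMod p)) * u = 1) :
    negPart (HahnSeries.ofPowerSeries ℤ (ZMod p) f / polyToLaurent c) =
      ∑ j ∈ Finset.range v, HahnSeries.single (-((j : ℤ) + 1))
        (PowerSeries.coeff (v - 1 - j) (f * u)) := by
  refine negPart_eq_sum fun j => ?_
  rw [coeff_quotient hc hq hu]
  rcases lt_or_ge j v with h | h
  · rw [if_neg (by omega), if_pos h]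
    congr 2
    omega
  · rw [if_pos (by omega), if_neg (by omega)]

theorem existsUnique_isRoot {E : (ZMod p)[X][X]} (h0 : (E.coeff 0).coeff 0 = 0)
    (h1 : (E.coeff 1).coeff 0 ≠ 0) : ∃! f : PowerSeries (ZMod p), IsRoot E f := by
  obtain ⟨f, hf, hE⟩ := exists_eval₂_eq_zero h0 h1
  exact ⟨f, ⟨hf, hE⟩, fun g hg => eval₂_unique h1 hg.1 hf hg.2 hE⟩

/-- The seven programs of the method via Mahler equations. -/
def mahlerProgs : Fin 7 → Prog :=
  ![mahlerEquationProg, monicProg, negPartProg, rhsProg, representationProg, valuesProg, outputProg]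

/-- The runs are chained by frame conditions. Each program finds its working arrays untouched by its
predecessors, hence still zero, and the data of earlier programs intact. -/
theorem exists_isMahlerRun {h d N Q H σ M L : ℕ} (hQ : Q = p ^ d) (hH : H = d * (Q * h))
    (hσ : σ = (d + 2) * H + 1) (hM : M = H * Q) (hL : L = Nat.clog p (N + 1)) (hh1 : 1 ≤ h)
    (hd2 : 2 ≤ d) {E : (ZMod p)[X][X]} (hd : E.natDegree ≤ d)
    (hh : ∀ j, (E.coeff j).natDegree ≤ h) (h01 : (E.coeff 1).coeff 0 ≠ 0)
    {f : PowerSeries (ZMod p)} (hf : IsRoot E f) :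
    ∃ (s : Fin 8 → State p) (t : Fin 7 → ℕ) (K : ℕ) (c : ℕ → (ZMod p)[X])
      (g : LaurentSeries (ZMod p)) (u : PowerSeries (ZMod p)),
      (∀ i : Fin 7, Exec (mahlerProgs i) (s i.castSucc) (t i) (s i.succ)) ∧
      IsMahlerRun h d N E f s K c g u ∧
      ∑ i, t i ≤ (d + 1) * (d + 1) * (d + 1) * ((σ + 1) * (σ + 1) * 3000) +
        ((d + 1) * ((M + 2 * H + 2) * (H * 500 + 1000)) + Q * 20) +
        ((H + 1) * ((H + 1) * 40 + 100) + 100) +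
        ((d + 1) * ((M + 1) * (H * 60 + 100) + H * 50 + 100) + 20) +
        ((d + 1) * ((M + 1) * 50 + 50) + 50) +
        (L * ((d + 1) * ((2 * H + 1) * ((2 * H + 1) * 100 + 300) + Q * 50 + 200) + p * 100 + 300) +
          d * 30 + H * 30 + 300) +
        (H * 100 + 200) := by
  have hp := (Fact.out : p.Prime)
  obtain ⟨t₁, s₁, e₁, ht₁, K, c, h₁⟩ := runs_mahlerEquationProg hQ hH hσ hh1 hd2 hd hh h01 hf (N := N)
  have k₁ := e₁.keeps
  have hc := trailing_ne_zero_of_minimal h₁.minimal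
  obtain ⟨q, u, hq, hq0, hu⟩ := exists_eq_X_pow_natTrailingDegree_mul hc
  obtain ⟨v, hv⟩ : ∃ v, v = (c 0).natTrailingDegree := ⟨_, rfl⟩
  have hq' : c 0 = X ^ v * q := hv ▸ hq
  obtain ⟨t₂, s₂, e₂, ht₂, m₂⟩ := runs_monicProg h₁ hQ hM
    (fun i j => by rw [k₁.fld 2 rfl]; rfl) (fun i j => by rw [k₁.fld 15 rfl]; rfl) hq hq0 hu
  have k₂ := e₂.keeps
  have h₂ := h₁.of_keeps k₂ rfl rfl
  obtain ⟨t₃, s₃, e₃, ht₃, r₃⟩ := runs_negPartProg h₂ m₂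
    (by rw [hσ]; exact Nat.lt_succ_of_le (Nat.le_mul_of_pos_left _ (by omega)))
    (fun i j => by rw [k₂.fld 3 rfl, k₁.fld 3 rfl]; rfl) hv
  have k₃ := e₃.keeps
  have h₃ := h₂.of_keeps k₃ rfl rfl
  have m₃ := m₂.of_keeps k₃ rfl rfl
  set w : ℕ → ZMod p := fun j => PowerSeries.coeff (v - 1 - j) (f * u) with hw
  have w₃ : ∀ j < v, s₃.fld 3 1 j = w j := fun j hj => by rw [r₃.2.1, if_pos hj]
  obtain ⟨t₄, s₄, e₄, ht₄, r₄, r₄'⟩ := runs_rhsProg h₃ m₃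
    (fun i j => by rw [k₃.fld 4 rfl, k₂.fld 4 rfl, k₁.fld 4 rfl]; rfl) hv w₃
  have k₄ := e₄.keeps
  have h₄ := h₃.of_keeps k₄ rfl rfl
  have m₄ := m₃.of_keeps k₄ rfl rfl
  set b := rhsPoly K v M (monicCoeff c) w with hb
  have b₄ : ∀ n, s₄.fld 4 0 n = b.coeff n := fun n => by rw [r₄', hb, coeff_rhsPoly]
  have hmdeg : ∀ k ≤ K, (monicCoeff c k).natDegree ≤ M := fun k hk => by
    refine (natDegree_monicCoeff_le h₁.natDegree_le k).trans ?_
    rw [hM, hQ]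
    exact Nat.mul_le_mul_left _ ((Nat.sub_le _ _).trans
      (Nat.pow_le_pow_right hp.pos (hk.trans h₁.order_le)))
  have hsdeg : ∀ k ≤ K, (solvedCoeff c b k).natDegree ≤ M := fun k hk => by
    rw [solvedCoeff]
    split_ifs
    · exact natDegree_rhsPoly_le _ _ _ _ _
    · rw [natDegree_neg]
      exact hmdeg k hk
  obtain ⟨t₅, s₅, e₅, ht₅, r₅, r₅'⟩ := runs_representationProg h₄ m₄
    (fun i j => by rw [k₄.fld 5 rfl, k₃.fld 5 rfl, k₂.fld 5 rfl, k₁.fld 5 rfl]; rfl) hv b₄ hsdeg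
  have k₅ := e₅.keeps
  have h₅ := h₄.of_keeps k₅ rfl rfl
  have m₅ := m₄.of_keeps k₅ rfl rfl
  set g := HahnSeries.ofPowerSeries ℤ (ZMod p) f / polyToLaurent (c 0) with hg
  set η := nonnegPart g with hη
  have hneg : negPart g = ∑ j ∈ Finset.range v, HahnSeries.single (-((j : ℤ) + 1)) (w j) :=
    negPart_quotient hc hq' hu
  have hbg : (b : PowerSeries (ZMod p)) = nonnegPart (-(mahlerOp K (monicCoeff c) (negPart g))) :=
    coe_rhsPoly hmdeg hneg
  have hg0 : mahlerOp K (monicCoeff c) g = 0 :=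
    mahlerOp_monicCoeff_eq_zero hc h₁.minimal.2.1
  obtain ⟨hηL, hηP⟩ := mahlerOp_nonnegPart hg0 hbg
  have hηa := eq_solvedCoeff_of_eq hηP
  have hη0 : s₅.fld 6 0 0 = PowerSeries.coeff 0 η := by
    rw [r₅', k₄.fld 17 rfl, r₃.2.2, hη, hg, coeff_nonnegPart_quotient hc hq' hu, zero_add]
  obtain ⟨t₆, s₆, e₆, ht₆, r₆⟩ := runs_valuesProg h₅ hL
    (fun l => by
      rw [k₅.nat 36 rfl, k₄.nat 36 rfl, k₃.nat 36 rfl, k₂.nat 36 rfl, k₁.nat 36 rfl]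
      simp [inputState]) r₅ hη0
    (fun i j => by
      rw [k₅.fld 18 rfl, k₄.fld 18 rfl, k₃.fld 18 rfl, k₂.fld 18 rfl, k₁.fld 18 rfl]; rfl)
    hηa (fun k hk => by
      rw [solvedCoeff, if_neg (by omega), natDegree_neg]
      exact natDegree_monicCoeff_le h₁.natDegree_le _)
  have k₆ := e₆.keeps
  have h₆ := h₅.of_keeps k₆ rfl rfl
  obtain ⟨t₇, s₇, e₇, ht₇, r₇⟩ := runs_outputProg h₆
  rw [← hQ] at ht₆
  have c₂ : ∀ k ≤ K, coeffC' s₂ k = monicCoeff c k := fun k hk =>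
    State.poly_eq (m₂.fld_2 k hk) (by rw [m₂.nat_8]; exact Nat.lt_succ_of_le (hmdeg k hk))
  have b₄' : storedRhs s₄ = b :=
    State.poly_eq b₄ (by rw [r₄]; exact Nat.lt_succ_of_le (natDegree_rhsPoly_le _ _ _ _ _))
  have a₅ : ∀ k ≤ K, repA s₅ k = solvedCoeff c b k := fun k hk =>
    State.poly_eq (r₅ k hk) (by rw [repD, m₅.nat_10]; exact Nat.lt_succ_of_le (hsdeg k hk))
  have hrep0 : repH0 s₅ = PowerSeries.constantCoeff η := by
    rw [repH0, hη0, PowerSeries.coeff_zero_eq_constantCoeff]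
  have hsec : ∀ r < p, ∀ j : FamilyIndex K (repD s₅), sectionOp p r (family K (repD s₅) η j) =
      ∑ i, repMatrix K (repD s₅) (repA s₅) r i j • family K (repD s₅) η i := fun r hr j => by
    refine section_family (fun k hk => ?_) ?_ hr j
    · rw [a₅ k hk, repD, m₅.nat_10]
      exact hsdeg k hk
    · rw [a₅ 0 (Nat.zero_le _)]
      refine hηa.trans (congrArg _ (Finset.sum_congr rfl fun k hk => ?_))
      rw [a₅ _ (Finset.mem_range.1 hk)]
  have hlin : IsLinearRepresentation η (repRow K (repD s₅) (repH0 s₅))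
      (repMatrix K (repD s₅) (repA s₅)) (repCol K (repD s₅)) := by
    rw [hrep0]
    exact isLinearRepresentation_of_section hsec
  have hterm : ∀ i ≤ (c 0).natDegree, i ≤ N → s₆.fld 7 0 i = PowerSeries.coeff (N - i) η :=
    fun i hi hiN => by
      rw [r₆ i (hi.trans (h₁.natDegree_le 0)), windowCoeff, if_pos hiN]
  have hout : s₇.fld 8 0 0 = ∑ i ∈ Finset.Icc (c 0).natTrailingDegree (c 0).natDegree,
      (c 0).coeff i * (if i ≤ N then storedTerm s₆ i else (negPart g).coeff ((N : ℤ) - i)) := by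
    rw [r₇]
    refine Finset.sum_congr rfl fun i _ => ?_
    split_ifs with hi
    · rfl
    -- For `i > N`, the coefficient of `g` at `N - i` is entry `i - N - 1` of the stored negative
    -- part, which is padded with zeros from `v` on.
    · rw [k₆.fld 3 rfl, k₅.fld 3 rfl, k₄.fld 3 rfl, r₃.2.1, coeff_negPart,
        if_pos (show (N : ℤ) - i < 0 by omega), hg,
        coeff_quotient hc hq' hu]
      split_ifs with h1 h2 h2
      · omega
      · congr 3
        omega
      · rfl
      · omega
  have hlow : lowDeg s₃ = v := h₃.nat_6.trans hv.symm
  refine ⟨![inputState p h d N E, s₁, s₂, s₃, s₄, s₅, s₆, s₇], ![t₁, t₂, t₃, t₄, t₅, t₆, t₇], K, c, g,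
    η, ?_, ?_, ?_⟩
  · intro i
    fin_cases i
    exacts [e₁, e₂, e₃, e₄, e₅, e₆, e₇]
  · exact {
      start := rfl
      order_eq := h₁.nat_4
      coeff_eq := fun k hk => State.poly_eq (h₁.fld_1 k hk)
        (h₁.nat_5.symm ▸ Nat.lt_succ_of_le (h₁.natDegree_le k))
      minimal := h₁.minimal
      trailing_ne_zero := hc
      lowDeg_eq := h₁.nat_6
      topDeg_eq := h₁.nat_7
      quotient_eq := hg
      nonneg_eq := hη
      monic_zero := (c₂ 0 (Nat.zero_le _)).trans (if_pos rfl)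
      monic_succ := fun k hk1 hk => (c₂ k hk).trans (if_neg (by omega))
      monic_eq := (mahlerOp_congr c₂ g).trans hg0
      lowDeg_eq' := h₃.nat_6
      trunc_eq := by
        change s₃.poly 3 0 (lowDeg s₃) = _
        ext n
        rw [hlow, ← hv, PowerSeries.coeff_trunc, State.poly, finsetSum_coeff]
        simp only [coeff_monomial, Finset.sum_ite_eq', Finset.mem_range, r₃.1]
        split_ifs <;> rfl
      neg_eq := by
        change ∑ j ∈ Finset.range (lowDeg s₃), HahnSeries.single (-((j : ℤ) + 1)) (s₃.fld 3 1 j) = _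
        rw [hlow, hneg]
        exact Finset.sum_congr rfl fun j hj => by rw [w₃ j (Finset.mem_range.1 hj)]
      rhs_eq := by
        change (storedRhs s₄ : PowerSeries (ZMod p)) =
          nonnegPart (-(mahlerOp K (coeffC' s₂) (negPart g)))
        rw [b₄', mahlerOp_congr c₂, hbg]
      inhomogeneous_eq := by
        change mahlerOp K (coeffC' s₂) _ = polyToLaurent (storedRhs s₄)
        rw [b₄', mahlerOp_congr c₂, hηL]
      repA_zero := (a₅ 0 (Nat.zero_le _)).trans b₄'.symm
      repA_succ := fun k hk1 hk => by
        change repA s₅ k = -coeffC' s₂ k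
        rw [a₅ k hk, c₂ k hk, solvedCoeff, if_neg (by omega)]
      repH0_eq := hrep0
      section_eq := hsec
      linearRepresentation := hlin
      -- The program found the coefficient of `η` by windows; the linear representation shows that
      -- it is the matrix product.
      term_eq := fun i _ hi hiN => (hterm i hi hiN).trans (hlin (N - i))
      output_eq := hout
      correct := by
        refine hout.trans ((Finset.sum_congr rfl fun i hi => ?_).trans
          (coeff_eq_sum_coeff_quotient hc N).symm)
        rw [← hg]
        split_ifs with hiN
        · rw [storedTerm, hterm i (Finset.mem_Icc.1 hi).2 hiN, hη, nonnegPart,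
            PowerSeries.coeff_mk, Nat.cast_sub hiN]
        · rw [coeff_negPart, if_pos (by omega)] }
  · rw [Fin.sum_univ_seven]
    change t₁ + t₂ + t₃ + t₄ + t₅ + t₆ + t₇ ≤ _
    omega

/-! ### The running time -/

/-- The total running time of the programs, in terms of bounds for the parameters. -/
theorem runningTime_le {d h p Q H σ M L : ℕ} (hd : 2 ≤ d) (hh : 1 ≤ h) (hp : 1 ≤ p) (hpQ : p ≤ Q)
    (hH : H = d * (Q * h)) (hσ : σ = (d + 2) * H + 1) (hM : M = H * Q) :
    (d + 1) * (d + 1) * (d + 1) * ((σ + 1) * (σ + 1) * 3000) +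
        ((d + 1) * ((M + 2 * H + 2) * (H * 500 + 1000)) + Q * 20) +
        ((H + 1) * ((H + 1) * 40 + 100) + 100) +
        ((d + 1) * ((M + 1) * (H * 60 + 100) + H * 50 + 100) + 20) +
        ((d + 1) * ((M + 1) * 50 + 50) + 50) +
        (L * ((d + 1) * ((2 * H + 1) * ((2 * H + 1) * 100 + 300) + Q * 50 + 200) + p * 100 + 300) +
          d * 30 + H * 30 + 300) +
        (H * 100 + 200) ≤ 1000000 * (d ^ 7 * (h ^ 2 * Q ^ 3) * (L + 1)) := by
  have h1 : 1 ≤ Q := hp.trans hpQ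
  have hdH : d ≤ H := by
    rw [hH]
    exact Nat.le_mul_of_pos_right _ (by positivity)
  have hQH : Q ≤ H := by
    rw [hH]
    nlinarith [Nat.le_mul_of_pos_right Q hh, Nat.le_mul_of_pos_left (Q * h) (by omega : 0 < d)]
  -- `W = d^3 h^2 Q^3` is the order of the cost of the monic equation, and `d^4 W` dominates the
  -- search, whose cost is of order `d^4 (d H^2)`. All bounds are expressed through these two.
  set W := d * H * H * Q with hW
  have e1 : d * H * H ≤ W := Nat.le_mul_of_pos_right _ h1
  have e2 : H * H ≤ d * H * H := by
    rw [mul_assoc]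
    exact Nat.le_mul_of_pos_left _ (by omega)
  have e3 : H ≤ H * H := Nat.le_mul_of_pos_right _ (by omega)
  have e4 : d * H ≤ d * H * H := Nat.le_mul_of_pos_right _ (by omega)
  have e5 : d * H * Q ≤ W := Nat.mul_le_mul_right _ e4
  have e6 : H * H * Q ≤ W := Nat.mul_le_mul_right _ e2
  have e7 : H * Q ≤ H * H * Q := Nat.mul_le_mul_right _ e3
  have e8 : d * Q ≤ d * H * Q := by
    rw [mul_assoc, mul_comm H, ← mul_assoc]
    exact Nat.le_mul_of_pos_right _ (by omega)
  have hT : d ^ 7 * (h ^ 2 * Q ^ 3) = d ^ 4 * W := by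
    rw [hW, hH]
    ring
  have hWT : W ≤ d ^ 4 * W := Nat.le_mul_of_pos_left _ (by positivity)
  have t1 : (d + 1) * (d + 1) * (d + 1) * ((σ + 1) * (σ + 1) * 3000) ≤
      216000 * (d ^ 4 * W) := by
    have a : σ + 1 ≤ 3 * (d * H) := by
      rw [hσ]
      nlinarith
    calc (d + 1) * (d + 1) * (d + 1) * ((σ + 1) * (σ + 1) * 3000) ≤
        (2 * d) * (2 * d) * (2 * d) * ((3 * (d * H)) * (3 * (d * H)) * 3000) := by
          gcongr <;> omega
      _ = 216000 * (d ^ 4 * (d * H * H)) := by ring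
      _ ≤ _ := by gcongr
  have t2 : (d + 1) * ((M + 2 * H + 2) * (H * 500 + 1000)) + Q * 20 ≤ 15020 * W := by
    calc (d + 1) * ((M + 2 * H + 2) * (H * 500 + 1000)) + Q * 20 ≤
        (2 * d) * ((H * Q + 2 * (H * Q) + 2 * (H * Q)) * (H * 500 + H * 1000)) + W * 20 := by
          rw [hM]
          have : H ≤ H * Q := Nat.le_mul_of_pos_right _ h1
          gcongr <;> omega
      _ = 15020 * W := by rw [hW]; ring
  have t3 : (H + 1) * ((H + 1) * 40 + 100) + 100 ≤ 1000 * W := by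
    nlinarith only [e1, e2, e3, hdH, hd]
  have t4 : (d + 1) * ((M + 1) * (H * 60 + 100) + H * 50 + 100) + 20 ≤ 2000 * W := by
    calc (d + 1) * ((M + 1) * (H * 60 + 100) + H * 50 + 100) + 20 ≤
        (2 * d) * ((H * Q + H * Q) * (H * 60 + H * 100) + H * H * Q * 50 + H * H * Q * 100) +
          W * 20 := by
          rw [hM]
          have : H ≤ H * Q := Nat.le_mul_of_pos_right _ h1
          gcongr <;> omega
      _ = 960 * W := by rw [hW]; ring
      _ ≤ _ := by gcongr; norm_num
  have t5 : (d + 1) * ((M + 1) * 50 + 50) + 50 ≤ 1000 * W := by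
    rw [hM]
    nlinarith only [e1, e2, e3, e4, e5, e6, e7, hdH, hd]
  have t6 : (d + 1) * ((2 * H + 1) * ((2 * H + 1) * 100 + 300) + Q * 50 + 200) + p * 100 + 300 ≤
      10000 * W := by
    have a1 : (2 * H + 1) * ((2 * H + 1) * 100 + 300) ≤ (3 * H) * (H * 600) :=
      Nat.mul_le_mul (by omega) (by omega)
    have a2 : (d + 1) * ((2 * H + 1) * ((2 * H + 1) * 100 + 300) + Q * 50 + 200) ≤
        (2 * d) * (H * H * 2100) := Nat.mul_le_mul (by omega) (by nlinarith only [a1, e3, hQH, hdH, hd])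
    have a3 : (2 * d) * (H * H * 2100) = 4200 * (d * H * H) := by ring
    omega
  have t7 : L * ((d + 1) * ((2 * H + 1) * ((2 * H + 1) * 100 + 300) + Q * 50 + 200) + p * 100 + 300)
      ≤ L * (10000 * W) := Nat.mul_le_mul_left _ t6
  have t8 : L * W ≤ L * (d ^ 4 * W) := Nat.mul_le_mul_left _ hWT
  have t9 : d * 30 + H * 30 + 300 ≤ 400 * W := by omega
  have t10 : H * 100 + 200 ≤ 300 * W := by omega
  rw [hT]
  calc _ ≤ 216000 * (d ^ 4 * W) + 15020 * W + 1000 * W + 2000 * W + 1000 * W +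
        (L * (10000 * W) + 400 * W) + 300 * W := by
        rw [add_assoc _ (d * 30) (H * 30), add_assoc _ (d * 30 + H * 30) 300]
        exact Nat.add_le_add (Nat.add_le_add (Nat.add_le_add (Nat.add_le_add (Nat.add_le_add
          (Nat.add_le_add t1 t2) t3) t4) t5) (Nat.add_le_add t7 t9)) t10
    _ = 216000 * (d ^ 4 * W) + 19720 * W + 10000 * (L * W) := by ring
    _ ≤ 1000000 * (d ^ 4 * W) + 1000000 * (L * (d ^ 4 * W)) := by omega
    _ = _ := by ring

/-- If the exponent is `l + 1`, then `l log 2` and `log 2` are both at most `log (N + 2)`, so `l +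
2` is at most `3 / log 2 < 5` times that logarithm. -/
theorem clog_add_one_le_log {p : ℕ} (hp : 2 ≤ p) (N : ℕ) :
    ((Nat.clog p (N + 1) + 1 : ℕ) : ℝ) ≤ 5 * Real.log ((N : ℝ) + 2) := by
  have hl := Real.log_two_gt_d9
  have h2 : Real.log 2 ≤ Real.log ((N : ℝ) + 2) :=
    Real.log_le_log (by norm_num) (by linarith [Nat.cast_nonneg (α := ℝ) N])
  rcases hL : Nat.clog p (N + 1) with _ | l
  · push_cast
    linarith
  · have h : p ^ l < N + 1 := (Nat.lt_clog_iff_pow_lt (by omega)).1 (by omega)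
    have h' : (2 : ℝ) ^ l ≤ (N : ℝ) + 2 := by
      have : 2 ^ l ≤ N + 2 := (Nat.pow_le_pow_left hp l).trans (by omega)
      exact_mod_cast this
    have h3 := Real.log_le_log (by positivity) h'
    rw [Real.log_pow] at h3
    push_cast
    nlinarith

/-- Since `B ≥ 2^(3d)`, one has `d ≤ log (B + 2)`, and the surplus factor `d^4` becomes the fourth
power of the logarithm. The constant is `1000000` times the `5` from the number of digits. -/
theorem natCast_le_softBound {d h p N : ℕ} (hd : 2 ≤ d) (hh : 1 ≤ h) (hp : 2 ≤ p) :
    ((1000000 * (d ^ 7 * (h ^ 2 * (p ^ d) ^ 3) * (Nat.clog p (N + 1) + 1)) : ℕ) : ℝ) ≤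
      softBound 5000000 4 ((d : ℝ) ^ 3 * (h : ℝ) ^ 2 * (p : ℝ) ^ (3 * d) *
        Real.log ((N : ℝ) + 2)) := by
  have hl := Real.log_two_gt_d9
  have hN : Real.log 2 ≤ Real.log ((N : ℝ) + 2) :=
    Real.log_le_log (by norm_num) (by linarith [Nat.cast_nonneg (α := ℝ) N])
  have hd' : (2 : ℝ) ≤ d := by exact_mod_cast hd
  have hh' : (1 : ℝ) ≤ h := by exact_mod_cast hh
  have hp' : (2 : ℝ) ≤ p := by exact_mod_cast hp
  set Λ := Real.log ((N : ℝ) + 2)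
  set B := (d : ℝ) ^ 3 * (h : ℝ) ^ 2 * (p : ℝ) ^ (3 * d) * Λ with hB
  have hP : (2 : ℝ) ^ (3 * d) ≤ B := by
    have h1 : (2 : ℝ) ^ (3 * d) ≤ (p : ℝ) ^ (3 * d) := by gcongr
    have h2 : (2 : ℝ) ^ 3 * 1 ^ 2 ≤ (d : ℝ) ^ 3 * (h : ℝ) ^ 2 := by gcongr
    have h3 : 1 ≤ (d : ℝ) ^ 3 * (h : ℝ) ^ 2 * Λ := by nlinarith
    rw [hB, mul_right_comm]
    exact h1.trans (le_mul_of_one_le_left (by positivity) h3)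
  have hB0 : 0 ≤ B := le_trans (by positivity) hP
  have hdB : (d : ℝ) ≤ Real.log (B + 2) := by
    have := Real.log_le_log (by positivity) (hP.trans (by linarith : B ≤ B + 2))
    rw [Real.log_pow] at this
    push_cast at this
    nlinarith
  have hc := clog_add_one_le_log hp N
  rw [softBound]
  calc _ = 1000000 * ((d : ℝ) ^ 3 * (h : ℝ) ^ 2 * (p : ℝ) ^ (3 * d)) *
        ((Nat.clog p (N + 1) + 1 : ℕ) : ℝ) * (d : ℝ) ^ 4 := by
        push_cast
        ring
    _ ≤ 1000000 * ((d : ℝ) ^ 3 * (h : ℝ) ^ 2 * (p : ℝ) ^ (3 * d)) * (5 * Λ) *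
        Real.log (B + 2) ^ 4 := by
          have hΛ : 0 ≤ Λ := by linarith
          gcongr
    _ = _ := by
        rw [hB]
        ring

end MahlerMethod

theorem theorem1 :
    ∃ P : Fin 7 → FieldRAM.Prog, ∃ C : ℝ, ∃ m : ℕ,
      ∀ (p : ℕ) [Fact p.Prime] (h d N : ℕ), 1 ≤ h → 2 ≤ d →
      ∀ E : Polynomial (Polynomial (ZMod p)),
        E.natDegree ≤ d → (∀ j, (E.coeff j).natDegree ≤ h) →
        E.evalEval 0 0 = 0 → (Polynomial.derivative E).evalEval 0 0 ≠ 0 →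
        (∃! f : PowerSeries (ZMod p), MahlerMethod.IsRoot E f) ∧
        ∀ f : PowerSeries (ZMod p), MahlerMethod.IsRoot E f →
          ∃ (s : Fin 8 → FieldRAM.State p) (t : Fin 7 → ℕ) (K : ℕ)
            (c : ℕ → Polynomial (ZMod p)) (g : LaurentSeries (ZMod p))
            (u : PowerSeries (ZMod p)),
            (∀ i : Fin 7, FieldRAM.Exec (P i) (s i.castSucc) (t i) (s i.succ)) ∧
            MahlerMethod.IsMahlerRun h d N E f s K c g u ∧
            ((∑ i, t i : ℕ) : ℝ) ≤
              softBound C m ((d : ℝ) ^ 3 * (h : ℝ) ^ 2 * (p : ℝ) ^ (3 * d) *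
                Real.log ((N : ℝ) + 2)) := by
  refine ⟨MahlerMethod.mahlerProgs, 5000000, 4, fun p _ h d N hh hd E hEd hEh h0 h1 => ?_⟩
  have hp := (Fact.out : p.Prime)
  have h00 : (E.coeff 0).coeff 0 = 0 := by
    simpa [Polynomial.evalEval, Polynomial.coeff_zero_eq_eval_zero] using h0
  have h01 : (E.coeff 1).coeff 0 ≠ 0 := by
    rw [Polynomial.evalEval, Polynomial.C_0, ← Polynomial.coeff_zero_eq_eval_zero,
      ← Polynomial.coeff_zero_eq_eval_zero, Polynomial.coeff_derivative] at h1
    simpa using h1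
  refine ⟨MahlerMethod.existsUnique_isRoot h00 h01, fun f hf => ?_⟩
  obtain ⟨s, t, K, c, g, u, he, hr, ht⟩ :=
    MahlerMethod.exists_isMahlerRun rfl rfl rfl rfl rfl hh hd hEd hEh h01 hf (N := N)
  refine ⟨s, t, K, c, g, u, he, hr, ?_⟩
  exact (Nat.cast_le.2 (ht.trans (MahlerMethod.runningTime_le hd hh hp.one_lt.le
    (Nat.le_self_pow (by omega) p) rfl rfl rfl))).trans
    (MahlerMethod.natCast_le_softBound hd hh hp.two_le)
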